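/- **Setting.** Let $m\ge 1$, and let $\mathcal D$ be a probability distribution of pairs $(a,b)\in\mathbb R^d\times\mathbb R$ with $b=a^\top x^\star$ almost surely for a fixed unknown $x^\star$, and with $\mathbb E\|a\|^4<\infty$. Put $f(x)=\mathbb E\,\tfrac12(a^\top x-b)^2$ and $\Sigma=\mathbb E[aa^\top]$. Let $0<\mu_1\le L_1<\mu_2\le L_2<\dots<\mu_m\le L_m$ be such that every eigenvalue of $\Sigma$ lies in $\bigcup_i[\mu_i,L_i]$; let $\bar d\le d$ be the largest number of eigenvalues (with multiplicity) in one band, $\kappa_i=L_i/\mu_i$, $\kappa=L_m/\mu_1$. Assume that for some orthogonal $P$ with $P\Sigma P^\top$ diagonal, $\mathbb E[(Pa)_i(Pa)_k^2(Pa)_j]=0$ for all $i,j,k$ with $i\ne j$; that $\mathbb E(w^\top a)^4\le C\,(\mathbb E(w^\top a)^2)^2$ for all $w\in\mathbb R^d$; and that $m\le\frac13\log\kappa$. **Algorithm.** For a batch size $n\geq 1$ and step counts $T_1,\dots,T_m$, the step $\mathrm{GD}(x;L)$ draws $n$ fresh samples $(a^{(j)},b^{(j)})$ and returns $x-\frac1L\cdot\frac1n\sum_{j}(a^{(j)\top}x-b^{(j)})a^{(j)}$.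 $\mathrm{BSLS}_i(x)$ repeats $T_i$ times "$x\leftarrow\mathrm{GD}(\mathrm{BSLS}_{i+1}(x);L_i)$" and then returns $\mathrm{BSLS}_{i+1}(x)$, where $\mathrm{BSLS}_{m+1}$ is the identity. Programs are real-register programs with arithmetic on single registers, constants, sign tests, loops of fixed length, and requests for a fresh sample; the input $x^{(0)}$ is given in $d$ registers, which hold the output at the end. The working space is the number of registers plus the number of nested loop counters. For $x^{(0)}\in\mathbb R^d$, $R\geq 0$ and $\eta>0$ put $$T_1(R,\eta)=\Big\lceil\kappa_1\log\tfrac{9R^2}{\eta}\Big\rceil,\qquad T_i(R,\eta)=8\lceil\kappa_i\log\kappa\rceil\quad(2\le i\le m),$$ where a negative value of $T_1$ is read as $0$. Write $r=\|x^{(0)}-x^\star\|$. 1. **Known bands, accuracy.** Let $\varepsilon>0$ and $n\ge C\,\bar d\,m^2\,(\prod_iT_i)(\max_iT_i)$ (in particular $n\ge C\,d\,m^2(\prod_iT_i)(\max_iT_i)$ suffices). (a) If $\varepsilon<9r^2$, and $T_1\ge\kappa_1\log(9r^2/\varepsilon)$, $T_i\ge8\kappa_i\log\kappa$ for $i\ge2$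 (in particular if $T_i=T_i(r,\varepsilon)$), then $\mathbb E\|\mathrm{BSLS}_1(x^{(0)})-x^\star\|^2\le\varepsilon$. (b) If $\varepsilon<9L_mr^2$, and $T_1\ge\kappa_1\log(9L_mr^2/\varepsilon)$, $T_i\ge8\kappa_i\log\kappa$ for $i\ge2$ (in particular if $T_i=T_i(r,\varepsilon/L_m)$), then $\mathbb E f(\mathrm{BSLS}_1(x^{(0)}))\le\min f+\varepsilon$. 2. **Known bands, cost.** If all $T_i\ge1$, then $\mathrm{BSLS}_1$ draws at most $n\,2^m\prod_iT_i$ samples, and it uses working space at most $6(d+m)$. 3. **Known bands, total number of samples.** There are constants $c_m$, depending only on $m$, such that whenever $0<\varepsilon<9L_mr^2$, there is a batch size $n\ge1$ for which $\mathrm{BSLS}_1$ with $T_i=T_i(r,\varepsilon/L_m)$ satisfies $\mathbb Ef(\mathrm{BSLS}_1(x^{(0)}))\le\min f+\varepsilon$ and draws at most $$c_m\,C\,\bar d\,\Big(\prod_{i}\kappa_i^2\Big)\,\log^{2(m-1)}(\kappa)\,\Big(1+\log\frac{9L_mr^2}{\varepsilon}\Big)^2$$ samples. 4. **Unknown bands.**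 There are constants $c_m$, depending only on $m$, such that for all $d,m,\mu_1,L_m,\pi,R,C,K$, $\varepsilon>0$ and $\delta\in(0,1)$ with $m\le\frac13\log(L_m/\mu_1)$ there is one program, whose working space plus program length is at most $c_m\,d\,\log^{2m}(L_m/\mu_1)$, with the following property. For all bands with the given $\mu_1$, $L_m$ and $\prod_i\kappa_i=\pi$, all $\mathcal D$ as in the setting that also satisfy $\|\Sigma^{-1/2}a\|\le K(\mathbb E\|\Sigma^{-1/2}a\|^2)^{1/2}$ almost surely, and all $x^{(0)}$ with $\|x^{(0)}-x^\star\|\le R$, its output $\hat x$ satisfies $f(\hat x)\le\min f+\varepsilon$ with probability at least $1-\delta$, and it always draws at most $$c_m\,K^2d\log\frac{4d}\delta\Big(1+\sqrt{\varepsilon/\delta}\Big)\cdot\Big(n_0\,2^m\prod_iT_i\Big)$$ samples, where $T_i=T_i(R,\varepsilon/L_m)$ are the step counts of the actual bands and $n_0=C\,d\,m^2(\prod_iT_i)(\max_iT_i)$. -/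

import Mathlib

open MeasureTheory

noncomputable section

namespace StochBSLS

/-! ### The stochastic quadratic multiscale optimization problem -/

abbrev Vec (d : ℕ) := EuclideanSpace ℝ (Fin d)

/-- A sample `(a, b)`: a covariate vector together with its label. -/
abbrev Sample (d : ℕ) := Vec d × ℝ

/-- The matrix `Σ = E[a aᵀ]`. -/
def covariance {d : ℕ} (𝒟 : Measure (Sample d)) : Matrix (Fin d) (Fin d) ℝ :=
  Matrix.of fun i j => ∫ z, z.1 i * z.1 j ∂𝒟

/-- The objective `E[(aᵀx - b)² / 2]`. -/
def objective {d : ℕ} (𝒟 : Measure (Sample d)) (x : Vec d) : ℝ :=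
  ∫ z, (1 / 2) * (inner ℝ z.1 x - z.2) ^ 2 ∂𝒟

/-- Positive, increasing, pairwise disjoint bands `[lo i, hi i]`. -/
structure Bands (m : ℕ) where
  lo : Fin m → ℝ
  hi : Fin m → ℝ
  lo_pos : ∀ i, 0 < lo i
  lo_le_hi : ∀ i, lo i ≤ hi i
  hi_lt_lo : ∀ i j, i < j → hi i < lo j

/-- The condition number of one band. -/
def Bands.cond {m : ℕ} (β : Bands m) (i : Fin m) : ℝ := β.hi i / β.lo i

/-- The global condition number: top of the last band over bottom of the first band. -/
def Bands.globalCond {m : ℕ} [NeZero m] (β : Bands m) : ℝ := β.hi ⊤ / β.lo 0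

/-- The product of the condition numbers of the bands. -/
def Bands.condProd {m : ℕ} (β : Bands m) : ℝ := ∏ i, β.cond i

/-- The largest number of eigenvalues (with multiplicity) in one band. -/
def maxMult {d m : ℕ} (band : Fin d → Fin m) : ℕ :=
  Finset.univ.sup fun i => (Finset.univ.filter fun k => band k = i).card

/-- The stochastic quadratic multiscale optimization problem with its distributional assumptions.
The orthonormal eigenbasis `u` consists of the rows of the orthogonal matrix `P` that
diagonalizes the covariance, so `⟪u k, a⟫ = (P a)_k`; `lam k` is the corresponding eigenvalue and
`band k` the band that it lies in. -/
structure Problem {d m : ℕ} [NeZero m] (𝒟 : Measure (Sample d)) (xopt : Vec d) (β : Bands m)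
    (u : OrthonormalBasis (Fin d) ℝ (Vec d)) (lam : Fin d → ℝ) (band : Fin d → Fin m)
    (C : ℝ) : Prop where
  label : ∀ᵐ z ∂𝒟, z.2 = inner ℝ z.1 xopt
  fourth_moment : MemLp (fun z : Sample d => z.1) 4 𝒟
  eigen : ∀ k, (covariance 𝒟).mulVec (u k) = lam k • (fun i => u k i)
  mem_band : ∀ k, lam k ∈ Set.Icc (β.lo (band k)) (β.hi (band k))
  second_order_indep : ∀ i j k, i ≠ j →
    ∫ z, inner ℝ (u i) z.1 * (inner ℝ (u k) z.1) ^ 2 * inner ℝ (u j) z.1 ∂𝒟 = 0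
  kurtosis : ∀ w : Vec d,
    ∫ z, (inner ℝ w z.1) ^ 4 ∂𝒟 ≤ C * (∫ z, (inner ℝ w z.1) ^ 2 ∂𝒟) ^ 2
  bands_le_log : (m : ℝ) ≤ Real.log β.globalCond / 3

/-- `Σ^(-1/2) a`, where `Σ` has orthonormal eigenbasis `u` with eigenvalues `lam`. -/
def invSqrtCov {d : ℕ} (u : OrthonormalBasis (Fin d) ℝ (Vec d)) (lam : Fin d → ℝ) (a : Vec d) :
    Vec d :=
  ∑ k, ((Real.sqrt (lam k))⁻¹ * inner ℝ (u k) a) • u k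

/-- The boundedness assumption `‖Σ^(-1/2) a‖ ≤ K (E ‖Σ^(-1/2) a‖²)^(1/2)`, almost surely. -/
def BoundedBy {d : ℕ} (𝒟 : Measure (Sample d)) (u : OrthonormalBasis (Fin d) ℝ (Vec d))
    (lam : Fin d → ℝ) (K : ℝ) : Prop :=
  ∀ᵐ z ∂𝒟, ‖invSqrtCov u lam z.1‖ ≤ K * Real.sqrt (∫ y, ‖invSqrtCov u lam y.1‖ ^ 2 ∂𝒟)

/-- The law of an infinite sequence of independent samples. -/
abbrev sampleStream {d : ℕ} (𝒟 : Measure (Sample d)) [IsProbabilityMeasure 𝒟] :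
    Measure (ℕ → Sample d) :=
  Measure.infinitePi fun _ => 𝒟

/-! ### Streaming programs

A program works on finitely many real registers: `d` registers hold the input vector at the start
and the output vector at the end, and the work registers, indexed by `W`, start at `0`. It can
do arithmetic on single registers, request a fresh sample (which overwrites `d + 1` registers),
branch on the sign of a register, and repeat a block a fixed number of times. -/

abbrev Reg (d : ℕ) (W : Type) := Fin d ⊕ W

inductive Prog (d : ℕ) (W : Type) : Type
  | skip : Prog d W
  | const (i : Reg d W) (c : ℝ) : Prog d W
  | add (i j k : Reg d W) : Prog d W
  | sub (i j k : Reg d W) : Prog d W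
  | mul (i j k : Reg d W) : Prog d W
  | div (i j k : Reg d W) : Prog d W
  | query (a : Fin d → Reg d W) (b : Reg d W) : Prog d W
  | seq (p q : Prog d W) : Prog d W
  | loop (n : ℕ) (p : Prog d W) : Prog d W
  | ifPos (i : Reg d W) (p q : Prog d W) : Prog d W

namespace Prog

variable {d : ℕ} {W : Type}

/-- The contents of the registers and the number of samples requested so far. -/
abbrev Config (d : ℕ) (W : Type) := (Reg d W → ℝ) × ℕ

/-- Execution on a given stream of samples; `i j k` as operands mean `i := j ∘ k`. -/
def exec [DecidableEq W] (z : ℕ → Sample d) : Prog d W → Config d W → Config d W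
  | skip, σ => σ
  | const i c, σ => (Function.update σ.1 i c, σ.2)
  | add i j k, σ => (Function.update σ.1 i (σ.1 j + σ.1 k), σ.2)
  | sub i j k, σ => (Function.update σ.1 i (σ.1 j - σ.1 k), σ.2)
  | mul i j k, σ => (Function.update σ.1 i (σ.1 j * σ.1 k), σ.2)
  | div i j k, σ => (Function.update σ.1 i (σ.1 j / σ.1 k), σ.2)
  | query a b, σ =>
      (Function.update (Function.extend a (fun k => (z σ.2).1 k) σ.1) b (z σ.2).2, σ.2 + 1)
  | seq p q, σ => exec z q (exec z p σ)
  | loop n p, σ => (exec z p)^[n] σ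
  | ifPos i p q, σ => if 0 < σ.1 i then exec z p σ else exec z q σ

/-- The input in its registers, the work registers at `0`, and no sample requested. -/
def start (x : Vec d) : Config d W := (Sum.elim (fun k => x k) (fun _ => 0), 0)

/-- The output vector on input `x` and sample stream `z`. -/
def result [DecidableEq W] (p : Prog d W) (x : Vec d) (z : ℕ → Sample d) : Vec d :=
  WithLp.toLp 2 fun k => (p.exec z (start x)).1 (Sum.inl k)

/-- The number of samples requested on input `x` and sample stream `z`. -/
def queries [DecidableEq W] (p : Prog d W) (x : Vec d) (z : ℕ → Sample d) : ℕ :=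
  (p.exec z (start x)).2

/-- The maximal nesting of loops, that is, the number of loop counters that are kept. -/
def loopDepth : Prog d W → ℕ
  | seq p q => max (loopDepth p) (loopDepth q)
  | loop _ p => loopDepth p + 1
  | ifPos _ p q => max (loopDepth p) (loopDepth q)
  | _ => 0

/-- Working space, in numbers stored: all registers and all loop counters. -/
def space [Fintype W] (p : Prog d W) : ℕ := Fintype.card (Reg d W) + p.loopDepth

/-- The length of the program text (a loop body is counted once). -/
def length : Prog d W → ℕ
  | skip => 0
  | query _ _ => d + 1
  | seq p q => length p + length q
  | loop _ p => length p + 1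
  | ifPos _ p q => length p + length q + 1
  | _ => 1

/-- Run `f k` for each coordinate `k` in turn. -/
def forEach (f : Fin d → Prog d W) : Prog d W :=
  (List.finRange d).foldr (fun k p => seq (f k) p) skip

end Prog

/-! ### The stochastic Big-Step-Little-Step algorithm -/

/-- Work registers of stochastic BSLS: the gradient `g`, the sample `(a, b)`, three more scalars. -/
abbrev Work (d : ℕ) := (Fin d ⊕ Fin d) ⊕ Fin 4

section Algorithm

variable {d : ℕ}

abbrev xReg (k : Fin d) : Reg d (Work d) := Sum.inl k
abbrev gReg (k : Fin d) : Reg d (Work d) := Sum.inr (Sum.inl (Sum.inl k))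
abbrev aReg (k : Fin d) : Reg d (Work d) := Sum.inr (Sum.inl (Sum.inr k))
abbrev bReg : Reg d (Work d) := Sum.inr (Sum.inr 0)
abbrev sReg : Reg d (Work d) := Sum.inr (Sum.inr 1)
abbrev tReg : Reg d (Work d) := Sum.inr (Sum.inr 2)
abbrev cReg : Reg d (Work d) := Sum.inr (Sum.inr 3)

open Prog

/-- Draw `(a, b)` and update `g ← g + (1/n) (aᵀx - b) a`. -/
def accumulate (d n : ℕ) : Prog d (Work d) :=
  seq (query aReg bReg) <|
  seq (const sReg 0) <|
  seq (forEach fun k => seq (mul tReg (aReg k) (xReg k)) (add sReg sReg tReg)) <|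
  seq (sub sReg sReg bReg) <|
  seq (const cReg (1 / (n : ℝ))) <|
  seq (mul sReg cReg sReg) <|
  forEach fun k => seq (mul tReg sReg (aReg k)) (add (gReg k) (gReg k) tReg)

/-- The minibatch step `x ← x - (1/L) g` with `g = (1/n) ∑ (aᵀx - b) a` over `n` fresh samples. -/
def gdStoch (d n : ℕ) (L : ℝ) : Prog d (Work d) :=
  seq (forEach fun k => const (gReg k) 0) <|
  seq (loop n (accumulate d n)) <|
  seq (const cReg (1 / L)) <|
  forEach fun k => seq (mul tReg cReg (gReg k)) (sub (xReg k) (xReg k) tReg)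

/-- The recursion, for the list of the pairs `(T_i, L_i)` of the current and the later bands. -/
def bslsList (d n : ℕ) : List (ℕ × ℝ) → Prog d (Work d)
  | [] => skip
  | (T, L) :: rest =>
      seq (loop T (seq (bslsList d n rest) (gdStoch d n L))) (bslsList d n rest)

/-- Stochastic BSLS from the first band on, with batch size `n`, step counts `T`, and step size
`1 / L i` in band `i`. -/
def bslsStoch (d n : ℕ) {m : ℕ} (T : Fin m → ℕ) (L : Fin m → ℝ) : Prog d (Work d) :=
  bslsList d n ((List.finRange m).map fun i => (T i, L i))

end Algorithm

/-- `T_1 = ⌈κ_1 log (9 R² / ε)⌉` and `T_i = 8 ⌈κ_i log κ⌉` for the later bands. -/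
def stepCount {m : ℕ} [NeZero m] (β : Bands m) (R ε : ℝ) (i : Fin m) : ℕ :=
  if i = 0 then ⌈β.cond i * Real.log (9 * R ^ 2 / ε)⌉₊
  else 8 * ⌈β.cond i * Real.log β.globalCond⌉₊

/-- Step counts that are at least as large as the prescribed ones, before any rounding. -/
def SufficientSteps {m : ℕ} [NeZero m] (β : Bands m) (R ε : ℝ) (T : Fin m → ℕ) : Prop :=
  β.cond 0 * Real.log (9 * R ^ 2 / ε) ≤ T 0 ∧
    ∀ i, i ≠ 0 → 8 * (β.cond i * Real.log β.globalCond) ≤ T i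

/-- The batch size `C D m² (∏ T_i) (max T_i)`, where `D` is the dimension or a bound for the number
of eigenvalues per band. -/
def batchSize {m : ℕ} (C D : ℝ) (T : Fin m → ℕ) : ℝ :=
  C * D * (m : ℝ) ^ 2 * (∏ i, (T i : ℝ)) * ((Finset.univ.sup T : ℕ) : ℝ)

/-- `x` is `ε`-optimal for the objective. -/
def IsOptimal {d : ℕ} (𝒟 : Measure (Sample d)) (ε : ℝ) (x : Vec d) : Prop :=
  ∀ y, objective 𝒟 x ≤ objective 𝒟 y + ε

/-- The output of `p` on input `x` is `ε`-optimal in expectation over the samples. -/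
def OptimalInExpectation {d : ℕ} {W : Type} [DecidableEq W] (𝒟 : Measure (Sample d))
    [IsProbabilityMeasure 𝒟] (p : Prog d W) (x : Vec d) (ε : ℝ) : Prop :=
  Integrable (fun z => objective 𝒟 (p.result x z)) (sampleStream 𝒟) ∧
    ∀ y, ∫ z, objective 𝒟 (p.result x z) ∂(sampleStream 𝒟) ≤ objective 𝒟 y + ε

end StochBSLS

end

noncomputable section

namespace StochBSLS

/-! ### Second moments per band: the deterministic recursion -/

section BandRecursion

open Finset

variable {m : ℕ}

/-! Only the expected squared errors `V j` per band have to be followed. In the eigenbasis,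
second-order independence removes the cross terms from the second moment of a stochastic gradient,
and the kurtosis bound controls the diagonal ones. So one minibatch step of size `1 / L p` maps `V`
to at most `bandStep`: bands before `p` are preserved, band `p` contracts by `(1 - 1 / κ p) ^ 2`,
later bands grow by `(L j / L p) ^ 2`, and noise of rank one and size `γ = C D / n` is added, where
`D` bounds the number of eigenvalues per band. Since each batch is fresh, it can be integrated out
first (`lintegral_block`), and since `bandStep` is linear with nonnegative coefficients, the bound
passes to expectations along the whole run (`Problem.lintegral_bandSq_gdRun_le`).

The growth of the later bands is harmless because each step follows a run of exactly these bands.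
`Damps` expresses what such a run does: later bands are damped by `h`, and everything else is a
coupling `a` weighted by `min (L j / L p) (L p / L j)` on both sides. This form survives the passage
from band `p` to the preceding one (`Damps.shift`). The coupling obeys `1 + m a = (1 + m γ) ^
(number of steps)`, so no power of the global condition number enters the noise; the damping stays
at most `1 / (4 m)` because `8 κ log κ` rounds gain the eighth power of the condition number and the
change of center loses its square. Induction from the last band to the first (`damps_schedule`),
with `Damps.total` for the first band, gives a contraction `exp (-T 0 / κ 0)` up to a constant as
soon as `m γ ∏ T` is small. This fixes the batch size.

On the side of programs, the recursion is flattened into a list of steps, and execution is shown to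
follow that list (`exec_bslsList`); the number of steps is `∏ (T i + 1) - 1`.

For unknown bands, tops and condition numbers are guessed up to constant factors, on a grid with
about `(log κ) ^ (2 m)` points. All guesses run on the same samples, so their number costs space but
hardly any samples. To share one loop, each run reads its step sizes from a mixed-radix counter that
shows zeros after its end. Afterwards all candidates are tested on fresh samples: Markov's
inequality makes the right guess pass, and an exponential lower-tail bound for nonnegative variables
with bounded kurtosis (`pi_sum_lt_le`) rejects every bad candidate. -/

/-- The weights that decay, in the ratio of the band tops, to both sides of the band `p`. -/
def bandWeight (L : Fin m → ℝ) (p j : Fin m) : ℝ := if j ≤ p then L j / L p else L p / L j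

/-- An upper bound for the effect of one step of size `1 / L p` on the second moments per band. -/
def bandStep (L σ : Fin m → ℝ) (γ : ℝ) (V : Fin m → ℝ) (p : Fin m) : Fin m → ℝ := fun j =>
  (if j < p then 1 else if j = p then σ p else (L j / L p) ^ 2) * V j +
    γ * (L j / L p) * ∑ k, L k / L p * V k

/-- `S` almost preserves the bands up to `p` and damps the later ones, with couplings `a`, `h`. -/
def Damps (w : Fin m → ℝ) (p : Fin m) (a h : ℝ) (S : (Fin m → ℝ) → Fin m → ℝ) : Prop :=
  ∀ V : Fin m → ℝ, 0 ≤ V → 0 ≤ S V ∧ (∀ j ≤ p, S V j ≤ V j + a * w j * ∑ k, w k * V k) ∧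
    ∀ j, p < j → S V j ≤ h * w j * ∑ k ∈ Ioi p, w k * V k + a * w j * ∑ k, w k * V k

lemma sum_eq_Iio_add_self_add_Ioi (p : Fin m) (f : Fin m → ℝ) :
    ∑ k, f k = ∑ k ∈ Iio p, f k + f p + ∑ k ∈ Ioi p, f k := by
  have h : (univ : Finset (Fin m)) = Iio p ∪ insert p (Ioi p) := by
    ext k; simp only [mem_univ, mem_union, mem_Iio, mem_insert, mem_Ioi, true_iff]
    rcases lt_trichotomy k p with h | h | h <;> simp [h]
  rw [h, sum_union, sum_insert (by simp)]
  · ring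
  · rw [disjoint_left]
    intro k hk hk'
    simp only [mem_Iio, mem_insert, mem_Ioi] at hk hk'
    rcases hk' with h | h
    · exact absurd hk (by simp [h])
    · exact absurd hk (not_lt.2 h.le)

lemma card_Iio_add_card_Ioi (p : Fin m) :
    (#(Iio p) : ℝ) + 1 + #(Ioi p) = m := by
  have h := sum_eq_Iio_add_self_add_Ioi p (fun _ => (1 : ℝ))
  simpa using h.symm

/-- The weights `w` and `y` of one level of the recursion, with center `p`. -/
structure LevelWeights (y w : Fin m → ℝ) (p : Fin m) : Prop where
  y_nonneg : ∀ j, 0 ≤ y j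
  w_nonneg : ∀ j, 0 ≤ w j
  w_le_one : ∀ j, w j ≤ 1
  w_self : w p = 1
  w_eq : ∀ j ≤ p, w j = y j
  y_mul_w : ∀ j, p < j → y j * w j = 1

/-- The effect of one step that follows a damping map. -/
def StepBound (y w : Fin m → ℝ) (p : Fin m) (ς b h : ℝ) (X : (Fin m → ℝ) → Fin m → ℝ) : Prop :=
  ∀ V : Fin m → ℝ, 0 ≤ V → 0 ≤ X V ∧ (∀ j < p, X V j ≤ V j + b * w j * ∑ k, w k * V k) ∧
    X V p ≤ ς * V p + b * ∑ k, w k * V k ∧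
    ∀ j, p < j → X V j ≤ y j * (h * ∑ k ∈ Ioi p, w k * V k + b * ∑ k, w k * V k)

/-- The shape of the moments after some steps from `V`. -/
structure IterBound (y w : Fin m → ℝ) (p : Fin m) (V : Fin m → ℝ) (Q Z Z' s d c : ℝ)
    (U : Fin m → ℝ) : Prop where
  nonneg : 0 ≤ U
  low : ∀ j < p, U j ≤ V j + w j * (c * Z')
  self : U p ≤ s * V p + (d * Q + c * Z)
  high : ∀ j, p < j → U j ≤ y j * (s / m * ∑ k ∈ Ioi p, w k * V k + (d * Q + c * Z))

lemma LevelWeights.sum_mul_le {y w : Fin m → ℝ} {p : Fin m} (hw : LevelWeights y w p) :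
    ∑ j, y j * w j ≤ m := by
  calc ∑ j, y j * w j ≤ ∑ _j : Fin m, (1 : ℝ) := by
        refine sum_le_sum fun j _ => ?_
        rcases le_or_gt j p with h | h
        · rw [← hw.w_eq j h]; nlinarith [hw.w_nonneg j, hw.w_le_one j]
        · exact (hw.y_mul_w j h).le
    _ = m := by simp

lemma sum_w_nonneg {w V : Fin m → ℝ} (hw : ∀ j, 0 ≤ w j) (hV : 0 ≤ V) (s : Finset (Fin m)) :
    0 ≤ ∑ k ∈ s, w k * V k := sum_nonneg fun k _ => mul_nonneg (hw k) (hV k)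

/-- The two weighted sums of the moments after some steps. -/
lemma IterBound.sums {y w : Fin m → ℝ} {p : Fin m} (hw : LevelWeights y w p) {V U : Fin m → ℝ}
    (hV : 0 ≤ V) {P Q Z Z' s d c : ℝ} (hP : P = ∑ k ∈ Iio p, w k * V k)
    (hQ : Q = V p + ∑ k ∈ Ioi p, w k * V k)
    (hZ : (∑ k ∈ Iio p, w k ^ 2) * Z' ≤ #(Iio p) * Z) (hZ0 : 0 ≤ Z)
    (hs : 0 ≤ s) (hd : 0 ≤ d) (hc : 0 ≤ c)
    (h : IterBound y w p V Q Z Z' s d c U) :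
    ∑ k, w k * U k ≤ P + (s + m * d) * Q + m * (c * Z) ∧
    ∑ k ∈ Ioi p, w k * U k ≤ s * (∑ k ∈ Ioi p, w k * V k) + m * (d * Q + c * Z) := by
  set W := ∑ k ∈ Ioi p, w k * V k with hW
  have hW0 : 0 ≤ W := sum_w_nonneg hw.w_nonneg hV _
  have hQ0 : 0 ≤ Q := by rw [hQ]; exact add_nonneg (hV p) hW0
  have hm : (0 : ℝ) < m := by
    have := p.pos
    exact_mod_cast this
  have hcard := card_Iio_add_card_Ioi p
  have h1 : ∑ k ∈ Iio p, w k * U k ≤ P + c * (#(Iio p) * Z) := by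
    calc ∑ k ∈ Iio p, w k * U k ≤ ∑ k ∈ Iio p, (w k * V k + c * (w k ^ 2 * Z')) := by
          refine sum_le_sum fun k hk => ?_
          have := mul_le_mul_of_nonneg_left (h.low k (mem_Iio.1 hk)) (hw.w_nonneg k)
          linarith
      _ = P + c * ((∑ k ∈ Iio p, w k ^ 2) * Z') := by
          rw [sum_add_distrib, hP, ← mul_sum, sum_mul]
      _ ≤ _ := by
          have := mul_le_mul_of_nonneg_left hZ hc
          linarith
  have h2 : ∑ k ∈ Ioi p, w k * U k ≤ #(Ioi p) * (s / m * W + (d * Q + c * Z)) := by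
    calc ∑ k ∈ Ioi p, w k * U k ≤ ∑ k ∈ Ioi p, (s / m * W + (d * Q + c * Z)) := by
          refine sum_le_sum fun k hk => ?_
          have h3 := mul_le_mul_of_nonneg_left (h.high k (mem_Ioi.1 hk)) (hw.w_nonneg k)
          have h4 := hw.y_mul_w k (mem_Ioi.1 hk)
          calc w k * U k ≤ _ := h3
            _ = (y k * w k) * (s / m * W + (d * Q + c * Z)) := by rw [hW]; ring
            _ = _ := by rw [h4, one_mul]
      _ = _ := by rw [sum_const, nsmul_eq_mul]
  -- The factor `1 / m` in the clause `high` pays for the sum over at most `m` later bands.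
  have h5 : (#(Ioi p) : ℝ) * (s / m * W) ≤ s * W := by
    have h6 : (#(Ioi p) : ℝ) ≤ m := by
      have : (0 : ℝ) ≤ #(Iio p) := Nat.cast_nonneg _
      linarith
    calc (#(Ioi p) : ℝ) * (s / m * W) ≤ m * (s / m * W) :=
          mul_le_mul_of_nonneg_right h6 (by positivity)
      _ = s * W := by field_simp
  have hdc : 0 ≤ d * Q + c * Z := by positivity
  constructor
  · rw [sum_eq_Iio_add_self_add_Ioi p, hw.w_self, one_mul]
    have h7 := h.self
    have h8 : s * Q = s * V p + s * W := by rw [hQ]; ring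
    have h9 : (m : ℝ) * (d * Q + c * Z) =
        (#(Iio p)) * (d * Q) + #(Iio p) * (c * Z) + (d * Q + c * Z) +
          #(Ioi p) * (d * Q + c * Z) := by
      rw [← hcard]; ring
    have h10 : (0 : ℝ) ≤ #(Iio p) * (d * Q) := by positivity
    nlinarith
  · have h11 : (#(Ioi p) : ℝ) * (d * Q + c * Z) ≤ m * (d * Q + c * Z) := by
      refine mul_le_mul_of_nonneg_right ?_ hdc
      have : (0 : ℝ) ≤ #(Iio p) := Nat.cast_nonneg _
      linarith
    linarith

/-- `Z` bounds the influence of the earlier bands on the bands from `p` on, `Z'` that of all bands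
on the earlier ones. Two scales are possible because what an earlier band gains returns with its
squared weight, which is the content of `hZ`. The coefficients satisfy `s + m d ↦ (ς + m b) (s + m
d)` and `1 + m c ↦ (1 + m b) (1 + m c)`. The condition `hsd` is guarded by `j < p`, so it is void
for the first band, where `ς + m b` may exceed `1`. -/
lemma IterBound.step {y w : Fin m → ℝ} {p : Fin m} (hw : LevelWeights y w p) {V U : Fin m → ℝ}
    (hV : 0 ≤ V) {P Q Z Z' s d c ς b h : ℝ} (hP : P = ∑ k ∈ Iio p, w k * V k)
    (hQ : Q = V p + ∑ k ∈ Ioi p, w k * V k)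
    (hZ : (∑ k ∈ Iio p, w k ^ 2) * Z' ≤ #(Iio p) * Z) (hPZ : P ≤ Z) (hPQ : P + Q ≤ Z')
    (hZZ : Z ≤ Z') (hs : 0 ≤ s) (hd : 0 ≤ d) (hc : 0 ≤ c) (hb : 0 ≤ b) (hh : 0 ≤ h)
    (hς : ς ≤ 1) (hmh : m * h ≤ ς) (hsd : ∀ j, j < p → s + m * d ≤ 1)
    {X : (Fin m → ℝ) → Fin m → ℝ} (hX : StepBound y w p ς b h X)
    (hU : IterBound y w p V Q Z Z' s d c U) :
    IterBound y w p V Q Z Z' (ς * s) (ς * d + b * s + m * b * d) (c + b + m * b * c) (X U) := by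
  set W := ∑ k ∈ Ioi p, w k * V k with hW
  have hW0 : 0 ≤ W := sum_w_nonneg hw.w_nonneg hV _
  have hP0 : 0 ≤ P := by rw [hP]; exact sum_w_nonneg hw.w_nonneg hV _
  have hQ0 : 0 ≤ Q := by rw [hQ]; exact add_nonneg (hV p) hW0
  have hZ0 : 0 ≤ Z := hP0.trans hPZ
  have hm : (0 : ℝ) < m := by exact_mod_cast p.pos
  have hς0 : 0 ≤ ς := le_trans (by positivity) hmh
  obtain ⟨hT, hH⟩ := hU.sums hw hV hP hQ hZ hZ0 hs hd hc
  rw [← hW] at hH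
  obtain ⟨h0, h1, h2, h3⟩ := hX U hU.nonneg
  set T := ∑ k, w k * U k
  set H := ∑ k ∈ Ioi p, w k * U k
  have hbT : b * T ≤ b * P + b * s * Q + m * b * d * Q + m * b * c * Z := by
    have := mul_le_mul_of_nonneg_left hT hb
    linarith
  have hbZ : b * P ≤ b * Z := mul_le_mul_of_nonneg_left hPZ hb
  have hςc : ς * (c * Z) ≤ c * Z := mul_le_of_le_one_left (by positivity) hς
  refine ⟨h0, fun j hj => ?_, ?_, fun j hj => ?_⟩
  · have h4 : T ≤ Z' + m * (c * Z') := by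
      have h5 : (s + m * d) * Q ≤ Q := mul_le_of_le_one_left hQ0 (hsd j hj)
      have h6 : m * (c * Z) ≤ m * (c * Z') := by gcongr
      linarith
    have h7 := mul_le_mul_of_nonneg_left h4 (mul_nonneg hb (hw.w_nonneg j))
    have h8 := hU.low j hj
    have h9 := h1 j hj
    nlinarith
  · have h4 := mul_le_mul_of_nonneg_left hU.self hς0
    linarith
  · refine (h3 j hj).trans (mul_le_mul_of_nonneg_left ?_ (hw.y_nonneg j))
    have h4 : h * H ≤ ς * (s / m * W + (d * Q + c * Z)) := by
      calc h * H ≤ h * (s * W + m * (d * Q + c * Z)) := mul_le_mul_of_nonneg_left hH hh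
        _ = (m * h) * (s / m * W + (d * Q + c * Z)) := by field_simp
        _ ≤ _ := mul_le_mul_of_nonneg_right hmh (by positivity)
    have h5 : ς * s / m * W = ς * (s / m * W) := by ring
    rw [h5]
    linarith

/-- The coefficients of the moments after `t` steps. -/
lemma IterBound.iterate {y w : Fin m → ℝ} {p : Fin m} (hw : LevelWeights y w p) {V : Fin m → ℝ}
    (hV : 0 ≤ V) {P Q Z Z' ς b h : ℝ} (hP : P = ∑ k ∈ Iio p, w k * V k)
    (hQ : Q = V p + ∑ k ∈ Ioi p, w k * V k)
    (hZ : (∑ k ∈ Iio p, w k ^ 2) * Z' ≤ #(Iio p) * Z) (hPZ : P ≤ Z) (hPQ : P + Q ≤ Z')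
    (hZZ : Z ≤ Z') (hb : 0 ≤ b) (hh : 0 ≤ h) (hς : ς ≤ 1)
    (hςb : ∀ j, j < p → ς + m * b ≤ 1) (hmh : m * h ≤ ς)
    {X : (Fin m → ℝ) → Fin m → ℝ} (hX : StepBound y w p ς b h X) {t : ℕ} (ht : t ≠ 0) :
    IterBound y w p V Q Z Z' (ς ^ t) (((ς + m * b) ^ t - ς ^ t) / m)
      (((1 + m * b) ^ t - 1) / m) (X^[t] V) := by
  have hm : (0 : ℝ) < m := by exact_mod_cast p.pos
  have hς0 : 0 ≤ ς := le_trans (by positivity) hmh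
  have hmb : 0 ≤ m * b := by positivity
  have hP0 : 0 ≤ P := by rw [hP]; exact sum_w_nonneg hw.w_nonneg hV _
  have hW0 : 0 ≤ ∑ k ∈ Ioi p, w k * V k := sum_w_nonneg hw.w_nonneg hV _
  have hQ0 : 0 ≤ Q := by rw [hQ]; exact add_nonneg (hV p) hW0
  -- The induction has to start at one step: the factor `1 / m` in `high` comes from the damping `h
  -- ≤ ς / m` and is absent before the first step.
  obtain ⟨t, rfl⟩ := Nat.exists_eq_add_one_of_ne_zero ht
  clear ht
  induction t with
  | zero =>
    obtain ⟨h0, h1, h2, h3⟩ := hX V hV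
    have hT : ∑ k, w k * V k = P + Q := by
      rw [sum_eq_Iio_add_self_add_Ioi p, hP, hQ, hw.w_self]; ring
    have e1 : ((ς + m * b) ^ (0 + 1) - ς ^ (0 + 1)) / m = b := by
      simp only [zero_add, pow_one]; field_simp; ring
    have e2 : ((1 + m * b) ^ (0 + 1) - 1) / m = b := by
      simp only [zero_add, pow_one]; field_simp; ring
    rw [e1, e2]
    simp only [zero_add, pow_one, Function.iterate_one]
    rw [hT] at h1 h2 h3
    have h5 : b * (P + Q) ≤ b * Q + b * Z := by nlinarith
    refine ⟨h0, fun j hj => ?_, by linarith, fun j hj => ?_⟩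
    · have := mul_le_mul_of_nonneg_left hPQ (mul_nonneg hb (hw.w_nonneg j))
      have := h1 j hj
      linarith
    · refine (h3 j hj).trans (mul_le_mul_of_nonneg_left ?_ (hw.y_nonneg j))
      have : h ≤ ς / m := by rw [le_div_iff₀ hm]; linarith
      have := mul_le_mul_of_nonneg_right this hW0
      linarith
  | succ t ih =>
    have hs1 : ς ^ (t + 1) ≤ (ς + m * b) ^ (t + 1) := by gcongr; linarith
    have hc1 : 1 ≤ (1 + m * b) ^ (t + 1) := one_le_pow₀ (by linarith)
    have h := ih.step hw hV hP hQ hZ hPZ hPQ hZZ (by positivity)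
      (div_nonneg (by linarith) hm.le) (div_nonneg (by linarith) hm.le) hb hh hς hmh
      (fun j hj => by
        have hs2 : (ς + m * b) ^ (t + 1) ≤ 1 := pow_le_one₀ (by positivity) (hςb j hj)
        field_simp; linarith) hX
    rw [Function.iterate_succ', Function.comp_apply]
    convert h using 1
    · ring
    · field_simp; ring
    · field_simp; ring

/-- A full round: the iterated step, followed by the damping map of the later bands. -/
lemma Damps.round {y w : Fin m → ℝ} {p : Fin m} (hw : LevelWeights y w p) {V : Fin m → ℝ}
    (hV : 0 ≤ V) {P Q Z Z' ς a b h : ℝ} (hP : P = ∑ k ∈ Iio p, w k * V k)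
    (hQ : Q = V p + ∑ k ∈ Ioi p, w k * V k)
    (hZ : (∑ k ∈ Iio p, w k ^ 2) * Z' ≤ #(Iio p) * Z) (hPZ : P ≤ Z) (hPQ : P + Q ≤ Z')
    (hZZ : Z ≤ Z') (ha : 0 ≤ a) (hb : 0 ≤ b) (hh : 0 ≤ h) (hς : ς ≤ 1)
    (hςb : ∀ j, j < p → ς + m * b ≤ 1) (hmh : m * h ≤ ς)
    {S X : (Fin m → ℝ) → Fin m → ℝ} (hS : Damps w p a h S) (hX : StepBound y w p ς b h X)
    {t : ℕ} (ht : t ≠ 0) :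
    0 ≤ S (X^[t] V) ∧
    (∀ j < p, S (X^[t] V) j ≤
      V j + w j * (((1 + m * a) * (1 + m * b) ^ t - 1) / m * Z')) ∧
    S (X^[t] V) p ≤ ς ^ t * V p + (((ς + m * b) ^ t - ς ^ t) / m + a * (ς + m * b) ^ t) * Q +
        ((1 + m * a) * (1 + m * b) ^ t - 1) / m * Z ∧
    ∀ j, p < j → S (X^[t] V) j ≤ w j * (ς ^ t / m * (∑ k ∈ Ioi p, w k * V k) +
        (((ς + m * b) ^ t - ς ^ t) / m + a * (ς + m * b) ^ t) * Q +
        ((1 + m * a) * (1 + m * b) ^ t - 1) / m * Z) := by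
  have hm : (0 : ℝ) < m := by exact_mod_cast p.pos
  have hς0 : 0 ≤ ς := le_trans (by positivity) hmh
  have hmb : 0 ≤ m * b := by positivity
  have hP0 : 0 ≤ P := by rw [hP]; exact sum_w_nonneg hw.w_nonneg hV _
  set W := ∑ k ∈ Ioi p, w k * V k with hW
  have hW0 : 0 ≤ W := sum_w_nonneg hw.w_nonneg hV _
  have hQ0 : 0 ≤ Q := by rw [hQ]; exact add_nonneg (hV p) hW0
  have hZ0 : 0 ≤ Z := hP0.trans hPZ
  have hs1 : ς ^ t ≤ (ς + m * b) ^ t := by gcongr; linarith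
  have hc1 : 1 ≤ (1 + m * b) ^ t := one_le_pow₀ (by linarith)
  have hI := IterBound.iterate hw hV hP hQ hZ hPZ hPQ hZZ hb hh hς hςb hmh hX ht
  have hd0 : 0 ≤ ((ς + m * b) ^ t - ς ^ t) / m := div_nonneg (by linarith) hm.le
  have hc0 : 0 ≤ ((1 + m * b) ^ t - 1) / m := div_nonneg (by linarith) hm.le
  have hss : (0 : ℝ) ≤ ς ^ t := by positivity
  obtain ⟨hT, hH⟩ := hI.sums hw hV hP hQ hZ hZ0 hss hd0 hc0
  rw [← hW] at hH
  have hd1 : ς ^ t + m * (((ς + m * b) ^ t - ς ^ t) / m) = (ς + m * b) ^ t := by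
    field_simp; ring
  -- The final damping map multiplies `1 + m c` by `1 + m a`.
  have hc2 : ((1 + m * a) * (1 + m * b) ^ t - 1) / m =
      ((1 + m * b) ^ t - 1) / m + a + a * m * (((1 + m * b) ^ t - 1) / m) := by
    field_simp; ring
  obtain ⟨h0, h1, h2⟩ := hS _ hI.nonneg
  rw [hc2]
  rw [hd1] at hT
  set U := X^[t] V
  set d := ((ς + m * b) ^ t - ς ^ t) / m
  set c := ((1 + m * b) ^ t - 1) / m
  set s := ς ^ t
  set r := (ς + m * b) ^ t
  set T := ∑ k, w k * U k
  set H := ∑ k ∈ Ioi p, w k * U k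
  have haT : a * T ≤ a * P + a * r * Q + a * m * c * Z := by
    have := mul_le_mul_of_nonneg_left hT ha
    linarith
  have haP : a * P ≤ a * Z := mul_le_mul_of_nonneg_left hPZ ha
  refine ⟨h0, fun j hj => ?_, ?_, fun j hj => ?_⟩
  · have h4 : T ≤ Z' + m * (c * Z') := by
      have h5 : r * Q ≤ Q :=
        mul_le_of_le_one_left hQ0 (pow_le_one₀ (by positivity) (hςb j hj))
      have h6 : m * (c * Z) ≤ m * (c * Z') := by gcongr
      linarith
    have h7 := mul_le_mul_of_nonneg_left h4 (mul_nonneg ha (hw.w_nonneg j))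
    have h8 := hI.low j hj
    have h9 := h1 j hj.le
    nlinarith
  · have h4 := h1 p le_rfl
    rw [hw.w_self, mul_one] at h4
    have h5 := hI.self
    linarith
  · have h4 : h * H ≤ s / m * W + (d * Q + c * Z) := by
      calc h * H ≤ h * (s * W + m * (d * Q + c * Z)) := mul_le_mul_of_nonneg_left hH hh
        _ = (m * h) * (s / m * W + (d * Q + c * Z)) := by field_simp
        _ ≤ 1 * (s / m * W + (d * Q + c * Z)) :=
            mul_le_mul_of_nonneg_right (by linarith) (by positivity)
        _ = _ := one_mul _
    have h5 := mul_le_mul_of_nonneg_left (add_le_add h4 haT) (hw.w_nonneg j)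
    have h6 := mul_le_mul_of_nonneg_left haP (hw.w_nonneg j)
    have h7 := h2 j hj
    linarith

end BandRecursion

end StochBSLS

namespace StochBSLS

/-! ### Flattening the recursion into a list of steps -/

/-- The sequence of the step sizes of a Big-Step-Little-Step recursion. -/
def bslsSteps {α : Type*} : List (ℕ × α) → List α
  | [] => []
  | (T, a) :: rest => (List.replicate T (bslsSteps rest ++ [a])).flatten ++ bslsSteps rest

lemma foldl_flatten_replicate {α β : Type*} (f : β → α → β) (l : List α) (T : ℕ) (x : β) :
    (List.replicate T l).flatten.foldl f x = (fun y => l.foldl f y)^[T] x := by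
  induction T generalizing x with
  | zero => simp
  | succ T ih => simp [List.replicate_succ, ih]

lemma foldl_bslsSteps_cons {α β : Type*} (f : β → α → β) (T : ℕ) (a : α) (rest : List (ℕ × α))
    (x : β) : (bslsSteps ((T, a) :: rest)).foldl f x =
      (bslsSteps rest).foldl f ((fun y => f ((bslsSteps rest).foldl f y) a)^[T] x) := by
  simp [bslsSteps, foldl_flatten_replicate]

lemma bslsSteps_map {α β : Type*} (g : α → β) (l : List (ℕ × α)) :
    bslsSteps (l.map fun q => (q.1, g q.2)) = (bslsSteps l).map g := by
  induction l with
  | nil => rfl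
  | cons q rest ih =>
    obtain ⟨T, a⟩ := q
    simp [bslsSteps, ih, List.map_flatten]

/-- Adding one makes the count multiplicative: with `N` steps in the inner run there are `T (N + 1)
+ N` steps in total, which is `(T + 1) (N + 1) - 1`. -/
lemma length_bslsSteps {α : Type*} (l : List (ℕ × α)) :
    (bslsSteps l).length + 1 = (l.map fun q => q.1 + 1).prod := by
  induction l with
  | nil => rfl
  | cons q rest ih =>
    obtain ⟨T, a⟩ := q
    simp only [bslsSteps, List.length_append, List.length_flatten, List.map_replicate,
      List.sum_replicate, List.length_cons, List.length_nil, List.map_cons, List.prod_cons, ← ih,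
      smul_eq_mul]
    ring

section BandRecursion

open Finset

variable {m : ℕ}

/-! ### One level of the recursion: step, change of center, first band -/

lemma levelWeights_bandWeight {L : Fin m → ℝ} (hL : ∀ i, 0 < L i) (hmono : Monotone L)
    (p : Fin m) : LevelWeights (fun j => L j / L p) (bandWeight L p) p where
  y_nonneg j := (div_pos (hL j) (hL p)).le
  w_nonneg j := by
    unfold bandWeight; split_ifs
    · exact (div_pos (hL j) (hL p)).le
    · exact (div_pos (hL p) (hL j)).le
  w_le_one j := by
    unfold bandWeight; split_ifs with h
    · exact (div_le_one (hL p)).2 (hmono h)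
    · exact (div_le_one (hL j)).2 (hmono (not_le.1 h).le)
  w_self := by simp [bandWeight, (hL p).ne']
  w_eq j hj := by simp [bandWeight, hj]
  y_mul_w j hj := by
    have := (hL p).ne'
    have := (hL j).ne'
    simp only [bandWeight, not_le.2 hj, if_false]
    field_simp

lemma bandStep_nonneg {L σ : Fin m → ℝ} {γ : ℝ} (hL : ∀ i, 0 < L i) (hσ : ∀ i, 0 ≤ σ i)
    (hγ : 0 ≤ γ) {V : Fin m → ℝ} (hV : 0 ≤ V) (p : Fin m) : 0 ≤ bandStep L σ γ V p := by
  intro j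
  have h1 : 0 ≤ ∑ k, L k / L p * V k :=
    sum_nonneg fun k _ => mul_nonneg (div_pos (hL k) (hL p)).le (hV k)
  have h2 : 0 ≤ L j / L p := (div_pos (hL j) (hL p)).le
  have h3 : (0 : ℝ) ≤ (if j < p then 1 else if j = p then σ p else (L j / L p) ^ 2) := by
    split_ifs
    · exact zero_le_one
    · exact hσ p
    · positivity
  have h4 : 0 ≤ V j := hV j
  simp only [bandStep, Pi.zero_apply]
  positivity

/-- One step after a damping map. -/
lemma Damps.stepBound {L σ : Fin m → ℝ} {γ a h ς : ℝ} (hL : ∀ i, 0 < L i) (hmono : Monotone L)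
    (hσ : ∀ i, 0 ≤ σ i) (hγ : 0 ≤ γ) (ha : 0 ≤ a) (hmh : m * h ≤ 1)
    {p : Fin m} (hς : σ p ≤ ς) (hς1 : ς ≤ 1) {S : (Fin m → ℝ) → Fin m → ℝ}
    (hS : Damps (bandWeight L p) p a h S) :
    StepBound (fun j => L j / L p) (bandWeight L p) p ς (a * (1 + m * γ) + γ) h
      (fun V => bandStep L σ γ (S V) p) := by
  intro V hV
  have hw := levelWeights_bandWeight hL hmono p
  set w := bandWeight L p
  set y : Fin m → ℝ := fun j => L j / L p with hy
  obtain ⟨h0, h1, h2⟩ := hS V hV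
  have hm : (0 : ℝ) < m := by exact_mod_cast p.pos
  have hsplit := sum_eq_Iio_add_self_add_Ioi p (fun k => w k * V k)
  set T := ∑ k, w k * V k with hT
  set W := ∑ k ∈ Ioi p, w k * V k with hW
  have hW0 : 0 ≤ W := sum_w_nonneg hw.w_nonneg hV _
  have hT0 : 0 ≤ T := sum_w_nonneg hw.w_nonneg hV _
  -- The noise of the step sees the moments with the growing weights `y`. The damping map has just
  -- turned the later bands into multiples of `w`, and `y k * w k ≤ 1`, so only the sum with the
  -- weights `w` remains.
  have hyU : ∑ k, y k * S V k ≤ (1 + m * a) * T := by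
    have e1 : ∑ k ∈ Iio p, y k * S V k ≤
        ∑ k ∈ Iio p, w k * V k + (∑ k ∈ Iio p, y k * w k) * (a * T) := by
      rw [sum_mul, ← sum_add_distrib]
      refine sum_le_sum fun k hk => ?_
      have hk' := (mem_Iio.1 hk).le
      have := mul_le_mul_of_nonneg_left (h1 k hk') (hw.y_nonneg k)
      rw [hw.w_eq k hk'] at this ⊢
      simp only [hy] at *
      linarith
    have e2 : y p * S V p ≤ w p * V p + (y p * w p) * (a * T) := by
      have := mul_le_mul_of_nonneg_left (h1 p le_rfl) (hw.y_nonneg p)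
      rw [hw.w_eq p le_rfl] at this ⊢
      simp only [hy] at *
      linarith
    have e3 : ∑ k ∈ Ioi p, y k * S V k ≤ W + (∑ k ∈ Ioi p, y k * w k) * (a * T) := by
      have e4 : ∑ k ∈ Ioi p, y k * S V k ≤ ∑ k ∈ Ioi p, (h * W + y k * w k * (a * T)) := by
        refine sum_le_sum fun k hk => ?_
        have := mul_le_mul_of_nonneg_left (h2 k (mem_Ioi.1 hk)) (hw.y_nonneg k)
        have e5 : y k * w k = 1 := hw.y_mul_w k (mem_Ioi.1 hk)
        calc y k * S V k ≤ _ := this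
          _ = (y k * w k) * (h * W + a * T) := by simp only [hy]; ring
          _ = _ := by rw [e5]; ring
      refine e4.trans ?_
      rw [sum_add_distrib, sum_const, nsmul_eq_mul, sum_mul]
      have h6 : (#(Ioi p) : ℝ) ≤ m := by
        have := card_Iio_add_card_Ioi p
        have : (0 : ℝ) ≤ #(Iio p) := Nat.cast_nonneg _
        linarith
      have h7 : (#(Ioi p) : ℝ) * (h * W) ≤ W := by
        rcases le_or_gt 0 h with hh | hh
        · calc (#(Ioi p) : ℝ) * (h * W) ≤ m * (h * W) :=
                mul_le_mul_of_nonneg_right h6 (by positivity)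
            _ = (m * h) * W := by ring
            _ ≤ W := mul_le_of_le_one_left hW0 hmh
        · have : h * W ≤ 0 := mul_nonpos_of_nonpos_of_nonneg hh.le hW0
          have : (#(Ioi p) : ℝ) * (h * W) ≤ 0 :=
            mul_nonpos_of_nonneg_of_nonpos (Nat.cast_nonneg _) this
          linarith
      linarith
    have e6 := sum_eq_Iio_add_self_add_Ioi p (fun k => y k * S V k)
    have e7 := sum_eq_Iio_add_self_add_Ioi p (fun k => y k * w k)
    have e8 := mul_le_mul_of_nonneg_right hw.sum_mul_le (mul_nonneg ha hT0)
    rw [e7] at e8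
    nlinarith
  have hγT : γ * ∑ k, y k * S V k ≤ γ * ((1 + m * a) * T) := mul_le_mul_of_nonneg_left hyU hγ
  refine ⟨bandStep_nonneg hL hσ hγ h0 p, fun j hj => ?_, ?_, fun j hj => ?_⟩
  · have e1 := h1 j hj.le
    have e2 : y j = w j := (hw.w_eq j hj.le).symm
    have e3 := mul_le_mul_of_nonneg_left hγT (hw.w_nonneg j)
    simp only [bandStep, hj, if_true]
    change 1 * S V j + γ * (y j) * ∑ k, y k * S V k ≤ _
    rw [e2]
    linarith
  · have e1 := h1 p le_rfl
    have e2 : y p = 1 := div_self (hL p).ne'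
    rw [hw.w_self] at e1
    simp only [bandStep, lt_irrefl, if_true, if_false]
    change σ p * S V p + γ * (y p) * ∑ k, y k * S V k ≤ _
    rw [e2]
    have e3 : σ p * S V p ≤ ς * (V p + a * 1 * T) :=
      mul_le_mul hς e1 (h0 p) ((hσ p).trans hς)
    have e4 : ς * (a * 1 * T) ≤ a * T := by
      rw [mul_one]; exact mul_le_of_le_one_left (mul_nonneg ha hT0) hς1
    linarith
  · have e1 := h2 j hj
    have e2 : y j * w j = 1 := hw.y_mul_w j hj
    have e3 := mul_le_mul_of_nonneg_left hγT (hw.y_nonneg j)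
    have e4 := mul_le_mul_of_nonneg_left e1 (sq_nonneg (y j))
    simp only [bandStep, not_lt.2 hj.le, hj.ne', if_false]
    change (y j) ^ 2 * S V j + γ * (y j) * ∑ k, y k * S V k ≤ y j * _
    -- The growth `y j ^ 2` in a later band meets the weight `w j = 1 / y j` left by the damping
    -- map, so a single factor `y j` survives.
    have e5 : y j ^ 2 * (h * w j * W + a * w j * T) = y j * (h * W + a * T) := by
      calc _ = y j * (y j * w j) * (h * W + a * T) := by ring
        _ = _ := by rw [e2, mul_one]
    rw [e5] at e4
    change y j * _ ≤ y j * _ at e3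
    linarith

set_option maxHeartbeats 1000000 in
/-- The center of a damping map moves to the preceding band. -/
lemma Damps.shift {L σ : Fin m → ℝ} {γ a h ς Kap : ℝ} (hL : ∀ i, 0 < L i) (hmono : Monotone L)
    (hσ : ∀ i, 0 ≤ σ i) (hγ : 0 ≤ γ) (ha : 0 ≤ a) (hh : 0 ≤ h)
    {q p : Fin m} (hqp : (q : ℕ) + 1 = p) (hKap : L p / L q ≤ Kap) (hςσ : σ p ≤ ς)
    (hmh : m * h ≤ ς)
    (hς : ς + m * (a * (1 + m * γ) + γ) ≤ 1) {S : (Fin m → ℝ) → Fin m → ℝ}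
    (hS : Damps (bandWeight L p) p a h S) {t : ℕ} (ht : t ≠ 0) :
    Damps (bandWeight L q) q
      (((1 + m * a) * (1 + m * (a * (1 + m * γ) + γ)) ^ t - 1) / m)
      (Kap ^ 2 * ((1 + m * a) * (ς + m * (a * (1 + m * γ) + γ)) ^ t))
      (fun V => S ((fun V => bandStep L σ γ (S V) p)^[t] V)) := by
  intro V hV
  have hm : (1 : ℝ) ≤ m := by exact_mod_cast p.pos
  have hw := levelWeights_bandWeight hL hmono p
  have hw' := levelWeights_bandWeight hL hmono q
  have hς1 : ς ≤ 1 := by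
    have : 0 ≤ m * (a * (1 + m * γ) + γ) := by positivity
    linarith
  have hς0 : 0 ≤ ς := le_trans (by positivity) hmh
  have hX := Damps.stepBound hL hmono hσ hγ ha (hmh.trans hς1) hςσ hς1 hS
  set w := bandWeight L p with hwdef
  set w' := bandWeight L q with hwdef'
  set b := a * (1 + m * γ) + γ with hb
  have hb0 : 0 ≤ b := by positivity
  have hqp' : q < p := by rw [Fin.lt_def]; omega
  have hiff : ∀ j : Fin m, j < p ↔ j ≤ q := fun j => by rw [Fin.lt_def, Fin.le_def]; omega
  set θ := L q / L p with hθ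
  have hθ0 : 0 < θ := div_pos (hL q) (hL p)
  have hθ1 : θ ≤ 1 := (div_le_one (hL p)).2 (hmono hqp'.le)
  have hθK : 1 ≤ Kap ^ 2 * θ ^ 2 := by
    have h1 : 1 ≤ Kap * θ := by
      have := mul_le_mul_of_nonneg_right hKap hθ0.le
      have e : L p / L q * θ = 1 := by
        rw [hθ]; have := (hL q).ne'; have := (hL p).ne'; field_simp
      linarith
    nlinarith
  -- Moving the center from `p` to `q` multiplies the weights by `1 / θ` on the lower side and by
  -- `θ` on the upper side.
  have hlow : ∀ j < p, w j = θ * w' j := fun j hj => by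
    rw [hwdef, hwdef', bandWeight, bandWeight, if_pos hj.le, if_pos ((hiff j).1 hj), hθ]
    have := (hL q).ne'; field_simp
  have hhigh : ∀ j, p ≤ j → w' j = θ * w j := fun j hj => by
    have hj' : ¬ j ≤ q := fun h => absurd ((hiff j).2 h) (not_lt.2 hj)
    rw [hwdef, hwdef', bandWeight, bandWeight, if_neg hj', hθ]
    have := (hL p).ne'
    have := (hL j).ne'
    split_ifs with h
    · rw [le_antisymm h hj]; field_simp
    · field_simp
  set P := ∑ k ∈ Iio p, w k * V k with hP
  set Q := V p + ∑ k ∈ Ioi p, w k * V k with hQ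
  set W' := ∑ k, w' k * V k with hW'
  have hP0 : 0 ≤ P := sum_w_nonneg hw.w_nonneg hV _
  have hQ0 : 0 ≤ Q := add_nonneg (hV p) (sum_w_nonneg hw.w_nonneg hV _)
  have hW'Q : ∑ k ∈ Ioi q, w' k * V k = θ * Q := by
    have e : Ioi q = insert p (Ioi p) := by
      ext k; simp only [mem_Ioi, mem_insert, Fin.lt_def, Fin.ext_iff]; omega
    rw [e, sum_insert (by simp), hhigh p le_rfl, hw.w_self, hQ, mul_add, mul_sum]
    congr 1
    · ring
    · refine sum_congr rfl fun k hk => ?_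
      rw [hhigh k (mem_Ioi.1 hk).le]; ring
  have hθW : θ * W' = P + θ ^ 2 * Q := by
    have e1 : θ * (∑ k ∈ Iio q, w' k * V k + w' q * V q) = P := by
      have e : Iio p = insert q (Iio q) := by
        ext k; simp only [mem_Iio, mem_insert, Fin.lt_def, Fin.ext_iff]; omega
      rw [hP, e, sum_insert (by simp), hlow q hqp', mul_add, mul_sum, add_comm]
      congr 1
      · ring
      · refine sum_congr rfl fun k hk => ?_
        rw [hlow k ((mem_Iio.1 hk).trans hqp')]; ring
    rw [hW', sum_eq_Iio_add_self_add_Ioi q, mul_add, e1, hW'Q]; ring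
  have hW'0 : 0 ≤ W' := sum_w_nonneg hw'.w_nonneg hV _
  have hWθ : W' / θ = P / θ ^ 2 + Q := by
    have e : W' / θ = θ * W' / θ ^ 2 := by rw [pow_two, mul_div_mul_left _ _ hθ0.ne']
    rw [e, hθW, add_div, mul_div_cancel_left₀ _ (pow_pos hθ0 2).ne']
  have hPθ : P ≤ P / θ ^ 2 := by
    rw [le_div_iff₀ (by positivity)]
    exact mul_le_of_le_one_right hP0 (pow_le_one₀ hθ0.le hθ1)
  -- With these choices `w j * Z'` for the earlier bands and `w j * Z` for the later ones both
  -- become `w' j * W'`, the coupling term with the new center.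
  obtain ⟨h0, h1, h2, h3⟩ := Damps.round (Z := θ * W') (Z' := W' / θ) hw hV hP hQ
    (by
      have e1 : ∑ k ∈ Iio p, w k ^ 2 ≤ #(Iio p) * θ ^ 2 := by
        rw [← nsmul_eq_mul, ← sum_const]
        refine sum_le_sum fun k hk => ?_
        have hk' := hlow k (mem_Iio.1 hk)
        have := hw.w_nonneg k
        refine pow_le_pow_left₀ this ?_ 2
        rw [hk']
        exact mul_le_of_le_one_right hθ0.le (hw'.w_le_one k)
      calc (∑ k ∈ Iio p, w k ^ 2) * (W' / θ) ≤ #(Iio p) * θ ^ 2 * (W' / θ) :=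
            mul_le_mul_of_nonneg_right e1 (by positivity)
        _ = _ := by field_simp)
    (by rw [hθW]; nlinarith [mul_nonneg (sq_nonneg θ) hQ0]) (by rw [hWθ]; linarith)
    (by rw [hθW, hWθ]
        have : θ ^ 2 * Q ≤ Q := mul_le_of_le_one_left hQ0 (pow_le_one₀ hθ0.le hθ1)
        linarith)
    ha hb0 hh hς1 (fun _ _ => hς) hmh hS hX ht
  set A := ((1 + m * a) * (1 + m * b) ^ t - 1) / m with hA
  set r := (ς + m * b) ^ t with hr
  set s := ς ^ t with hs
  have hs0 : 0 ≤ s := pow_nonneg hς0 t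
  have hrs : s ≤ r := by
    rw [hr, hs]; gcongr; nlinarith
  have hm0 : (0 : ℝ) < m := by linarith
  have hma : 0 ≤ m * a := by positivity
  have hd : s + ((r - s) / m + a * r) ≤ (1 + m * a) * r := by
    have e1 : (r - s) / m ≤ r - s := div_le_self (by linarith) hm
    have e2 : a * r ≤ m * a * r := by
      have : 0 ≤ a * r := mul_nonneg ha (hs0.trans hrs)
      nlinarith
    linarith
  -- For the damped part the weight changes twice, once in `w j` and once inside the sum, which
  -- costs `θ ^ 2`. The factor `Kap ^ 2` makes up for it.
  have hcoef : ∀ j, p ≤ j → w j * ((1 + m * a) * r * Q + A * (θ * W')) ≤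
      Kap ^ 2 * ((1 + m * a) * r) * w' j * (θ * Q) + A * w' j * W' := fun j hj => by
    rw [hhigh j hj]
    have e0 := hw.w_nonneg j
    have e1 : 0 ≤ (1 + m * a) * r * Q * w j := by
      have := hs0.trans hrs
      positivity
    have := mul_le_mul_of_nonneg_right hθK e1
    linarith
  refine ⟨h0, fun j hj => ?_, fun j hj => ?_⟩
  · have hj' := (hiff j).2 hj
    have e := h1 j hj'
    rw [hlow j hj'] at e
    have : θ * w' j * (A * (W' / θ)) = A * w' j * W' := by field_simp
    linarith
  · have hj' : p ≤ j := not_lt.1 fun h => absurd ((hiff j).1 h) (not_le.2 hj)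
    rw [hW'Q]
    refine le_trans ?_ (hcoef j hj')
    rcases hj'.eq_or_lt with rfl | hj''
    · rw [hw.w_self, one_mul]
      have e1 : s * V p ≤ s * Q :=
        mul_le_mul_of_nonneg_left (by
          have := sum_w_nonneg hw.w_nonneg hV (Ioi p)
          linarith) hs0
      have e2 := mul_le_mul_of_nonneg_right hd hQ0
      linarith
    · refine (h3 j hj'').trans (mul_le_mul_of_nonneg_left ?_ (hw.w_nonneg j))
      have e3 : ∑ k ∈ Ioi p, w k * V k ≤ Q := by have : 0 ≤ V p := hV p; linarith
      have e4 := sum_w_nonneg hw.w_nonneg hV (Ioi p)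
      have e1 : s / m * ∑ k ∈ Ioi p, w k * V k ≤ s * Q :=
        mul_le_mul (div_le_self hs0 hm) e3 e4 hs0
      have e2 := mul_le_mul_of_nonneg_right hd hQ0
      linarith

/-- The total second moment after the last round of the first band. -/
lemma Damps.total {L σ : Fin m → ℝ} {γ a h ς : ℝ} (hL : ∀ i, 0 < L i) (hmono : Monotone L)
    (hσ : ∀ i, 0 ≤ σ i) (hγ : 0 ≤ γ) (ha : 0 ≤ a) (hh : 0 ≤ h)
    {p : Fin m} (hp : (p : ℕ) = 0) (hςσ : σ p ≤ ς) (hmh : m * h ≤ ς)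
    (hς1 : ς ≤ 1)
    {S : (Fin m → ℝ) → Fin m → ℝ} (hS : Damps (bandWeight L p) p a h S) {t : ℕ} (ht : t ≠ 0)
    {V : Fin m → ℝ} (hV : 0 ≤ V) :
    ∑ j, S ((fun V => bandStep L σ γ (S V) p)^[t] V) j ≤
      (1 + m * a) * (ς + m * (a * (1 + m * γ) + γ)) ^ t * ∑ j, V j := by
  have hm : (0 : ℝ) < m := by exact_mod_cast p.pos
  have hw := levelWeights_bandWeight hL hmono p
  have hb0 : 0 ≤ a * (1 + m * γ) + γ := by positivity
  have hς0 : 0 ≤ ς := le_trans (by positivity) hmh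
  have hX := Damps.stepBound hL hmono hσ hγ ha (hmh.trans hς1) hςσ hς1 hS
  have hemp : Iio p = ∅ := by
    ext k; simp [Fin.lt_def, hp]
  set b := a * (1 + m * γ) + γ with hb
  set Q := V p + ∑ k ∈ Ioi p, bandWeight L p k * V k with hQ
  have hQ0 : 0 ≤ Q := add_nonneg (hV p) (sum_w_nonneg hw.w_nonneg hV _)
  -- There is no band before the first, so nothing flows in from below and all terms with `Z`
  -- vanish.
  obtain ⟨h0, h1, h2, h3⟩ := Damps.round (P := 0) (Z := 0) (Z' := Q) hw hV (by simp [hemp]) hQ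
    (by simp [hemp]) le_rfl (by simp) hQ0 ha hb0 hh hς1
    (fun j hj => absurd (hemp ▸ mem_Iio.2 hj) (notMem_empty j)) hmh hS hX ht
  set U := S ((fun V => bandStep L σ γ (S V) p)^[t] V)
  rw [mul_zero, add_zero] at h2 h3
  set r := (ς + m * b) ^ t with hr
  set s := ς ^ t with hs
  set W := ∑ k ∈ Ioi p, bandWeight L p k * V k with hW
  have hs0 : 0 ≤ s := pow_nonneg hς0 t
  have hrs : s ≤ r := by
    rw [hr, hs]; gcongr; nlinarith
  set D := ((r - s) / m + a * r) * Q with hD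
  have hD0 : 0 ≤ D :=
    mul_nonneg (add_nonneg (div_nonneg (by linarith) hm.le) (mul_nonneg ha (hs0.trans hrs))) hQ0
  have hW0 : 0 ≤ W := sum_w_nonneg hw.w_nonneg hV _
  have hcard := card_Iio_add_card_Ioi p
  rw [hemp, card_empty, Nat.cast_zero, zero_add] at hcard
  have e1 : ∑ k ∈ Ioi p, U k ≤ s * W + #(Ioi p) * D := by
    calc ∑ k ∈ Ioi p, U k ≤ ∑ k ∈ Ioi p, (s / m * W + D) := by
          refine sum_le_sum fun k hk => (h3 k (mem_Ioi.1 hk)).trans ?_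
          exact mul_le_of_le_one_left (by positivity) (hw.w_le_one k)
      _ = #(Ioi p) * (s / m * W) + #(Ioi p) * D := by rw [sum_const, nsmul_eq_mul, mul_add]
      _ ≤ _ := by
          have : (#(Ioi p) : ℝ) * (s / m * W) ≤ m * (s / m * W) :=
            mul_le_mul_of_nonneg_right (by linarith) (by positivity)
          have e : m * (s / m * W) = s * W := by field_simp
          linarith
  have e2 : ∑ j, U j ≤ s * Q + m * D := by
    rw [sum_eq_Iio_add_self_add_Ioi p, hemp, sum_empty, zero_add, ← hcard]
    have : s * Q = s * V p + s * W := by rw [hQ]; ring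
    linarith
  have e3 : s * Q + m * D = (1 + m * a) * r * Q := by
    rw [hD]; field_simp; ring
  have e4 : Q ≤ ∑ j, V j := by
    rw [sum_eq_Iio_add_self_add_Ioi p, hemp, sum_empty, zero_add, hQ]
    exact add_le_add le_rfl (sum_le_sum fun k _ =>
      mul_le_of_le_one_left (hV k) (hw.w_le_one k))
  rw [e3] at e2
  refine e2.trans (mul_le_mul_of_nonneg_left e4 ?_)
  have := hs0.trans hrs
  positivity

end BandRecursion

end StochBSLS

namespace StochBSLS

section BandRecursion

open Finset

variable {m : ℕ}

/-! ### Induction over the bands -/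

lemma Damps.mono {w : Fin m → ℝ} (hw : ∀ j, 0 ≤ w j) {p : Fin m} {a a' h h' : ℝ} (ha : a ≤ a')
    (hh : h ≤ h') {S : (Fin m → ℝ) → Fin m → ℝ} (hS : Damps w p a h S) : Damps w p a' h' S := by
  intro V hV
  obtain ⟨h0, h1, h2⟩ := hS V hV
  have e0 := sum_w_nonneg hw hV univ
  have e1 := sum_w_nonneg hw hV (Ioi p)
  refine ⟨h0, fun j hj => (h1 j hj).trans ?_, fun j hj => (h2 j hj).trans ?_⟩ <;>
  · have := hw j
    gcongr

/-- The schedule of the steps of stochastic BSLS from the band `p` on. -/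
def schedule (T : Fin m → ℕ) (p : ℕ) : List (Fin m) :=
  bslsSteps (((List.finRange m).drop p).map fun i => (T i, i))

lemma foldl_schedule {β : Type*} (T : Fin m → ℕ) (p : Fin m) (f : β → Fin m → β) (x : β) :
    (schedule T p).foldl f x = (schedule T (p + 1)).foldl f
      ((fun y => f ((schedule T (p + 1)).foldl f y) p)^[T p] x) := by
  have h : (List.finRange m).drop p = p :: (List.finRange m).drop (p + 1) := by
    rw [List.drop_eq_getElem_cons (by simp)]
    simp
  rw [schedule, h, List.map_cons, foldl_bslsSteps_cons]
  rfl

/-- For `x = 1 / κ` the squared contraction factor `(1 - x) ^ 2` beats `exp (-x)` by a margin linear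
in `x`; this margin absorbs the noise. The proof passes through the cubic Taylor polynomial of `exp
(-x)`. -/
lemma exp_neg_ge_sq {x : ℝ} (h0 : 0 ≤ x) (h1 : x ≤ 1) : (1 - x) ^ 2 + x / 3 ≤ Real.exp (-x) := by
  have h2 : 1 - x + x ^ 2 / 2 - x ^ 3 / 6 ≤ Real.exp (-x) := by
    have e1 : Real.exp (-x) * Real.exp x = 1 := by rw [← Real.exp_add]; simp
    have e2 := Real.exp_bound' h0 h1 (n := 4) (by norm_num)
    simp [Finset.sum_range_succ, Nat.factorial] at e2
    have e3 := Real.exp_pos (-x)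
    have e4 := Real.exp_pos x
    have e5 : (1 - x + x ^ 2 / 2 - x ^ 3 / 6) * Real.exp x ≤ 1 := by
      have e6 : 0 ≤ 1 - x + x ^ 2 / 2 - x ^ 3 / 6 := by nlinarith [sq_nonneg x, pow_nonneg h0 3]
      refine (mul_le_mul_of_nonneg_left e2 e6).trans ?_
      have hx3 := pow_nonneg h0 3
      have hx4 := pow_nonneg h0 4
      nlinarith [pow_nonneg h0 5, pow_nonneg h0 6, pow_nonneg h0 7, mul_nonneg hx4 (sub_nonneg.2 h1),
        mul_nonneg (pow_nonneg h0 5) (sub_nonneg.2 h1), mul_nonneg (pow_nonneg h0 6) (sub_nonneg.2 h1)]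
    nlinarith
  nlinarith [sq_nonneg x, mul_nonneg (sq_nonneg x) (sub_nonneg.2 h1)]

/-- The total contraction of the bands from the second on. -/
lemma damps_schedule {L κ : Fin m → ℝ} {T : Fin m → ℕ} {γ Kap : ℝ} (hL : ∀ i, 0 < L i)
    (hmono : Monotone L) (hκ : ∀ i, 1 ≤ κ i) (hγ : 0 ≤ γ)
    (hKap : ∀ p q, L p / L q ≤ Kap) (hm : 3 * m ≤ Real.log Kap)
    (hT : ∀ p : Fin m, 0 < (p : ℕ) → 8 * (κ p * Real.log Kap) ≤ T p)
    (hβ : ∀ p : Fin m, 0 < (p : ℕ) →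
      (1 + m * γ) ^ (∏ j ∈ Ioi p, (T j + 1)) - 1 ≤ 1 / (10 * κ p)) (k : ℕ) :
    ∀ q : Fin m, (q : ℕ) + 1 + k = m → Damps (bandWeight L q) q
      (((1 + m * γ) ^ (∏ j ∈ Ioi q, (T j + 1)) / (1 + m * γ) - 1) / m) (1 / (4 * m))
      (fun V => (schedule T (q + 1)).foldl
        (bandStep L (fun i => (1 - 1 / κ i) ^ 2) γ) V) := by
  induction k with
  | zero =>
    intro q hq V hV
    have hm0 : (0 : ℝ) < m := by exact_mod_cast q.pos
    have hg : (0 : ℝ) < 1 + m * γ := by positivity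
    have e : Ioi q = ∅ := by
      ext j; simp only [mem_Ioi, Fin.lt_def, notMem_empty, iff_false]; omega
    have e2 : (schedule T (q + 1)) = [] := by
      rw [schedule, List.drop_eq_nil_of_le (by simp; omega)]; rfl
    simp only [e, e2, prod_empty, pow_one, div_self hg.ne', sub_self, zero_div, zero_mul, add_zero,
      sum_empty, mul_zero, List.foldl_nil]
    refine ⟨hV, fun j _ => le_rfl, fun j hj => ?_⟩
    rw [Fin.lt_def] at hj; omega
  | succ k ih =>
    intro q hq
    obtain ⟨p, hp⟩ : ∃ p : Fin m, (q : ℕ) + 1 = p := ⟨⟨q + 1, by omega⟩, rfl⟩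
    have hp0 : 0 < (p : ℕ) := by omega
    have ihp := ih p (by omega)
    have hm0 : (0 : ℝ) < m := by exact_mod_cast q.pos
    have hm1 : (1 : ℝ) ≤ m := by exact_mod_cast q.pos
    have hg : (1 : ℝ) ≤ 1 + m * γ := by
      have : 0 ≤ m * γ := by positivity
      linarith
    have hN : 1 ≤ ∏ j ∈ Ioi p, (T j + 1) := Nat.one_le_iff_ne_zero.2 (prod_ne_zero_iff.2 (by simp))
    set N := ∏ j ∈ Ioi p, (T j + 1) with hNdef
    set g := 1 + m * γ with hgdef
    have hgN : g ≤ g ^ N := by simpa using pow_le_pow_right₀ hg hN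
    set a := (g ^ N / g - 1) / m with ha
    have ha0 : 0 ≤ a := by
      rw [ha]
      refine div_nonneg ?_ hm0.le
      rw [sub_nonneg, one_le_div (by linarith)]
      exact hgN
    -- Here `N - 1` is the number of steps of the inner run and `1 + m a = g ^ (N - 1)`. One further
    -- step adds one factor `g`, so the coupling of a round is `g ^ N - 1`.
    have hmb : m * (a * g + γ) = g ^ N - 1 := by
      rw [ha]
      have : g ≠ 0 := by linarith
      field_simp
      rw [hgdef]; ring
    have h1ma : 1 + m * a = g ^ N / g := by rw [ha]; field_simp; ring
    have hκp := hκ p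
    have hκ0 : 0 < κ p := by linarith
    have hβp := hβ p hp0
    have hx1 : 1 / κ p ≤ 1 := (div_le_one hκ0).2 hκp
    have hx0 : 0 < 1 / κ p := by positivity
    have hβx : g ^ N - 1 ≤ (1 / κ p) / 10 := by
      refine hβp.trans (le_of_eq ?_); field_simp
    -- Noise of at most `1 / (10 κ p)` fits into the margin `1 / (3 κ p)`, and `1 / 4 + 1 / 10` is
    -- still below `exp (-1)`.
    have hbase : max ((1 - 1 / κ p) ^ 2) (1 / 4) + (g ^ N - 1) ≤ Real.exp (-(1 / κ p)) := by
      rw [← max_add_add_right]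
      refine max_le ?_ ?_
      · have := exp_neg_ge_sq hx0.le hx1
        linarith
      · have h1 : Real.exp (-1) ≤ Real.exp (-(1 / κ p)) := Real.exp_le_exp.2 (by linarith)
        have h2 := Real.exp_neg_one_gt_d9
        linarith
    have hβ0 : 0 ≤ g ^ N - 1 := by
      have := one_le_pow₀ hg (n := N)
      linarith
    have hexp1 : Real.exp (-(1 / κ p)) ≤ 1 := Real.exp_le_one_iff.2 (by linarith)
    have hTp := hT p hp0
    have hKap1 : 0 < Kap := lt_of_lt_of_le (div_pos (hL p) (hL p)) (hKap p p)
    have hT0 : T p ≠ 0 := by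
      intro h
      rw [h, Nat.cast_zero] at hTp
      have : 0 < κ p * Real.log Kap := by nlinarith
      linarith
    -- The contraction factor is raised to at least `1 / 4` so that it dominates `m h = 1 / 4`, the
    -- damping of the later bands; it could be zero when `κ p = 1`.
    have key := Damps.shift (ς := max ((1 - 1 / κ p) ^ 2) (1 / 4)) (γ := γ) (t := T p) hL hmono
      (σ := fun i => (1 - 1 / κ i) ^ 2) (fun i => sq_nonneg _) hγ ha0 (by positivity) hp
      (hKap p q) (le_max_left _ _)
      (by
        have : (m : ℝ) * (1 / (4 * m)) = 1 / 4 := by field_simp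
        rw [this]; exact le_max_right _ _)
      (by rw [hmb]; linarith) ihp hT0
    rw [← hgdef, hmb, h1ma] at key
    have hQ : ∏ j ∈ Ioi q, (T j + 1) = (T p + 1) * N := by
      have e : Ioi q = insert p (Ioi p) := by
        ext k; simp only [mem_Ioi, mem_insert, Fin.lt_def, Fin.ext_iff]; omega
      rw [e, prod_insert (by simp)]
    have hw' := levelWeights_bandWeight hL hmono q
    have key2 := Damps.mono (a' := (g ^ (∏ j ∈ Ioi q, (T j + 1)) / g - 1) / m)
      (h' := 1 / (4 * m)) hw'.w_nonneg (le_of_eq ?_) ?_ key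
    · refine (congrArg (Damps _ q _ _) (funext fun V => ?_)).mpr key2
      rw [hp]
      exact foldl_schedule T p _ V
    · rw [hQ]
      have e : (1 + (g ^ N - 1)) ^ T p = g ^ (N * T p) := by rw [pow_mul]; ring
      rw [e, add_mul, one_mul, pow_add, mul_comm (T p) N]
      ring
    -- `8 κ log Kap` rounds gain `Kap ^ 8`. After the loss of `Kap ^ 2` there remains `2 / Kap ^ 6`,
    -- which is below `1 / (4 m)` because `3 m ≤ log Kap`.
    · have e1 : (max ((1 - 1 / κ p) ^ 2) (1 / 4) + (g ^ N - 1)) ^ T p ≤ 1 / Kap ^ 8 := by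
        have e2 : (0 : ℝ) ≤ max ((1 - 1 / κ p) ^ 2) (1 / 4) := le_max_of_le_right (by norm_num)
        calc _ ≤ Real.exp (-(1 / κ p)) ^ T p := pow_le_pow_left₀ (by linarith) hbase _
          _ = Real.exp (-(T p / κ p)) := by rw [← Real.exp_nat_mul]; congr 1; ring
          _ ≤ Real.exp (-(8 * Real.log Kap)) := by
              refine Real.exp_le_exp.2 (neg_le_neg ?_)
              rw [le_div_iff₀ hκ0]; linarith
          _ = 1 / Kap ^ 8 := by
              rw [Real.exp_neg, mul_comm, Real.exp_mul, Real.exp_log hKap1, one_div]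
              norm_cast
      have e3 : g ^ N / g ≤ 2 := by
        rw [div_le_iff₀ (by linarith)]
        linarith
      have e4 : Kap ^ 2 * (g ^ N / g * (max ((1 - 1 / κ p) ^ 2) (1 / 4) + (g ^ N - 1)) ^ T p) ≤
          Kap ^ 2 * (2 * (1 / Kap ^ 8)) := by
        gcongr
      refine e4.trans ?_
      have hlog : Real.log Kap ≤ Kap - 1 := Real.log_le_sub_one_of_pos hKap1
      have hK4 : (4 : ℝ) ≤ Kap := by linarith
      have e5 : Kap ^ 2 * (2 * (1 / Kap ^ 8)) = 2 / Kap ^ 6 := by field_simp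
      rw [e5, div_le_div_iff₀ (by positivity) (by positivity)]
      have e6 : Kap * 4 ^ 5 ≤ Kap ^ 6 := by
        calc Kap * 4 ^ 5 ≤ Kap * Kap ^ 5 := by gcongr
          _ = Kap ^ 6 := by ring
      linarith

/-- The total second moment after a run of stochastic BSLS. -/
theorem sum_foldl_schedule_le {L κ : Fin m → ℝ} {T : Fin m → ℕ} {γ Kap : ℝ} (hL : ∀ i, 0 < L i)
    (hmono : Monotone L) (hκ : ∀ i, 1 ≤ κ i) (hγ : 0 ≤ γ)
    (hKap : ∀ p q, L p / L q ≤ Kap) (hm : 3 * m ≤ Real.log Kap)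
    (hT : ∀ p : Fin m, 0 < (p : ℕ) → 8 * (κ p * Real.log Kap) ≤ T p)
    (hβ : ∀ p : Fin m, 0 < (p : ℕ) →
      (1 + m * γ) ^ (∏ j ∈ Ioi p, (T j + 1)) - 1 ≤ 1 / (10 * κ p))
    {p : Fin m} (hp : (p : ℕ) = 0) (hTp : T p ≠ 0) {V : Fin m → ℝ} (hV : 0 ≤ V) :
    ∑ j, (schedule T 0).foldl (bandStep L (fun i => (1 - 1 / κ i) ^ 2) γ) V j ≤
      (1 + m * γ) ^ (∏ j ∈ Ioi p, (T j + 1)) / (1 + m * γ) *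
        (max ((1 - 1 / κ p) ^ 2) (1 / 4) + ((1 + m * γ) ^ (∏ j ∈ Ioi p, (T j + 1)) - 1)) ^ T p *
          ∑ j, V j := by
  have hm0 : (0 : ℝ) < m := by exact_mod_cast p.pos
  have hD := damps_schedule hL hmono hκ hγ hKap hm hT hβ (m - 1) p (by have := p.pos; omega)
  have hg : (1 : ℝ) ≤ 1 + m * γ := by
    have : 0 ≤ m * γ := by positivity
    linarith
  have hN : 1 ≤ ∏ j ∈ Ioi p, (T j + 1) := Nat.one_le_iff_ne_zero.2 (prod_ne_zero_iff.2 (by simp))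
  set N := ∏ j ∈ Ioi p, (T j + 1) with hNdef
  set g := 1 + m * γ with hgdef
  have hgN : g ≤ g ^ N := by simpa using pow_le_pow_right₀ hg hN
  set a := (g ^ N / g - 1) / m with ha
  have ha0 : 0 ≤ a := by
    rw [ha]
    refine div_nonneg ?_ hm0.le
    rw [sub_nonneg, one_le_div (by linarith)]
    exact hgN
  have hmb : m * (a * g + γ) = g ^ N - 1 := by
    rw [ha]
    have : g ≠ 0 := by linarith
    field_simp
    rw [hgdef]; ring
  have h1ma : 1 + m * a = g ^ N / g := by rw [ha]; field_simp; ring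
  have hκp := hκ p
  have hκ0 : 0 < κ p := by linarith
  have hx1 : 1 / κ p ≤ 1 := (div_le_one hκ0).2 hκp
  have hx0 : 0 < 1 / κ p := by positivity
  have key := Damps.total (ς := max ((1 - 1 / κ p) ^ 2) (1 / 4)) (γ := γ) (t := T p) hL hmono
    (σ := fun i => (1 - 1 / κ i) ^ 2) (fun i => sq_nonneg _) hγ ha0 (by positivity) hp
    (le_max_left _ _)
    (by
      have : (m : ℝ) * (1 / (4 * m)) = 1 / 4 := by field_simp
      rw [this]; exact le_max_right _ _)
    (max_le (by nlinarith) (by norm_num)) hD hTp hV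
  rw [← hgdef, hmb, h1ma] at key
  have e := foldl_schedule T p (bandStep L (fun i => (1 - 1 / κ i) ^ 2) γ) V
  rw [hp] at e key
  rw [e]
  exact key

end BandRecursion

end StochBSLS

namespace StochBSLS

section BandRecursion

open Finset

variable {m : ℕ}

/-! ### Noise budget and contraction of a whole run -/

/-- The band tops `L`, condition numbers `κ` and step counts `T` of a run of BSLS, with a bound
`Kap` for the ratios of the band tops. -/
structure Regime (L κ : Fin m → ℝ) (T : Fin m → ℕ) (Kap : ℝ) : Prop where
  pos : ∀ i, 0 < L i
  mono : Monotone L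
  one_le_cond : ∀ i, 1 ≤ κ i
  ratio : ∀ p q, L p / L q ≤ Kap
  bands : 3 * m ≤ Real.log Kap
  steps : ∀ p : Fin m, 0 < (p : ℕ) → 8 * (κ p * Real.log Kap) ≤ T p

variable {L κ : Fin m → ℝ} {T : Fin m → ℕ} {Kap γ : ℝ}

lemma Regime.le_steps (h : Regime L κ T Kap) {p : Fin m} (hp : 0 < (p : ℕ)) :
    24 * (m * κ p) ≤ T p := by
  have h1 := h.steps p hp
  have h2 := h.one_le_cond p
  have h3 := h.bands
  have : κ p * (3 * m) ≤ κ p * Real.log Kap := by gcongr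
  linarith

/-- All later step counts are at least `24 m`, so at most `m` factors `1 + 1 / T j` multiply to at
most `exp (1 / 24)`. Thus the exact number of steps is comparable to the product of the `T j`. -/
lemma Regime.prod_succ_le (h : Regime L κ T Kap) (p : Fin m) :
    ((∏ j ∈ Ioi p, (T j + 1) : ℕ) : ℝ) ≤ 2 * ∏ j ∈ Ioi p, (T j : ℝ) := by
  have hm : (1 : ℝ) ≤ m := by exact_mod_cast p.pos
  have hlarge : ∀ j ∈ Ioi p, 24 * (m : ℝ) ≤ T j := fun j hj => by
    have hj' : 0 < (j : ℕ) := lt_of_le_of_lt (Nat.zero_le _) (Fin.lt_def.1 (mem_Ioi.1 hj))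
    have h1 := h.le_steps hj'
    have h2 := h.one_le_cond j
    nlinarith
  push_cast
  calc ∏ j ∈ Ioi p, ((T j : ℝ) + 1) ≤ ∏ j ∈ Ioi p, (Real.exp (1 / (24 * m)) * T j) := by
        refine prod_le_prod (fun j _ => by positivity) fun j hj => ?_
        have h1 := hlarge j hj
        have h2 := Real.add_one_le_exp (1 / (24 * (m : ℝ)))
        have h3 : (0 : ℝ) ≤ T j := Nat.cast_nonneg _
        have h4 := mul_le_mul_of_nonneg_right h2 h3
        have h5 : 1 ≤ 1 / (24 * (m : ℝ)) * T j := by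
          rw [one_div, inv_mul_eq_div, one_le_div (by positivity)]; exact h1
        linarith
    _ = Real.exp (1 / (24 * m)) ^ #(Ioi p) * ∏ j ∈ Ioi p, (T j : ℝ) := by
        rw [prod_mul_distrib, prod_const]
    _ ≤ 2 * ∏ j ∈ Ioi p, (T j : ℝ) := by
        refine mul_le_mul_of_nonneg_right ?_ (prod_nonneg fun j _ => Nat.cast_nonneg _)
        rw [← Real.exp_nat_mul]
        have h1 : (#(Ioi p) : ℝ) ≤ m := by
          have := card_Iio_add_card_Ioi p
          have : (0 : ℝ) ≤ #(Iio p) := Nat.cast_nonneg _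
          linarith
        have h2 : (#(Ioi p) : ℝ) * (1 / (24 * m)) ≤ 1 / 24 := by
          rw [mul_one_div, div_le_div_iff₀ (by positivity) (by norm_num)]
          linarith
        have h3 := Real.abs_exp_sub_one_le (x := 1 / 24) (by norm_num [abs_le])
        have h4 := (abs_le.1 h3).2
        rw [abs_of_pos (by norm_num : (0 : ℝ) < 1 / 24)] at h4
        exact (Real.exp_le_exp.2 h2).trans (by linarith)

lemma one_add_pow_sub_one_le {g : ℝ} (hg : 0 ≤ g) {N : ℕ} (h : g * N ≤ 1) :
    (1 + g) ^ N - 1 ≤ 2 * (g * N) := by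
  have h1 : (1 + g) ^ N ≤ Real.exp (g * N) := by
    rw [mul_comm g, Real.exp_nat_mul]
    exact pow_le_pow_left₀ (by linarith) (by linarith [Real.add_one_le_exp g]) N
  have h0 : 0 ≤ g * N := by positivity
  have h2 := (abs_le.1 (Real.abs_exp_sub_one_le (x := g * N) (by rw [abs_of_nonneg h0]; exact h))).2
  rw [abs_of_nonneg h0] at h2
  linarith

/-- The noise that one step in the band `p` adds, together with the later bands. -/
lemma Regime.noise_le (h : Regime L κ T Kap) (hγ : 0 ≤ γ) {p : Fin m} {r : ℝ} (hr : r ≤ 1 / 2)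
    (hp : m * γ * ∏ j ∈ Ioi p, (T j : ℝ) ≤ r) :
    (1 + m * γ) ^ (∏ j ∈ Ioi p, (T j + 1)) - 1 ≤ 4 * r := by
  have h0 : 0 ≤ m * γ := by positivity
  have h1 : m * γ * ((∏ j ∈ Ioi p, (T j + 1) : ℕ) : ℝ) ≤ 2 * r := by
    have := mul_le_mul_of_nonneg_left (h.prod_succ_le p) h0
    linarith
  have := one_add_pow_sub_one_le h0 (h1.trans (by linarith))
  linarith

/-- The noise condition for the later bands is automatic once the noise of one round of the first
band is bounded: a round of band `p` is shorter by a factor `T p`, and `T p` is at least `48 κ p`.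
-/
lemma Regime.noise_later (h : Regime L κ T Kap) (hγ : 0 ≤ γ) {o : Fin m}
    (ho : (o : ℕ) = 0) (hn : m * γ * ∏ j ∈ Ioi o, (T j : ℝ) ≤ 1) (p : Fin m)
    (hp : 0 < (p : ℕ)) :
    (1 + m * γ) ^ (∏ j ∈ Ioi p, (T j + 1)) - 1 ≤ 1 / (10 * κ p) := by
  -- A later band exists only if `m ≥ 2`, which turns `24 m κ` into `48 κ`.
  have hm : (2 : ℝ) ≤ m := by
    have : 2 ≤ m := by omega
    exact_mod_cast this
  have hκ := h.one_le_cond p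
  have hTp := h.le_steps hp
  have h0 : 0 ≤ m * γ := by positivity
  have hTp0 : 48 * κ p ≤ T p := by nlinarith
  have hTpos : (0 : ℝ) < T p := by linarith
  have h1 : (∏ j ∈ Ioi p, (T j : ℝ)) * T p ≤ ∏ j ∈ Ioi o, (T j : ℝ) := by
    have e : ∏ j ∈ insert p (Ioi p), T j ≤ ∏ j ∈ Ioi o, T j := by
      refine prod_le_prod_of_subset_of_one_le' ?_ fun j hj _ => ?_
      · intro j hj
        simp only [mem_insert, mem_Ioi, Fin.lt_def, Fin.ext_iff] at hj ⊢
        omega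
      · have hj' : 0 < (j : ℕ) := by simpa [Fin.lt_def, ho] using hj
        have h2 := h.le_steps hj'
        have h3 := h.one_le_cond j
        have : (1 : ℝ) ≤ T j := by nlinarith
        exact_mod_cast this
    rw [prod_insert (by simp), mul_comm] at e
    exact_mod_cast e
  have h2 : m * γ * ∏ j ∈ Ioi p, (T j : ℝ) ≤ 1 / (48 * κ p) := by
    have e1 := (mul_le_mul_of_nonneg_left h1 h0).trans hn
    have e2 : m * γ * ∏ j ∈ Ioi p, (T j : ℝ) ≤ 1 / T p := by
      rw [le_div_iff₀ hTpos]; linarith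
    exact e2.trans (one_div_le_one_div_of_le (by linarith) hTp0)
  refine (h.noise_le hγ ?_ h2).trans ?_
  · rw [div_le_div_iff₀ (by linarith) (by norm_num)]; linarith
  · rw [mul_one_div, div_le_div_iff₀ (by linarith) (by linarith)]; linarith

lemma exp_neg_one_div_pow (x : ℝ) (t : ℕ) : Real.exp (-(1 / x)) ^ t = Real.exp (-(t / x)) := by
  rw [← Real.exp_nat_mul]; congr 1; ring

/-- Contraction of a run with an arbitrary number of rounds of the first band. -/
theorem Regime.contraction (h : Regime L κ T Kap) (hγ : 0 ≤ γ) {o : Fin m}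
    (ho : (o : ℕ) = 0) (hTo : T o ≠ 0) (hn : m * γ * ∏ j ∈ Ioi o, (T j : ℝ) ≤ 1 / (40 * κ o))
    {V : Fin m → ℝ} (hV : 0 ≤ V) :
    ∑ j, (schedule T 0).foldl (bandStep L (fun i => (1 - 1 / κ i) ^ 2) γ) V j ≤
      2 * Real.exp (-(T o / κ o)) * ∑ j, V j := by
  have hκ := h.one_le_cond o
  have hm : (0 : ℝ) ≤ m * γ := by positivity
  have h40 : 1 / (40 * κ o) ≤ 1 / 40 := one_div_le_one_div_of_le (by norm_num) (by linarith)
  have key := sum_foldl_schedule_le h.pos h.mono h.one_le_cond hγ h.ratio h.bands h.steps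
    (h.noise_later hγ ho (hn.trans (by linarith))) ho hTo hV
  refine key.trans (mul_le_mul_of_nonneg_right ?_ (sum_nonneg fun j _ => hV j))
  have hβ := h.noise_le hγ (by linarith) hn
  have hβ0 : 1 ≤ (1 + m * γ) ^ (∏ j ∈ Ioi o, (T j + 1)) := one_le_pow₀ (by linarith)
  set G := (1 + m * γ) ^ (∏ j ∈ Ioi o, (T j + 1))
  have hx0 : 0 < 1 / κ o := by positivity
  have hx1 : 1 / κ o ≤ 1 := (div_le_one (by linarith)).2 hκ
  have e40 : 4 * (1 / (40 * κ o)) = (1 / κ o) / 10 := by field_simp; norm_num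
  have hbase : max ((1 - 1 / κ o) ^ 2) (1 / 4) + (G - 1) ≤ Real.exp (-(1 / κ o)) := by
    rw [← max_add_add_right]
    refine max_le ?_ ?_
    · have := exp_neg_ge_sq hx0.le hx1
      linarith
    · have h1 : Real.exp (-1) ≤ Real.exp (-(1 / κ o)) := Real.exp_le_exp.2 (by linarith)
      have h2 := Real.exp_neg_one_gt_d9
      linarith
  -- The final inner run after the last step in the first band contributes this factor.
  have h1 : G / (1 + m * γ) ≤ 2 := by
    rw [div_le_iff₀ (by linarith)]
    linarith
  have h2 : (0 : ℝ) ≤ max ((1 - 1 / κ o) ^ 2) (1 / 4) := le_max_of_le_right (by norm_num)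
  rw [← exp_neg_one_div_pow]
  exact mul_le_mul h1 (pow_le_pow_left₀ (by linarith) hbase _)
    (pow_nonneg (by linarith) _) (by norm_num)

/-- Contraction of a run with the prescribed number of rounds of the first band. -/
theorem Regime.contraction_of_le (h : Regime L κ T Kap) (hγ : 0 ≤ γ) {o : Fin m}
    (ho : (o : ℕ) = 0) (hTo : T o ≠ 0)
    (hn : (m = 1 ∧ γ * T o ≤ 1 ∧ 2 ≤ κ o) ∨ m * γ * ∏ j, (T j : ℝ) ≤ 1 / 40)
    {V : Fin m → ℝ} (hV : 0 ≤ V) :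
    ∑ j, (schedule T 0).foldl (bandStep L (fun i => (1 - 1 / κ i) ^ 2) γ) V j ≤
      9 * Real.exp (-(T o / κ o)) * ∑ j, V j := by
  have hκ := h.one_le_cond o
  have hm : (0 : ℝ) ≤ m * γ := by positivity
  have hTo1 : (1 : ℝ) ≤ T o := by exact_mod_cast Nat.one_le_iff_ne_zero.2 hTo
  have hx0 : 0 < 1 / κ o := by positivity
  have hx1 : 1 / κ o ≤ 1 := (div_le_one (by linarith)).2 hκ
  -- Here the noise of a single round is not compared with `1 / κ o`, as it would be for the
  -- contraction of each round separately. It suffices that its accumulation over all `T o` rounds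
  -- is bounded, expressed by `β`.
  suffices hs : m * γ * ∏ j ∈ Ioi o, (T j : ℝ) ≤ 1 ∧
      ∃ β : ℝ, 0 ≤ β ∧ β * T o ≤ 1 ∧
      (1 + m * γ) ^ (∏ j ∈ Ioi o, (T j + 1)) / (1 + m * γ) ≤ 11 / 10 ∧
      max ((1 - 1 / κ o) ^ 2) (1 / 4) + ((1 + m * γ) ^ (∏ j ∈ Ioi o, (T j + 1)) - 1) ≤
        Real.exp (-(1 / κ o)) * (1 + 2 * β) by
    obtain ⟨hs1, β, hβ0, hβT, h1, hbase⟩ := hs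
    have key := sum_foldl_schedule_le h.pos h.mono h.one_le_cond hγ h.ratio h.bands h.steps
      (h.noise_later hγ ho hs1) ho hTo hV
    refine key.trans (mul_le_mul_of_nonneg_right ?_ (sum_nonneg fun j _ => hV j))
    have hG0 : 1 ≤ (1 + m * γ) ^ (∏ j ∈ Ioi o, (T j + 1)) := one_le_pow₀ (by linarith)
    have h2 : (0 : ℝ) ≤ max ((1 - 1 / κ o) ^ 2) (1 / 4) := le_max_of_le_right (by norm_num)
    have h3 := pow_le_pow_left₀ (by linarith) hbase (T o)
    rw [mul_pow, exp_neg_one_div_pow] at h3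
    -- The accumulated noise costs at most `exp 2 ≤ 8`; together with `11 / 10` for the final inner
    -- run this gives the constant `9`.
    have h4 : (1 + 2 * β) ^ T o ≤ 8 := by
      have e1 : (1 + 2 * β) ^ T o ≤ Real.exp (2 * β) ^ T o :=
        pow_le_pow_left₀ (by linarith) (by linarith [Real.add_one_le_exp (2 * β)]) _
      rw [← Real.exp_nat_mul] at e1
      have e2 : Real.exp ((T o : ℝ) * (2 * β)) ≤ Real.exp 2 := Real.exp_le_exp.2 (by linarith)
      have e3 : Real.exp 2 ≤ 8 := by
        have e4 := Real.exp_one_lt_d9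
        have e5 : Real.exp 2 = Real.exp 1 * Real.exp 1 := by rw [← Real.exp_add]; norm_num
        nlinarith [Real.exp_pos 1]
      linarith
    have h5 := mul_le_mul h1 (h3.trans (mul_le_mul_of_nonneg_left h4 (Real.exp_pos _).le))
      (pow_nonneg (by linarith) _) (by norm_num)
    have := Real.exp_pos (-((T o : ℝ) / κ o))
    linarith
  -- For a single band the noise of a round is `γ` itself, and `κ ≥ 2` gives `exp (-1 / κ) ≥ 1 / 2`,
  -- so `γ` is absorbed by `2 γ exp (-1 / κ)`. In the other case `β = 1 / (10 T o)`.
  rcases hn with ⟨rfl, hγT, hκ2⟩ | hn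
  · have hemp : Ioi o = ∅ := by
      ext j; simp only [mem_Ioi, Fin.lt_def, notMem_empty, iff_false]; omega
    simp only [hemp, prod_empty, pow_one, Nat.cast_one, one_mul, mul_one]
    have hγ1 : γ ≤ 1 := by nlinarith
    refine ⟨hγ1, γ, hγ, hγT, by rw [div_self (by linarith)]; norm_num, ?_⟩
    have e1 : 1 / κ o ≤ 1 / 2 := one_div_le_one_div_of_le (by norm_num) hκ2
    have e2 := exp_neg_ge_sq hx0.le hx1
    have e3 := Real.add_one_le_exp (-(1 / κ o))
    rw [← max_add_add_right]
    refine max_le ?_ ?_ <;> nlinarith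
  · have hsplit : ∏ j, (T j : ℝ) = T o * ∏ j ∈ Ioi o, (T j : ℝ) := by
      have e : (univ : Finset (Fin m)) = insert o (Ioi o) := by
        ext j; simp only [mem_univ, mem_insert, mem_Ioi, Fin.lt_def, Fin.ext_iff, true_iff]; omega
      rw [e, prod_insert (by simp)]
    have hpos : 0 ≤ ∏ j ∈ Ioi o, (T j : ℝ) := prod_nonneg fun j _ => Nat.cast_nonneg _
    have hr : m * γ * ∏ j ∈ Ioi o, (T j : ℝ) ≤ 1 / (40 * T o) := by
      rw [le_div_iff₀ (by positivity)]
      rw [hsplit] at hn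
      linarith
    have hr40 : 1 / (40 * (T o : ℝ)) ≤ 1 / 40 :=
      one_div_le_one_div_of_le (by norm_num) (by linarith)
    have hβ := h.noise_le hγ (by linarith) hr
    refine ⟨by linarith, 4 * (1 / (40 * T o)), by positivity, ?_, ?_, ?_⟩
    · have : 4 * (1 / (40 * (T o : ℝ))) * T o = 1 / 10 := by field_simp; norm_num
      rw [this]; norm_num
    · rw [div_le_iff₀ (by linarith)]
      linarith
    · set β := 4 * (1 / (40 * (T o : ℝ)))
      have hβ10 : β ≤ 1 / 10 := by linarith
      have hβ0 : 0 ≤ β := by positivity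
      have e2 := exp_neg_ge_sq hx0.le hx1
      have e3 := Real.add_one_le_exp (-(1 / κ o))
      have e4 : β * (1 - 1 / κ o) ≤ β * Real.exp (-(1 / κ o)) :=
        mul_le_mul_of_nonneg_left (by linarith) hβ0
      rw [← max_add_add_right]
      refine max_le ?_ ?_
      · nlinarith
      · have h1 : Real.exp (-1) ≤ Real.exp (-(1 / κ o)) := Real.exp_le_exp.2 (by linarith)
        have h2 := Real.exp_neg_one_gt_d9
        have h3 : 0 ≤ β * Real.exp (-(1 / κ o)) := by positivity
        linarith

end BandRecursion

end StochBSLS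

namespace StochBSLS

/-! ### Semantics of programs -/

namespace Prog

variable {d : ℕ} {W : Type}

/-- Run `f k` for each `k` of a list in turn. -/
def forList {ι : Type*} (l : List ι) (f : ι → Prog d W) : Prog d W :=
  l.foldr (fun k p => seq (f k) p) skip

lemma forEach_eq_forList (f : Fin d → Prog d W) : forEach f = forList (List.finRange d) f := rfl

variable [DecidableEq W]

lemma exec_forList_cons {ι : Type*} (z : ℕ → Sample d) (k : ι) (l : List ι) (f : ι → Prog d W)
    (σ : Config d W) :
    exec z (forList (k :: l) f) σ = exec z (forList l f) (exec z (f k) σ) := rfl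

/-- A loop over blocks, each of which writes one register `G k` and the scratch register `t`. -/
lemma exec_forEach_update (z : ℕ → Sample d) {f : Fin d → Prog d W} {t : Reg d W}
    {G : Fin d → Reg d W} {F : Fin d → (Reg d W → ℝ) → ℝ} (hG : Function.Injective G)
    (hGt : ∀ k, G k ≠ t)
    (hcount : ∀ k σ, (exec z (f k) σ).2 = σ.2)
    (hval : ∀ k σ, (exec z (f k) σ).1 (G k) = F k σ.1)
    (hframe : ∀ k σ r, r ≠ t → r ≠ G k → (exec z (f k) σ).1 r = σ.1 r)
    (hF : ∀ k ρ ρ', (∀ r, r ≠ t → (∀ j, j ≠ k → r ≠ G j) → ρ r = ρ' r) → F k ρ = F k ρ')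
    (σ : Config d W) :
    (exec z (forEach f) σ).2 = σ.2 ∧ (∀ k, (exec z (forEach f) σ).1 (G k) = F k σ.1) ∧
      ∀ r, r ≠ t → (∀ k, r ≠ G k) → (exec z (forEach f) σ).1 r = σ.1 r := by
  have main : ∀ (l : List (Fin d)), l.Nodup → ∀ σ : Config d W,
      (exec z (forList l f) σ).2 = σ.2 ∧ (∀ k ∈ l, (exec z (forList l f) σ).1 (G k) = F k σ.1) ∧
      ∀ r, r ≠ t → (∀ k ∈ l, r ≠ G k) → (exec z (forList l f) σ).1 r = σ.1 r := by
    intro l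
    induction l with
    | nil => intro _ σ; exact ⟨rfl, by simp, fun r _ _ => rfl⟩
    | cons k l ih =>
      intro hl σ
      obtain ⟨hkl, hl⟩ := List.nodup_cons.1 hl
      obtain ⟨h1, h2, h3⟩ := ih hl (exec z (f k) σ)
      rw [exec_forList_cons]
      refine ⟨h1.trans (hcount k σ), fun j hj => ?_, fun r hr hr' => ?_⟩
      · rcases List.mem_cons.1 hj with rfl | hj
        · rw [h3 _ (hGt j) fun i hi h => hkl (hG h ▸ hi), hval]
        · rw [h2 j hj]
          -- Block `k` has changed only `t` and `G k`, and the value computed by block `j` reads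
          -- neither.
          exact hF j _ _ fun r hr hr' =>
            hframe k σ r hr (hr' k (by rintro rfl; exact hkl hj))
      · rw [h3 r hr fun i hi => hr' i (List.mem_cons_of_mem _ hi),
          hframe k σ r hr (hr' k List.mem_cons_self)]
  obtain ⟨h1, h2, h3⟩ := main (List.finRange d) (List.nodup_finRange d) σ
  exact ⟨h1, fun k => h2 k (List.mem_finRange k), fun r hr hr' => h3 r hr fun k _ => hr' k⟩

/-- The accumulation of a dot product. -/
lemma exec_dot (z : ℕ → Sample d) {s t : Reg d W} {A X : Fin d → Reg d W} (hst : s ≠ t)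
    (hA : ∀ k, A k ≠ s ∧ A k ≠ t) (hX : ∀ k, X k ≠ s ∧ X k ≠ t) (σ : Config d W) :
    (exec z (forEach fun k => seq (mul t (A k) (X k)) (add s s t)) σ).2 = σ.2 ∧
    (exec z (forEach fun k => seq (mul t (A k) (X k)) (add s s t)) σ).1 s =
      σ.1 s + ∑ k, σ.1 (A k) * σ.1 (X k) ∧
    ∀ r, r ≠ s → r ≠ t →
      (exec z (forEach fun k => seq (mul t (A k) (X k)) (add s s t)) σ).1 r = σ.1 r := by
  have main : ∀ (l : List (Fin d)) (σ : Config d W),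
      (exec z (forList l fun k => seq (mul t (A k) (X k)) (add s s t)) σ).2 = σ.2 ∧
      (exec z (forList l fun k => seq (mul t (A k) (X k)) (add s s t)) σ).1 s =
        σ.1 s + (l.map fun k => σ.1 (A k) * σ.1 (X k)).sum ∧
      ∀ r, r ≠ s → r ≠ t →
        (exec z (forList l fun k => seq (mul t (A k) (X k)) (add s s t)) σ).1 r = σ.1 r := by
    intro l
    induction l with
    | nil => intro σ; exact ⟨rfl, by simp [forList, exec], fun r _ _ => rfl⟩
    | cons k l ih =>
      intro σ
      rw [exec_forList_cons]
      obtain ⟨h1, h2, h3⟩ := ih (exec z (seq (mul t (A k) (X k)) (add s s t)) σ)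
      have e : ∀ r, r ≠ s → r ≠ t →
          (exec z (seq (mul t (A k) (X k)) (add s s t)) σ).1 r = σ.1 r := by
        intro r hr hr'
        simp [exec, hr, hr']
      refine ⟨h1, ?_, fun r hr hr' => ?_⟩
      · rw [h2, List.map_cons, List.sum_cons]
        have e1 : (exec z (seq (mul t (A k) (X k)) (add s s t)) σ).1 s =
            σ.1 s + σ.1 (A k) * σ.1 (X k) := by
          simp [exec, hst]
        rw [e1, add_assoc]
        congr 3
        refine List.map_congr_left fun j _ => ?_
        rw [e _ (hA j).1 (hA j).2, e _ (hX j).1 (hX j).2]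
      · rw [h3 r hr hr', e r hr hr']
  obtain ⟨h1, h2, h3⟩ := main (List.finRange d) σ
  refine ⟨h1, ?_, h3⟩
  rw [forEach_eq_forList, h2, ← List.ofFn_eq_map, List.sum_ofFn]

end Prog

/-! ### The program of stochastic BSLS: iterates, number of samples, space -/

open Prog

variable {d : ℕ}

/-- One minibatch gradient step of size `η` on the samples `y`. -/
def batchStep {n : ℕ} (η : ℝ) (y : Fin n → Sample d) (x : Vec d) : Vec d :=
  x - η • ∑ j, ((1 / (n : ℝ)) * (inner ℝ (y j).1 x - (y j).2)) • (y j).1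

/-- The `n` samples of a stream from position `off` on. -/
def block (n off : ℕ) (z : ℕ → Sample d) : Fin n → Sample d := fun j => z (off + j)

/-- A sequence of minibatch steps, with the position in the stream. -/
def gdRun (n : ℕ) (z : ℕ → Sample d) (ηs : List ℝ) (s : Vec d × ℕ) : Vec d × ℕ :=
  ηs.foldl (fun s η => (batchStep η (block n s.2 z) s.1, s.2 + n)) s

lemma gdRun_snd (n : ℕ) (z : ℕ → Sample d) (ηs : List ℝ) (s : Vec d × ℕ) :
    (gdRun n z ηs s).2 = s.2 + n * ηs.length := by
  induction ηs generalizing s with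
  | nil => simp [gdRun]
  | cons η ηs ih =>
    have := ih (batchStep η (block n s.2 z) s.1, s.2 + n)
    simp only [gdRun, List.foldl_cons, List.length_cons] at this ⊢
    rw [this]; ring

lemma inner_eq_sum (a x : Vec d) : inner ℝ a x = ∑ k, a k * x k := by
  simp [PiLp.inner_apply, mul_comm]

/-- The part of `accumulate` that follows the request of the sample. -/
def addGradient (d n : ℕ) : Prog d (Work d) :=
  seq (const sReg 0) <|
  seq (forEach fun k => seq (mul tReg (aReg k) (xReg k)) (add sReg sReg tReg)) <|
  seq (sub sReg sReg bReg) <|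
  seq (const cReg (1 / (n : ℝ))) <|
  seq (mul sReg cReg sReg) <|
  forEach fun k => seq (mul tReg sReg (aReg k)) (add (gReg k) (gReg k) tReg)

/-- The part of `gdStoch` that follows the accumulation of the gradient. -/
def applyGradient (d : ℕ) : Prog d (Work d) :=
  forEach fun k => seq (mul tReg cReg (gReg k)) (sub (xReg k) (xReg k) tReg)

lemma exec_addGradient (z : ℕ → Sample d) (n : ℕ) (σ : Config d (Work d)) :
    (exec z (addGradient d n) σ).2 = σ.2 ∧
    (∀ k, (exec z (addGradient d n) σ).1 (xReg k) = σ.1 (xReg k)) ∧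
    (∀ k, (exec z (addGradient d n) σ).1 (aReg k) = σ.1 (aReg k)) ∧
    (exec z (addGradient d n) σ).1 bReg = σ.1 bReg ∧
    ∀ k, (exec z (addGradient d n) σ).1 (gReg k) = σ.1 (gReg k) +
      (1 / (n : ℝ)) * (∑ j, σ.1 (aReg j) * σ.1 (xReg j) - σ.1 bReg) * σ.1 (aReg k) := by
  set σ1 := exec z (const sReg 0) σ with hσ1
  obtain ⟨h1, h2, h3⟩ := exec_dot z (s := sReg) (t := tReg) (A := aReg) (X := xReg)
    (by simp) (by simp) (by simp) σ1
  set σ2 := exec z (forEach fun k => seq (mul tReg (aReg k) (xReg k)) (add sReg sReg tReg)) σ1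
    with hσ2
  set σ3 := exec z (seq (sub sReg sReg bReg) (seq (const cReg (1 / (n : ℝ))) (mul sReg cReg sReg)))
    σ2 with hσ3
  obtain ⟨h4, h5, h6⟩ := exec_forEach_update z (t := tReg) (G := gReg)
    (f := fun k => seq (mul tReg sReg (aReg k)) (add (gReg k) (gReg k) tReg))
    (F := fun k ρ => ρ (gReg k) + ρ sReg * ρ (aReg k))
    (fun i j h => by simpa using h) (by simp) (fun k σ => rfl)
    (fun k σ => by simp [exec])
    (fun k σ r hr hr' => by simp [exec, hr, hr'])
    (fun k ρ ρ' h => by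
      rw [h (gReg k) (by simp) (fun j hj => by simpa using hj.symm), h sReg (by simp) (by simp),
        h (aReg k) (by simp) (by simp)]) σ3
  have hE : exec z (addGradient d n) σ =
      exec z (forEach fun k => seq (mul tReg sReg (aReg k)) (add (gReg k) (gReg k) tReg)) σ3 := rfl
  have hfr : ∀ r, r ≠ sReg → r ≠ tReg → r ≠ cReg → σ3.1 r = σ.1 r := by
    intro r hs ht hc
    have e1 : σ3.1 r = σ2.1 r := by
      rw [hσ3]; simp [exec, hs, hc]
    rw [e1, h3 r hs ht, hσ1]
    simp [exec, hs]
  have hs : σ3.1 sReg = (1 / (n : ℝ)) * (∑ j, σ.1 (aReg j) * σ.1 (xReg j) - σ.1 bReg) := by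
    have e1 : σ3.1 sReg = (1 / (n : ℝ)) * (σ2.1 sReg - σ2.1 bReg) := by
      rw [hσ3]; simp [exec]
    rw [e1, h2, h3 bReg (by simp) (by simp), hσ1]
    simp [exec]
  rw [hE]
  refine ⟨h4.trans h1, fun k => ?_, fun k => ?_, ?_, fun k => ?_⟩
  · rw [h6 _ (by simp) (by simp), hfr _ (by simp) (by simp) (by simp)]
  · rw [h6 _ (by simp) (by simp), hfr _ (by simp) (by simp) (by simp)]
  · rw [h6 _ (by simp) (by simp), hfr _ (by simp) (by simp) (by simp)]
  · rw [h5 k, hs, hfr _ (by simp) (by simp) (by simp), hfr _ (by simp) (by simp) (by simp)]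

lemma exec_applyGradient (z : ℕ → Sample d) (σ : Config d (Work d)) :
    (exec z (applyGradient d) σ).2 = σ.2 ∧
    (∀ k, (exec z (applyGradient d) σ).1 (xReg k) =
      σ.1 (xReg k) - σ.1 cReg * σ.1 (gReg k)) ∧
    ∀ r, r ≠ tReg → (∀ k, r ≠ xReg k) → (exec z (applyGradient d) σ).1 r = σ.1 r :=
  exec_forEach_update z (t := tReg) (G := xReg)
    (F := fun k ρ => ρ (xReg k) - ρ cReg * ρ (gReg k))
    (fun i j h => by simpa using h) (by simp) (fun k σ => rfl)
    (fun k σ => by simp [exec])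
    (fun k σ r hr hr' => by simp [exec, hr, hr'])
    (fun k ρ ρ' h => by
      rw [h (xReg k) (by simp) (fun j hj => by simpa using hj.symm), h cReg (by simp) (by simp),
        h (gReg k) (by simp) (by simp)]) σ

/-- The iterate that a configuration holds, and the number of samples that were drawn. -/
def iterate (σ : Config d (Work d)) : Vec d × ℕ := (WithLp.toLp 2 fun k => σ.1 (xReg k), σ.2)

lemma exec_query_eq (z : ℕ → Sample d) (σ : Config d (Work d)) :
    (exec z (query aReg bReg) σ).2 = σ.2 + 1 ∧
    (∀ k, (exec z (query aReg bReg) σ).1 (aReg k) = (z σ.2).1 k) ∧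
    (exec z (query aReg bReg) σ).1 bReg = (z σ.2).2 ∧
    ∀ r, r ≠ bReg → (∀ k, r ≠ aReg k) → (exec z (query aReg bReg) σ).1 r = σ.1 r := by
  have hinj : Function.Injective (aReg (d := d)) := fun i j h => by simpa using h
  refine ⟨rfl, fun k => ?_, by simp [exec], fun r hr hr' => ?_⟩
  · simp only [exec]
    rw [Function.update_of_ne (by simp), hinj.extend_apply]
  · simp only [exec]
    rw [Function.update_of_ne hr, Function.extend_apply' _ _ _ (by rintro ⟨k, rfl⟩; exact hr' k rfl)]

lemma exec_accumulate (z : ℕ → Sample d) (n : ℕ) (σ : Config d (Work d)) :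
    (iterate (exec z (accumulate d n) σ)) = ((iterate σ).1, σ.2 + 1) ∧
    ∀ k, (exec z (accumulate d n) σ).1 (gReg k) = σ.1 (gReg k) +
      (1 / (n : ℝ)) * (inner ℝ (z σ.2).1 (iterate σ).1 - (z σ.2).2) * (z σ.2).1 k := by
  obtain ⟨q1, q2, q3, q4⟩ := exec_query_eq z σ
  set σ1 := exec z (query aReg bReg) σ
  obtain ⟨h1, h2, -, -, h5⟩ := exec_addGradient z n σ1
  have hE : exec z (accumulate d n) σ = exec z (addGradient d n) σ1 := rfl
  have hx : ∀ k, σ1.1 (xReg k) = σ.1 (xReg k) := fun k => q4 _ (by simp) (by simp)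
  rw [hE]
  refine ⟨?_, fun k => ?_⟩
  · simp only [iterate, h1, q1, h2, hx]
  · rw [h5 k, q3, q4 (gReg k) (by simp) (by simp), inner_eq_sum]
    simp only [q2, hx, iterate]

lemma exec_loop_accumulate (z : ℕ → Sample d) (n i : ℕ) (σ : Config d (Work d)) :
    (iterate (exec z (loop i (accumulate d n)) σ)) = ((iterate σ).1, σ.2 + i) ∧
    ∀ k, (exec z (loop i (accumulate d n)) σ).1 (gReg k) = σ.1 (gReg k) +
      ∑ j ∈ Finset.range i, (1 / (n : ℝ)) *
        (inner ℝ (z (σ.2 + j)).1 (iterate σ).1 - (z (σ.2 + j)).2) * (z (σ.2 + j)).1 k := by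
  induction i with
  | zero => simp [exec, iterate]
  | succ i ih =>
    obtain ⟨h1, h2⟩ := ih
    have hE : exec z (loop (i + 1) (accumulate d n)) σ =
        exec z (accumulate d n) (exec z (loop i (accumulate d n)) σ) := by
      simp only [exec, Function.iterate_succ', Function.comp_apply]
    set σ1 := exec z (loop i (accumulate d n)) σ
    obtain ⟨h3, h4⟩ := exec_accumulate z n σ1
    have e : σ1.2 = σ.2 + i := congrArg Prod.snd h1
    rw [hE]
    refine ⟨by rw [h3, h1, e, add_assoc], fun k => ?_⟩
    rw [h4, h2, Finset.sum_range_succ, h1, e, add_assoc]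

lemma exec_gdStoch (z : ℕ → Sample d) (n : ℕ) (L : ℝ) (σ : Config d (Work d)) :
    iterate (exec z (gdStoch d n L) σ) =
      (batchStep (1 / L) (block n σ.2 z) (iterate σ).1, σ.2 + n) := by
  obtain ⟨a1, a2, a3⟩ := exec_forEach_update z (t := tReg) (G := gReg)
    (f := fun k => const (gReg k) 0) (F := fun k ρ => 0)
    (fun i j h => by simpa using h) (by simp) (fun k σ => rfl)
    (fun k σ => by simp [exec])
    (fun k σ r hr hr' => by simp [exec, hr'])
    (fun k ρ ρ' h => rfl) σ
  set σ1 := exec z (forEach fun k => const (gReg k) 0) σ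
  obtain ⟨b1, b2⟩ := exec_loop_accumulate z n n σ1
  set σ2 := exec z (loop n (accumulate d n)) σ1
  set σ3 := exec z (const cReg (1 / L)) σ2 with hσ3
  obtain ⟨c1, c2, -⟩ := exec_applyGradient z σ3
  have hE : exec z (gdStoch d n L) σ = exec z (applyGradient d) σ3 := rfl
  have h1 : iterate σ1 = iterate σ := by
    simp only [iterate, a1, a3 _ (show xReg _ ≠ tReg by simp) (show ∀ k, xReg _ ≠ gReg k by simp)]
  have hx2 : ∀ k, σ2.1 (xReg k) = (iterate σ).1 k := fun k => by
    have := congrArg (fun s : Vec d × ℕ => s.1 k) b1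
    rw [h1] at this
    exact this
  have h32 : σ3.2 = σ2.2 := rfl
  have h22 : σ2.2 = σ.2 + n := by
    have := congrArg Prod.snd b1
    rw [a1] at this
    exact this
  rw [hE]
  refine Prod.ext ?_ ?_
  · ext k
    change (exec z (applyGradient d) σ3).1 (xReg k) = _
    rw [c2]
    have e1 : σ3.1 (xReg k) = σ2.1 (xReg k) := by rw [hσ3]; simp [exec]
    have e2 : σ3.1 (gReg k) = σ2.1 (gReg k) := by rw [hσ3]; simp [exec]
    have e3 : σ3.1 cReg = 1 / L := by rw [hσ3]; simp [exec]
    rw [e1, e2, e3, hx2, b2, a2, h1, a1, zero_add, Finset.sum_range]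
    simp [batchStep, block]
  · change (exec z (applyGradient d) σ3).2 = _
    rw [c1, h32, h22]

lemma iterate_exec_loop (z : ℕ → Sample d) (p : Prog d (Work d)) (f : Vec d × ℕ → Vec d × ℕ)
    (h : ∀ σ, iterate (exec z p σ) = f (iterate σ)) (T : ℕ) (σ : Config d (Work d)) :
    iterate (exec z (loop T p) σ) = f^[T] (iterate σ) := by
  simp only [exec]
  induction T generalizing σ with
  | zero => rfl
  | succ T ih => rw [Function.iterate_succ_apply, ih, h, Function.iterate_succ_apply]

/-- The link between programs and analysis: each call resets its gradient registers, so the iterate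
and the position in the stream evolve by themselves, whatever the other registers hold. -/
lemma exec_bslsList (z : ℕ → Sample d) (n : ℕ) (l : List (ℕ × ℝ)) (σ : Config d (Work d)) :
    iterate (exec z (bslsList d n l) σ) =
      gdRun n z ((bslsSteps l).map fun L => 1 / L) (iterate σ) := by
  induction l generalizing σ with
  | nil => rfl
  | cons q rest ih =>
    obtain ⟨T, L⟩ := q
    have hE : exec z (bslsList d n ((T, L) :: rest)) σ = exec z (bslsList d n rest)
        (exec z (loop T (seq (bslsList d n rest) (gdStoch d n L))) σ) := rfl
    rw [hE, ih, iterate_exec_loop z _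
      (fun s => gdRun n z ((bslsSteps rest ++ [L]).map fun L => 1 / L) s)]
    · simp only [gdRun, List.foldl_map, bslsSteps, List.foldl_append, foldl_flatten_replicate]
    · intro σ
      have hE : exec z (seq (bslsList d n rest) (gdStoch d n L)) σ =
        exec z (gdStoch d n L) (exec z (bslsList d n rest) σ) := rfl
      rw [hE, exec_gdStoch]
      have h2 : (exec z (bslsList d n rest) σ).2 = (iterate (exec z (bslsList d n rest) σ)).2 := rfl
      rw [h2, ih σ]
      simp [gdRun]

/-- The step sizes of stochastic BSLS. -/
def bslsEtas {m : ℕ} (T : Fin m → ℕ) (L : Fin m → ℝ) : List ℝ :=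
  (schedule T 0).map fun p => 1 / L p

lemma bslsStoch_iterate {m : ℕ} (z : ℕ → Sample d) (n : ℕ) (T : Fin m → ℕ) (L : Fin m → ℝ)
    (x : Vec d) : iterate (exec z (bslsStoch d n T L) (start x)) =
      gdRun n z (bslsEtas T L) (x, 0) := by
  rw [bslsStoch, exec_bslsList, bslsEtas, schedule, List.drop_zero]
  have := bslsSteps_map L ((List.finRange m).map fun i => (T i, i))
  rw [List.map_map] at this
  have e : ((fun q : ℕ × Fin m => (q.1, L q.2)) ∘ fun i => (T i, i)) = fun i => (T i, L i) := rfl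
  rw [e] at this
  rw [this, List.map_map]
  rfl

lemma bslsStoch_result {m : ℕ} (z : ℕ → Sample d) (n : ℕ) (T : Fin m → ℕ) (L : Fin m → ℝ)
    (x : Vec d) : (bslsStoch d n T L).result x z = (gdRun n z (bslsEtas T L) (x, 0)).1 := by
  rw [← bslsStoch_iterate]; rfl

lemma length_schedule {m : ℕ} (T : Fin m → ℕ) : (schedule T 0).length + 1 = ∏ i, (T i + 1) := by
  rw [schedule, length_bslsSteps, List.drop_zero, List.map_map, Fin.prod_univ_def]
  rfl

lemma bslsStoch_queries {m : ℕ} (z : ℕ → Sample d) (n : ℕ) (T : Fin m → ℕ) (L : Fin m → ℝ)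
    (x : Vec d) : (bslsStoch d n T L).queries x z = n * (schedule T 0).length := by
  have h := congrArg Prod.snd (bslsStoch_iterate z n T L x)
  rw [gdRun_snd, bslsEtas, List.length_map, zero_add] at h
  exact h

/-- The source of the factor `2 ^ m` in the number of samples: `T + 1 ≤ 2 T` for each band. -/
lemma prod_succ_le_two_pow {m : ℕ} {T : Fin m → ℕ} (hT : ∀ i, 1 ≤ T i) :
    ∏ i, (T i + 1) ≤ 2 ^ m * ∏ i, T i := by
  calc ∏ i, (T i + 1) ≤ ∏ i, 2 * T i := Finset.prod_le_prod' fun i _ => by have := hT i; omega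
    _ = 2 ^ m * ∏ i, T i := by rw [Finset.prod_mul_distrib]; simp

lemma bslsStoch_queries_le {m : ℕ} (z : ℕ → Sample d) (n : ℕ) {T : Fin m → ℕ} (L : Fin m → ℝ)
    (x : Vec d) (hT : ∀ i, 1 ≤ T i) :
    (bslsStoch d n T L).queries x z ≤ n * 2 ^ m * ∏ i, T i := by
  rw [bslsStoch_queries, mul_assoc]
  refine Nat.mul_le_mul_left n ?_
  have := length_schedule T
  have := prod_succ_le_two_pow hT
  omega

lemma loopDepth_forList {W : Type} {ι : Type*} (l : List ι) {f : ι → Prog d W} {D : ℕ}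
    (h : ∀ k, (f k).loopDepth ≤ D) : (forList l f).loopDepth ≤ D := by
  induction l with
  | nil => exact Nat.zero_le _
  | cons k l ih => exact max_le (h k) ih

lemma loopDepth_addGradient (d n : ℕ) : (addGradient d n).loopDepth = 0 := by
  have h1 := loopDepth_forList (List.finRange d) (D := 0)
    (f := fun k : Fin d => seq (mul tReg (aReg k) (xReg k)) (add sReg sReg tReg))
    (fun k => by simp [loopDepth])
  have h2 := loopDepth_forList (List.finRange d) (D := 0)
    (f := fun k : Fin d => seq (mul tReg sReg (aReg k)) (add (gReg k) (gReg k) tReg))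
    (fun k => by simp [loopDepth])
  rw [← forEach_eq_forList] at h1 h2
  simp only [addGradient, loopDepth]
  omega

lemma loopDepth_applyGradient (d : ℕ) : (applyGradient d).loopDepth = 0 := by
  have h2 := loopDepth_forList (List.finRange d) (D := 0)
    (f := fun k : Fin d => seq (mul tReg cReg (gReg k)) (sub (xReg k) (xReg k) tReg))
    (fun k => by simp [loopDepth])
  rw [← forEach_eq_forList] at h2
  exact Nat.le_zero.1 h2

lemma loopDepth_gdStoch (d n : ℕ) (L : ℝ) : (gdStoch d n L).loopDepth ≤ 1 := by
  have h1 := loopDepth_forList (List.finRange d) (D := 0)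
    (f := fun k : Fin d => (const (gReg k) 0 : Prog d (Work d))) (fun k => by simp [loopDepth])
  rw [← forEach_eq_forList] at h1
  have h2 := loopDepth_addGradient d n
  have h3 := loopDepth_applyGradient d
  change max _ (max (max 0 (addGradient d n).loopDepth + 1)
    (max 0 (applyGradient d).loopDepth)) ≤ 1
  omega

lemma loopDepth_bslsList (d n : ℕ) (l : List (ℕ × ℝ)) :
    (bslsList d n l).loopDepth ≤ l.length + 1 := by
  induction l with
  | nil => simp [bslsList, loopDepth]
  | cons q rest ih =>
    obtain ⟨T, L⟩ := q
    have := loopDepth_gdStoch d n L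
    simp only [bslsList, loopDepth, List.length_cons]
    omega

lemma bslsStoch_space_le {m : ℕ} [NeZero m] (d n : ℕ) (T : Fin m → ℕ) (L : Fin m → ℝ) :
    (bslsStoch d n T L).space ≤ 6 * (d + m) := by
  have h := loopDepth_bslsList d n ((List.finRange m).map fun i => (T i, L i))
  have hm : 0 < m := NeZero.pos m
  simp only [List.length_map, List.length_finRange] at h
  simp only [space, bslsStoch, Fintype.card_sum, Fintype.card_fin]
  omega

end StochBSLS

namespace StochBSLS

/-! ### Moments of one minibatch step -/

open ProbabilityTheory Finset

variable {d m : ℕ} [NeZero m] {𝒟 : Measure (Sample d)} [IsProbabilityMeasure 𝒟] {xopt : Vec d}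
  {β : Bands m} {u : OrthonormalBasis (Fin d) ℝ (Vec d)} {lam : Fin d → ℝ} {band : Fin d → Fin m}
  {C : ℝ}

lemma Problem.lam_pos (hp : Problem 𝒟 xopt β u lam band C) (k : Fin d) : 0 < lam k :=
  (β.lo_pos _).trans_le (hp.mem_band k).1

lemma integrable_inner_four (h4 : MemLp (fun z : Sample d => z.1) 4 𝒟) (w₁ w₂ w₃ w₄ : Vec d) :
    Integrable (fun z : Sample d =>
      inner ℝ w₁ z.1 * inner ℝ w₂ z.1 * inner ℝ w₃ z.1 * inner ℝ w₄ z.1) 𝒟 := by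
  have h : Integrable (fun z : Sample d => ‖z.1‖ ^ 4) 𝒟 := by
    exact_mod_cast h4.integrable_norm_pow (p := 4) (by norm_num)
  refine (h.const_mul (‖w₁‖ * ‖w₂‖ * ‖w₃‖ * ‖w₄‖)).mono' (by fun_prop) ?_
  filter_upwards with z
  rw [norm_mul, norm_mul, norm_mul]
  have h1 := norm_inner_le_norm (𝕜 := ℝ) w₁ z.1
  have h2 := norm_inner_le_norm (𝕜 := ℝ) w₂ z.1
  have h3 := norm_inner_le_norm (𝕜 := ℝ) w₃ z.1
  have h4 := norm_inner_le_norm (𝕜 := ℝ) w₄ z.1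
  calc _ ≤ (‖w₁‖ * ‖z.1‖) * (‖w₂‖ * ‖z.1‖) * (‖w₃‖ * ‖z.1‖) * (‖w₄‖ * ‖z.1‖) := by gcongr
    _ = _ := by ring

lemma integrable_inner_two (h4 : MemLp (fun z : Sample d => z.1) 4 𝒟) (w₁ w₂ : Vec d) :
    Integrable (fun z : Sample d => inner ℝ w₁ z.1 * inner ℝ w₂ z.1) 𝒟 := by
  have h2 : MemLp (fun z : Sample d => z.1) 2 𝒟 := h4.mono_exponent (by norm_num)
  have h : Integrable (fun z : Sample d => ‖z.1‖ ^ 2) 𝒟 := by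
    exact_mod_cast h2.integrable_norm_pow (p := 2) (by norm_num)
  refine (h.const_mul (‖w₁‖ * ‖w₂‖)).mono' (by fun_prop) ?_
  filter_upwards with z
  rw [norm_mul]
  have h1 := norm_inner_le_norm (𝕜 := ℝ) w₁ z.1
  have h2 := norm_inner_le_norm (𝕜 := ℝ) w₂ z.1
  calc _ ≤ (‖w₁‖ * ‖z.1‖) * (‖w₂‖ * ‖z.1‖) := by gcongr
    _ = _ := by ring

/-- The eigenvalue equation in weak form. It gives the mean of each coordinate of the stochastic
gradient. -/
lemma Problem.integral_inner_two (hp : Problem 𝒟 xopt β u lam band C) (k : Fin d) (e : Vec d) :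
    ∫ z, inner ℝ (u k) z.1 * inner ℝ e z.1 ∂𝒟 = lam k * inner ℝ (u k) e := by
  have hij : ∀ i j : Fin d, Integrable (fun z : Sample d => z.1 i * z.1 j) 𝒟 := fun i j => by
    simpa [inner_eq_sum, Pi.single_apply] using integrable_inner_two hp.fourth_moment
      (EuclideanSpace.single i (1 : ℝ)) (EuclideanSpace.single j (1 : ℝ))
  have h1 : ∀ z : Sample d, inner ℝ (u k) z.1 * inner ℝ e z.1 =
      ∑ i, ∑ j, (e i * u k j) * (z.1 i * z.1 j) := fun z => by
    rw [inner_eq_sum, inner_eq_sum, mul_comm, sum_mul_sum]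
    refine sum_congr rfl fun i _ => sum_congr rfl fun j _ => by ring
  simp_rw [h1]
  rw [integral_finsetSum _ fun i _ => integrable_finsetSum _ fun j _ => (hij i j).const_mul _]
  have h2 : ∀ i, ∫ z, ∑ j, (e i * u k j) * (z.1 i * z.1 j) ∂𝒟 = e i * (lam k * u k i) := by
    intro i
    rw [integral_finsetSum _ fun j _ => (hij i j).const_mul _]
    have h3 := congrFun (hp.eigen k) i
    simp only [Matrix.mulVec, dotProduct, covariance, Matrix.of_apply, Pi.smul_apply,
      smul_eq_mul] at h3
    rw [← h3, mul_sum]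
    refine sum_congr rfl fun j _ => ?_
    rw [integral_const_mul]; ring
  simp_rw [h2]
  rw [inner_eq_sum, mul_sum]
  refine sum_congr rfl fun i _ => by ring

lemma Problem.integral_sq_inner (hp : Problem 𝒟 xopt β u lam band C) (e : Vec d) :
    ∫ z, inner ℝ e z.1 ^ 2 ∂𝒟 = ∑ k, lam k * inner ℝ (u k) e ^ 2 := by
  have h1 : ∀ z : Sample d, inner ℝ e z.1 ^ 2 =
      ∑ k, inner ℝ (u k) e * (inner ℝ (u k) z.1 * inner ℝ e z.1) := fun z => by
    have : inner ℝ e z.1 = ∑ k, inner ℝ (u k) e * inner ℝ (u k) z.1 := by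
      rw [← u.sum_inner_mul_inner e z.1]
      exact sum_congr rfl fun k _ => by rw [real_inner_comm]
    rw [pow_two]
    nth_rewrite 1 [this]
    rw [sum_mul]
    exact sum_congr rfl fun k _ => by ring
  simp_rw [h1]
  rw [integral_finsetSum _ fun k _ => (integrable_inner_two hp.fourth_moment _ _).const_mul _]
  refine sum_congr rfl fun k _ => ?_
  rw [integral_const_mul, hp.integral_inner_two]; ring

/-- The mixed fourth moment is bounded by the pure ones through the inequality of arithmetic and
geometric means. The weights `lam j / lam k` and `lam k / lam j` balance the two terms, so the
constant stays `C`. -/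
lemma Problem.integral_sq_mul_sq_le (hp : Problem 𝒟 xopt β u lam band C) (k j : Fin d) :
    ∫ z, inner ℝ (u k) z.1 ^ 2 * inner ℝ (u j) z.1 ^ 2 ∂𝒟 ≤ C * lam k * lam j := by
  have hk := hp.lam_pos k
  have hj := hp.lam_pos j
  have hint : ∀ w : Vec d, Integrable (fun z : Sample d => inner ℝ w z.1 ^ 4) 𝒟 := fun w => by
    refine (integrable_inner_four hp.fourth_moment w w w w).congr (ae_of_all _ fun z => ?_)
    simp only; ring
  have h2 : ∀ k, ∫ z, inner ℝ (u k) z.1 ^ 2 ∂𝒟 = lam k := fun k => by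
    have := hp.integral_inner_two k (u k)
    rw [real_inner_self_eq_norm_sq, u.norm_eq_one, one_pow, mul_one] at this
    rw [← this]
    exact integral_congr_ae (ae_of_all _ fun z => by ring)
  have hkur : ∀ k, ∫ z, inner ℝ (u k) z.1 ^ 4 ∂𝒟 ≤ C * lam k ^ 2 := fun k => by
    have := hp.kurtosis (u k)
    rwa [h2] at this
  have h3 : ∫ z, inner ℝ (u k) z.1 ^ 2 * inner ℝ (u j) z.1 ^ 2 ∂𝒟 ≤
      ∫ z, (lam j / (2 * lam k) * inner ℝ (u k) z.1 ^ 4 +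
        lam k / (2 * lam j) * inner ℝ (u j) z.1 ^ 4) ∂𝒟 := by
    refine integral_mono ?_ (((hint _).const_mul _).add ((hint _).const_mul _)) fun z => ?_
    · refine (integrable_inner_four hp.fourth_moment (u k) (u k) (u j) (u j)).congr
        (ae_of_all _ fun z => ?_)
      simp only; ring
    · simp only
      have h4 := sq_nonneg (lam j * inner ℝ (u k) z.1 ^ 2 - lam k * inner ℝ (u j) z.1 ^ 2)
      have e : lam j / (2 * lam k) * inner ℝ (u k) z.1 ^ 4 +
        lam k / (2 * lam j) * inner ℝ (u j) z.1 ^ 4 =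
          ((lam j * inner ℝ (u k) z.1 ^ 2) ^ 2 + (lam k * inner ℝ (u j) z.1 ^ 2) ^ 2) /
            (2 * lam k * lam j) := by
        field_simp
      rw [e, le_div_iff₀ (by positivity)]
      nlinarith
  refine h3.trans ?_
  rw [integral_add ((hint _).const_mul _) ((hint _).const_mul _), integral_const_mul,
    integral_const_mul]
  have h5 := mul_le_mul_of_nonneg_left (hkur k) (show 0 ≤ lam j / (2 * lam k) by positivity)
  have h6 := mul_le_mul_of_nonneg_left (hkur j) (show 0 ≤ lam k / (2 * lam j) by positivity)
  have e1 : lam j / (2 * lam k) * (C * lam k ^ 2) = C * lam k * lam j / 2 := by field_simp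
  have e2 : lam k / (2 * lam j) * (C * lam j ^ 2) = C * lam k * lam j / 2 := by field_simp
  linarith

/-- The second moment of one coordinate of a stochastic gradient. -/
lemma Problem.integral_sq_gradient_le (hp : Problem 𝒟 xopt β u lam band C) (k : Fin d)
    (e : Vec d) :
    ∫ z, (inner ℝ (u k) z.1 * inner ℝ e z.1) ^ 2 ∂𝒟 ≤
      C * lam k * ∑ j, lam j * inner ℝ (u j) e ^ 2 := by
  have hint : ∀ j l, Integrable (fun z : Sample d =>
      inner ℝ (u j) z.1 * inner ℝ (u k) z.1 ^ 2 * inner ℝ (u l) z.1) 𝒟 := fun j l => by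
    refine (integrable_inner_four hp.fourth_moment (u j) (u k) (u k) (u l)).congr
      (ae_of_all _ fun z => ?_)
    simp only; ring
  have h1 : ∀ z : Sample d, (inner ℝ (u k) z.1 * inner ℝ e z.1) ^ 2 =
      ∑ j, ∑ l, (inner ℝ (u j) e * inner ℝ (u l) e) *
        (inner ℝ (u j) z.1 * inner ℝ (u k) z.1 ^ 2 * inner ℝ (u l) z.1) := fun z => by
    have : inner ℝ e z.1 = ∑ k, inner ℝ (u k) e * inner ℝ (u k) z.1 := by
      rw [← u.sum_inner_mul_inner e z.1]
      exact sum_congr rfl fun k _ => by rw [real_inner_comm]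
    rw [mul_pow, pow_two (inner ℝ e z.1), this, sum_mul_sum, mul_sum]
    refine sum_congr rfl fun j _ => ?_
    rw [mul_sum]
    exact sum_congr rfl fun l _ => by ring
  simp_rw [h1]
  rw [integral_finsetSum _ fun j _ => integrable_finsetSum _ fun l _ => (hint j l).const_mul _,
    mul_sum]
  refine sum_le_sum fun j _ => ?_
  -- Second-order independence leaves only the diagonal terms of the double sum.
  rw [integral_finsetSum _ fun l _ => (hint j l).const_mul _, sum_eq_single j]
  · rw [integral_const_mul]
    have h2 := hp.integral_sq_mul_sq_le k j
    have h3 : ∫ z, inner ℝ (u j) z.1 * inner ℝ (u k) z.1 ^ 2 * inner ℝ (u j) z.1 ∂𝒟 =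
        ∫ z, inner ℝ (u k) z.1 ^ 2 * inner ℝ (u j) z.1 ^ 2 ∂𝒟 :=
      integral_congr_ae (ae_of_all _ fun z => by ring)
    rw [h3]
    have h4 := mul_le_mul_of_nonneg_left h2 (mul_self_nonneg (inner ℝ (u j) e))
    linarith
  · intro l _ hl
    rw [integral_const_mul, hp.second_order_indep j l k hl.symm, mul_zero]
  · simp

/-- The samples that the label equation holds for. -/
lemma Problem.ae_pi_label (hp : Problem 𝒟 xopt β u lam band C) (n : ℕ) :
    ∀ᵐ y ∂(Measure.pi fun _ : Fin n => 𝒟), ∀ j, (y j).2 = inner ℝ (y j).1 xopt :=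
  ae_all_iff.2 fun j =>
    (measurePreserving_eval (fun _ : Fin n => 𝒟) j).quasiMeasurePreserving.ae hp.label

/-- One coordinate of the error after a minibatch step. -/
lemma inner_batchStep {n : ℕ} (η : ℝ) {y : Fin n → Sample d}
    (hy : ∀ j, (y j).2 = inner ℝ (y j).1 xopt) (x w : Vec d) :
    inner ℝ w (batchStep η y x - xopt) = inner ℝ w (x - xopt) -
      η / n * ∑ j, inner ℝ w (y j).1 * inner ℝ (x - xopt) (y j).1 := by
  have h1 : batchStep η y x - xopt = (x - xopt) - η • ∑ j, ((1 / (n : ℝ)) *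
      (inner ℝ (y j).1 x - (y j).2)) • (y j).1 := by
    rw [batchStep]; abel
  rw [h1, inner_sub_right, inner_smul_right, inner_sum, mul_sum, mul_sum]
  congr 1
  refine sum_congr rfl fun j _ => ?_
  rw [inner_smul_right, hy j, ← inner_sub_right, real_inner_comm (y j).1 (x - xopt)]
  ring

/-- The second moment of one coordinate of the error after a minibatch step from a fixed point. -/
lemma Problem.lintegral_batchStep_le (hp : Problem 𝒟 xopt β u lam band C) {n : ℕ} (hn : 0 < n)
    (η : ℝ) (x : Vec d) (k : Fin d) :
    ∫⁻ y, ENNReal.ofReal (inner ℝ (u k) (batchStep η y x - xopt) ^ 2)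
      ∂(Measure.pi fun _ : Fin n => 𝒟) ≤
    ENNReal.ofReal ((1 - η * lam k) ^ 2 * inner ℝ (u k) (x - xopt) ^ 2 +
      η ^ 2 * (C / n) * lam k * ∑ j, lam j * inner ℝ (u j) (x - xopt) ^ 2) := by
  set e := x - xopt with he
  set X : Sample d → ℝ := fun z => inner ℝ (u k) z.1 * inner ℝ e z.1 with hX
  have hX2 : MemLp X 2 𝒟 := by
    rw [memLp_two_iff_integrable_sq (by fun_prop)]
    refine (integrable_inner_four hp.fourth_moment (u k) e (u k) e).congr (ae_of_all _ fun z => ?_)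
    simp only [hX]; ring
  have hmean : ∫ z, X z ∂𝒟 = lam k * inner ℝ (u k) e := hp.integral_inner_two k e
  have hsq := hp.integral_sq_gradient_le k e
  set π := Measure.pi fun _ : Fin n => 𝒟 with hπ
  set Z : (Fin n → Sample d) → ℝ := fun y => ∑ j, X (y j) with hZ
  have hXj : ∀ j, MemLp (fun y : Fin n → Sample d => X (y j)) 2 π := fun j =>
    hX2.comp_measurePreserving (measurePreserving_eval (fun _ : Fin n => 𝒟) j)
  have hZ2 : MemLp Z 2 π := memLp_finsetSum _ fun j _ => hXj j
  have hZint : Integrable Z π := hZ2.integrable (by norm_num)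
  have hZmean : ∫ y, Z y ∂π = n * (lam k * inner ℝ (u k) e) := by
    rw [hZ, integral_finsetSum _ fun j _ => (hXj j).integrable (by norm_num)]
    have : ∀ j : Fin n, ∫ y, X (y j) ∂π = lam k * inner ℝ (u k) e := fun j => by
      rw [← hmean]
      exact integral_comp_eval (μ := fun _ : Fin n => 𝒟) (i := j) hX2.aestronglyMeasurable
    simp [this]
  -- Independence makes the variance additive; after division by `n ^ 2` the noise is smaller by the
  -- factor `1 / n`.
  have hvar : Var[Z; π] ≤ n * ∫ z, X z ^ 2 ∂𝒟 := by
    have h1 : Z = ∑ j, fun y : Fin n → Sample d => X (y j) := by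
      funext y; simp [hZ]
    rw [h1, variance_sum_pi fun _ => hX2]
    simp only [sum_const, card_univ, Fintype.card_fin, nsmul_eq_mul]
    refine mul_le_mul_of_nonneg_left ?_ (Nat.cast_nonneg _)
    rw [variance_eq_sub hX2]
    have := sq_nonneg (∫ z, X z ∂𝒟)
    simp only [Pi.pow_apply]
    linarith
  have hZsq : ∫ y, Z y ^ 2 ∂π ≤ n * ∫ z, X z ^ 2 ∂𝒟 + (n * (lam k * inner ℝ (u k) e)) ^ 2 := by
    have := variance_eq_sub hZ2
    rw [hZmean] at this
    simp only [Pi.pow_apply] at this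
    linarith
  have hae : (fun y => ENNReal.ofReal (inner ℝ (u k) (batchStep η y x - xopt) ^ 2)) =ᵐ[π]
      fun y => ENNReal.ofReal ((inner ℝ (u k) e - η / n * Z y) ^ 2) := by
    filter_upwards [hp.ae_pi_label n] with y hy
    rw [inner_batchStep η hy]
  have hint1 : Integrable (fun y => (inner ℝ (u k) e - η / n * Z y) ^ 2) π := by
    have : MemLp (fun y => inner ℝ (u k) e - η / n * Z y) 2 π :=
      (memLp_const _).sub (hZ2.const_mul _)
    exact this.integrable_sq
  rw [lintegral_congr_ae hae, ← ofReal_integral_eq_lintegral_ofReal hint1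
    (ae_of_all _ fun y => sq_nonneg _)]
  refine ENNReal.ofReal_le_ofReal ?_
  have hn' : (n : ℝ) ≠ 0 := by exact_mod_cast hn.ne'
  have hexp : ∫ y, (inner ℝ (u k) e - η / n * Z y) ^ 2 ∂π =
      inner ℝ (u k) e ^ 2 - 2 * (η / n) * inner ℝ (u k) e * ∫ y, Z y ∂π +
        (η / n) ^ 2 * ∫ y, Z y ^ 2 ∂π := by
    have e1 : ∀ y, (inner ℝ (u k) e - η / n * Z y) ^ 2 = inner ℝ (u k) e ^ 2 -
        2 * (η / n) * inner ℝ (u k) e * Z y + (η / n) ^ 2 * Z y ^ 2 := fun y => by ring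
    simp_rw [e1]
    have i1 : Integrable (fun y => 2 * (η / n) * inner ℝ (u k) e * Z y) π := hZint.const_mul _
    have i2 : Integrable (fun y => inner ℝ (u k) e ^ 2 - 2 * (η / n) * inner ℝ (u k) e * Z y) π :=
      (integrable_const _).sub i1
    rw [integral_add i2 (hZ2.integrable_sq.const_mul _), integral_sub (integrable_const _) i1,
      integral_const_mul, integral_const_mul]
    simp
  rw [hexp, hZmean]
  have h1 := mul_le_mul_of_nonneg_left hZsq (sq_nonneg (η / n))
  have h2 : (η / n) ^ 2 * (n * ∫ z, X z ^ 2 ∂𝒟) ≤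
      (η / n) ^ 2 * (n * (C * lam k * ∑ j, lam j * inner ℝ (u j) e ^ 2)) := by
    gcongr
  have e1 : (η / n) ^ 2 * (n * (C * lam k * ∑ j, lam j * inner ℝ (u j) e ^ 2)) =
      η ^ 2 * (C / n) * lam k * ∑ j, lam j * inner ℝ (u j) e ^ 2 := by field_simp
  have e2 : inner ℝ (u k) e ^ 2 - 2 * (η / n) * inner ℝ (u k) e * (n * (lam k * inner ℝ (u k) e)) +
      (η / n) ^ 2 * (n * (lam k * inner ℝ (u k) e)) ^ 2 =
      (1 - η * lam k) ^ 2 * inner ℝ (u k) e ^ 2 := by field_simp; ring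
  linarith

end StochBSLS

namespace StochBSLS

/-! ### Independence of the iterate and the next minibatch -/

open ProbabilityTheory Finset

section Stream

variable {d : ℕ} {𝒟 : Measure (Sample d)} [IsProbabilityMeasure 𝒟]

lemma map_block (n off : ℕ) :
    (sampleStream 𝒟).map (block n off) = Measure.pi fun _ : Fin n => 𝒟 := by
  have h0 : iIndepFun (fun (i : ℕ) (z : ℕ → Sample d) => z i) (sampleStream 𝒟) :=
    iIndepFun_infinitePi (X := fun _ => id) (fun _ => measurable_id)
  have hinj : Function.Injective fun j : Fin n => off + (j : ℕ) := fun i j h => by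
    simpa [Fin.ext_iff] using h
  have h1 := h0.precomp hinj
  have h2 := (iIndepFun_iff_map_fun_eq_pi_map
    (f := fun (j : Fin n) (z : ℕ → Sample d) => z (off + j))
    (fun j => (measurable_pi_apply (off + (j : ℕ))).aemeasurable)).1 h1
  change (sampleStream 𝒟).map (fun z (j : Fin n) => z (off + j)) = _
  rw [h2]
  congr 1
  funext j
  exact Measure.infinitePi_map_eval _ _

lemma measurable_block (n off : ℕ) : Measurable (block (d := d) n off) := by
  unfold block; fun_prop

/-- A function of the samples before position `off` and a function of the samples after it depend on
disjoint sets of coordinates of the product measure. -/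
lemma indepFun_block {α : Type*} [MeasurableSpace α] {X : (ℕ → Sample d) → α} (hX : Measurable X)
    {off : ℕ} (hdep : ∀ z z', (∀ i < off, z i = z' i) → X z = X z') (n : ℕ) :
    IndepFun X (block n off) (sampleStream 𝒟) := by
  have h0 : iIndepFun (fun (i : ℕ) (z : ℕ → Sample d) => z i) (sampleStream 𝒟) :=
    iIndepFun_infinitePi (X := fun _ => id) (fun _ => measurable_id)
  have hdisj : Disjoint (range off) (Ico off (off + n)) := by
    rw [disjoint_left]; intro i hi hi'; simp at hi hi'; omega
  have h1 := h0.indepFun_finset (range off) (Ico off (off + n)) hdisj (fun i => by fun_prop)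
  -- The coordinates from `off` on do not influence `X` and may be filled with zeros; this exhibits
  -- `X` as a function of the first coordinates.
  set φ : ((i : range off) → Sample d) → α :=
    fun v => X fun i => if h : i ∈ range off then v ⟨i, h⟩ else 0 with hφ
  set ψ : ((i : Ico off (off + n)) → Sample d) → Fin n → Sample d :=
    fun v j => v ⟨off + j, by simp⟩ with hψ
  have hφm : Measurable φ := by
    refine hX.comp (measurable_pi_lambda _ fun i => ?_)
    by_cases h : i ∈ range off
    · simp only [h, dif_pos]; fun_prop
    · simp only [h, dif_neg, not_false_iff]; fun_prop
  have hψm : Measurable ψ := by rw [hψ]; fun_prop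
  have h2 := h1.comp hφm hψm
  have e1 : (φ ∘ fun (z : ℕ → Sample d) (i : range off) => z i) = X := by
    funext z
    refine hdep _ _ fun i hi => ?_
    simp [hi]
  have e2 : (ψ ∘ fun (z : ℕ → Sample d) (i : Ico off (off + n)) => z i) = block n off := by
    funext z j; rfl
  rwa [e1, e2] at h2

/-- Fresh samples may be integrated out first. -/
lemma lintegral_block {α : Type*} [MeasurableSpace α] {X : (ℕ → Sample d) → α} (hX : Measurable X)
    {off : ℕ} (hdep : ∀ z z', (∀ i < off, z i = z' i) → X z = X z') (n : ℕ)
    {F : α → (Fin n → Sample d) → ENNReal} (hF : Measurable (Function.uncurry F)) :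
    ∫⁻ z, F (X z) (block n off z) ∂(sampleStream 𝒟) =
      ∫⁻ z, ∫⁻ y, F (X z) y ∂(Measure.pi fun _ : Fin n => 𝒟) ∂(sampleStream 𝒟) := by
  have hB := measurable_block (d := d) n off
  have h1 := (indepFun_iff_map_prod_eq_prod_map_map hX.aemeasurable hB.aemeasurable).1
    (indepFun_block (𝒟 := 𝒟) hX hdep n)
  rw [map_block] at h1
  have : IsProbabilityMeasure ((sampleStream 𝒟).map X) :=
    Measure.isProbabilityMeasure_map hX.aemeasurable
  calc ∫⁻ z, F (X z) (block n off z) ∂(sampleStream 𝒟)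
      = ∫⁻ q, Function.uncurry F q ∂((sampleStream 𝒟).map fun z => (X z, block n off z)) := by
        rw [lintegral_map hF (hX.prodMk hB)]; rfl
    _ = ∫⁻ x, ∫⁻ y, F x y ∂(Measure.pi fun _ : Fin n => 𝒟) ∂((sampleStream 𝒟).map X) := by
        rw [h1, lintegral_prod _ hF.aemeasurable]; rfl
    _ = _ := by
        exact lintegral_map hF.lintegral_prod_right' hX

lemma measurable_batchStep {n : ℕ} (η : ℝ) :
    Measurable (fun q : Vec d × (Fin n → Sample d) => batchStep η q.2 q.1) := by
  unfold batchStep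
  fun_prop

lemma gdRun_append (n : ℕ) (z : ℕ → Sample d) (ηs : List ℝ) (η : ℝ) (s : Vec d × ℕ) :
    gdRun n z (ηs ++ [η]) s =
      (batchStep η (block n (s.2 + n * ηs.length) z) (gdRun n z ηs s).1,
        s.2 + n * (ηs.length + 1)) := by
  have h : gdRun n z (ηs ++ [η]) s = (batchStep η (block n (gdRun n z ηs s).2 z) (gdRun n z ηs s).1,
      (gdRun n z ηs s).2 + n) := by
    simp [gdRun]
  rw [h, gdRun_snd]
  refine Prod.ext rfl ?_
  simp only; ring

lemma measurable_gdRun (n : ℕ) (ηs : List ℝ) (s : Vec d × ℕ) :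
    Measurable fun z : ℕ → Sample d => (gdRun n z ηs s).1 := by
  induction ηs using List.reverseRecOn with
  | nil => simp only [gdRun, List.foldl_nil]; exact measurable_const
  | append_singleton ηs η ih =>
    simp only [gdRun_append]
    exact (measurable_batchStep η).comp (ih.prodMk (measurable_block n _))

/-- The run is adapted: it has read only the samples before its current position. Hence the next
block is independent of the iterate. -/
lemma gdRun_congr (n : ℕ) (ηs : List ℝ) (x : Vec d) {z z' : ℕ → Sample d}
    (h : ∀ i < n * ηs.length, z i = z' i) :
    (gdRun n z ηs (x, 0)).1 = (gdRun n z' ηs (x, 0)).1 := by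
  induction ηs using List.reverseRecOn with
  | nil => rfl
  | append_singleton ηs η ih =>
    simp only [List.length_append, List.length_singleton] at h
    simp only [gdRun_append, zero_add]
    rw [ih fun i hi => h i (by nlinarith)]
    congr 1
    funext j
    refine h _ ?_
    have := j.2
    rw [mul_add]; omega

end Stream

section Bands

variable {d m : ℕ} [NeZero m] {𝒟 : Measure (Sample d)} [IsProbabilityMeasure 𝒟] {xopt : Vec d}
  {β : Bands m} {u : OrthonormalBasis (Fin d) ℝ (Vec d)} {lam : Fin d → ℝ} {band : Fin d → Fin m}
  {C : ℝ}

/-! ### From the deterministic recursion to expectations -/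

/-- The part of the squared distance to `xopt` that lies in one band. -/
def bandSq (xopt : Vec d) (u : OrthonormalBasis (Fin d) ℝ (Vec d)) (band : Fin d → Fin m)
    (x : Vec d) (i : Fin m) : ℝ :=
  ∑ k with band k = i, inner ℝ (u k) (x - xopt) ^ 2

lemma bandSq_nonneg (x : Vec d) : 0 ≤ bandSq xopt u band x := fun _ =>
  sum_nonneg fun _ _ => sq_nonneg _

lemma sum_bandSq (x : Vec d) : ∑ i, bandSq xopt u band x i = ‖x - xopt‖ ^ 2 := by
  rw [← u.sum_sq_norm_inner_right (x - xopt)]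
  simp only [bandSq, Real.norm_eq_abs, sq_abs]
  exact sum_fiberwise _ _ _

lemma measurable_bandSq (i : Fin m) : Measurable fun x : Vec d => bandSq xopt u band x i := by
  unfold bandSq; fun_prop

/-- Exhibits the linearity of `bandStep` with explicit coefficients, so that it commutes with the
integral over the past. -/
lemma bandStep_eq_sum (L σ : Fin m → ℝ) (γ : ℝ) (V : Fin m → ℝ) (p i : Fin m) :
    bandStep L σ γ V p i = ∑ k, ((if k = i then
      (if i < p then 1 else if i = p then σ p else (L i / L p) ^ 2) else 0) +
        γ * (L i / L p) * (L k / L p)) * V k := by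
  simp only [add_mul, sum_add_distrib, ite_mul, zero_mul, sum_ite_eq', mem_univ, if_true, bandStep,
    mul_sum]
  congr 1
  exact sum_congr rfl fun k _ => by ring

/-- The bands `[L i / κ i, L i]` contain the eigenvalues. -/
def BandCover (lam : Fin d → ℝ) (band : Fin d → Fin m) (L κ : Fin m → ℝ) : Prop :=
  ∀ k, L (band k) / κ (band k) ≤ lam k ∧ lam k ≤ L (band k)

lemma contraction_factor_le {L κ : Fin m → ℝ} (hL : ∀ i, 0 < L i) (hmono : Monotone L)
    (hκ : ∀ i, 1 ≤ κ i) {p i : Fin m} {l : ℝ} (h1 : L i / κ i ≤ l) (h2 : l ≤ L i) :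
    (1 - 1 / L p * l) ^ 2 ≤
      if i < p then 1 else if i = p then (1 - 1 / κ p) ^ 2 else (L i / L p) ^ 2 := by
  have hp := hL p
  have hi := hL i
  have hl : 0 < l := (div_pos hi (by have := hκ i; linarith)).trans_le h1
  have hlp : 1 / L p * l = l / L p := by ring
  rw [hlp]
  have h0 : 0 < l / L p := div_pos hl hp
  split_ifs with h h'
  · have h3 : l / L p ≤ 1 := (div_le_one hp).2 (h2.trans (hmono h.le))
    nlinarith
  · subst h'
    have h3 : l / L i ≤ 1 := (div_le_one hp).2 h2
    have h4 : 1 / κ i ≤ l / L i := by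
      rw [le_div_iff₀ hp]
      calc 1 / κ i * L i = L i / κ i := by ring
        _ ≤ l := h1
    nlinarith
  · have h3 : 1 ≤ L i / L p := (one_le_div hp).2 (hmono (not_lt.1 h))
    have h4 : l / L p ≤ L i / L p := by gcongr
    nlinarith

/-- The coordinate bounds are summed over one band. Each of its at most `D` coordinates receives
noise of the same order, which is how the multiplicity enters `γ = C D / n`. -/
lemma Problem.lintegral_bandSq_batchStep_le (hp : Problem 𝒟 xopt β u lam band C) {n : ℕ}
    (hn : 0 < n) {L κ : Fin m → ℝ} (hL : ∀ i, 0 < L i) (hmono : Monotone L) (hκ : ∀ i, 1 ≤ κ i)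
    (hcov : BandCover lam band L κ) (hC : 0 ≤ C) {D : ℝ}
    (hD : ∀ i, (#{k | band k = i} : ℝ) ≤ D) (x : Vec d) (p i : Fin m) :
    ∫⁻ y, ENNReal.ofReal (bandSq xopt u band (batchStep (1 / L p) y x) i)
      ∂(Measure.pi fun _ : Fin n => 𝒟) ≤
    ENNReal.ofReal (bandStep L (fun i => (1 - 1 / κ i) ^ 2) (C * D / n)
      (bandSq xopt u band x) p i) := by
  have hmeas : ∀ k, Measurable fun y : Fin n → Sample d =>
      ENNReal.ofReal (inner ℝ (u k) (batchStep (1 / L p) y x - xopt) ^ 2) := fun k => by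
    have h1 : Measurable fun y : Fin n → Sample d => batchStep (1 / L p) y x :=
      (measurable_batchStep (1 / L p)).comp (measurable_const.prodMk measurable_id)
    fun_prop
  have hlam : ∀ k, 0 ≤ lam k := fun k => (hp.lam_pos k).le
  set E := ∑ j, lam j * inner ℝ (u j) (x - xopt) ^ 2 with hE
  have hE0 : 0 ≤ E := sum_nonneg fun j _ => mul_nonneg (hlam j) (sq_nonneg _)
  have hEle : E ≤ ∑ j, L j * bandSq xopt u band x j := by
    have h1 : ∑ j, L j * bandSq xopt u band x j =
        ∑ k, L (band k) * inner ℝ (u k) (x - xopt) ^ 2 := by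
      simp only [bandSq, mul_sum]
      rw [← sum_fiberwise univ band]
      refine sum_congr rfl fun j _ => sum_congr rfl fun k hk => ?_
      rw [(mem_filter.1 hk).2]
    rw [h1]
    exact sum_le_sum fun k _ => mul_le_mul_of_nonneg_right (hcov k).2 (sq_nonneg _)
  simp only [bandSq]
  have h1 : ∀ y : Fin n → Sample d,
      ENNReal.ofReal (∑ k with band k = i, inner ℝ (u k) (batchStep (1 / L p) y x - xopt) ^ 2) =
      ∑ k with band k = i, ENNReal.ofReal (inner ℝ (u k) (batchStep (1 / L p) y x - xopt) ^ 2) :=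
    fun y => ENNReal.ofReal_sum_of_nonneg fun k _ => sq_nonneg _
  simp_rw [h1]
  rw [lintegral_finsetSum _ fun k _ => hmeas k]
  refine (sum_le_sum fun k _ => hp.lintegral_batchStep_le hn (1 / L p) x k).trans ?_
  rw [← ENNReal.ofReal_sum_of_nonneg fun k _ => by have := hlam k; positivity]
  refine ENNReal.ofReal_le_ofReal ?_
  rw [sum_add_distrib]
  set ρ : ℝ := if i < p then 1 else if i = p then (1 - 1 / κ p) ^ 2 else (L i / L p) ^ 2 with hρ
  have h2 : ∑ k with band k = i, (1 - 1 / L p * lam k) ^ 2 * inner ℝ (u k) (x - xopt) ^ 2 ≤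
      ρ * bandSq xopt u band x i := by
    rw [bandSq, mul_sum]
    refine sum_le_sum fun k hk => mul_le_mul_of_nonneg_right ?_ (sq_nonneg _)
    have h3 := hcov k
    rw [(mem_filter.1 hk).2] at h3
    exact contraction_factor_le hL hmono hκ h3.1 h3.2
  have h3 : ∑ k with band k = i, (1 / L p) ^ 2 * (C / n) * lam k * E ≤
      C * D / n * (L i / L p) * ∑ k, L k / L p * bandSq xopt u band x k := by
    calc ∑ k with band k = i, (1 / L p) ^ 2 * (C / n) * lam k * E
        ≤ ∑ k with band k = i, (1 / L p) ^ 2 * (C / n) * L i * E := by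
          refine sum_le_sum fun k hk => ?_
          have h3 := (hcov k).2
          rw [(mem_filter.1 hk).2] at h3
          gcongr
      _ = #{k | band k = i} * ((1 / L p) ^ 2 * (C / n) * L i * E) := by
          rw [sum_const, nsmul_eq_mul]
      _ ≤ D * ((1 / L p) ^ 2 * (C / n) * L i * ∑ j, L j * bandSq xopt u band x j) := by
          have := (hL i).le
          have hD0 : 0 ≤ D := le_trans (Nat.cast_nonneg _) (hD i)
          exact mul_le_mul (hD i) (by gcongr) (by positivity) hD0
      _ = _ := by
          have e : ∑ k, L k / L p * bandSq xopt u band x k =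
              1 / L p * ∑ j, L j * bandSq xopt u band x j := by
            rw [mul_sum]; exact sum_congr rfl fun k _ => by ring
          rw [e]; ring
  exact add_le_add h2 h3

/-- The second moments per band along a sequence of minibatch steps. -/
theorem Problem.lintegral_bandSq_gdRun_le (hp : Problem 𝒟 xopt β u lam band C) {n : ℕ}
    (hn : 0 < n) {L κ : Fin m → ℝ} (hL : ∀ i, 0 < L i) (hmono : Monotone L) (hκ : ∀ i, 1 ≤ κ i)
    (hcov : BandCover lam band L κ) (hC : 0 ≤ C) {D : ℝ} (hD0 : 0 ≤ D)
    (hD : ∀ i, (#{k | band k = i} : ℝ) ≤ D) (x : Vec d) (ps : List (Fin m)) :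
    0 ≤ ps.foldl (bandStep L (fun i => (1 - 1 / κ i) ^ 2) (C * D / n)) (bandSq xopt u band x) ∧
    ∀ i, ∫⁻ z, ENNReal.ofReal (bandSq xopt u band
        (gdRun n z (ps.map fun p => 1 / L p) (x, 0)).1 i) ∂(sampleStream 𝒟) ≤
      ENNReal.ofReal (ps.foldl (bandStep L (fun i => (1 - 1 / κ i) ^ 2) (C * D / n))
        (bandSq xopt u band x) i) := by
  have hγ : 0 ≤ C * D / n := by positivity
  induction ps using List.reverseRecOn with
  | nil => exact ⟨bandSq_nonneg x, fun i => by simp [gdRun]⟩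
  | append_singleton ps p ih =>
    obtain ⟨ih0, ih1⟩ := ih
    simp only [List.foldl_append, List.foldl_cons, List.foldl_nil, List.map_append, List.map_cons,
      List.map_nil]
    set V := ps.foldl (bandStep L (fun i => (1 - 1 / κ i) ^ 2) (C * D / n)) (bandSq xopt u band x)
    refine ⟨bandStep_nonneg hL (fun i => sq_nonneg _) hγ ih0 p, fun i => ?_⟩
    simp only [gdRun_append, zero_add, List.length_map]
    have hmeas : ∀ j, Measurable fun z : ℕ → Sample d => ENNReal.ofReal (bandSq xopt u band
        (gdRun n z (ps.map fun p => 1 / L p) (x, 0)).1 j) := fun j =>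
      ((measurable_bandSq j).comp (measurable_gdRun n _ _)).ennreal_ofReal
    rw [lintegral_block (F := fun x y => ENNReal.ofReal (bandSq xopt u band
      (batchStep (1 / L p) y x) i)) (measurable_gdRun n _ _)
      (fun z z' h => gdRun_congr n _ x (by rwa [List.length_map])) n
      ((measurable_bandSq i).comp (measurable_batchStep (1 / L p))).ennreal_ofReal]
    refine (lintegral_mono fun z =>
      hp.lintegral_bandSq_batchStep_le hn hL hmono hκ hcov hC hD _ p i).trans ?_
    set c : Fin m → ℝ := fun k => ((if k = i then
      (if i < p then 1 else if i = p then (1 - 1 / κ p) ^ 2 else (L i / L p) ^ 2) else 0) +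
        C * D / n * (L i / L p) * (L k / L p)) with hc
    have hc0 : ∀ k, 0 ≤ c k := fun k => by
      have h1 := (div_pos (hL i) (hL p)).le
      have h2 := (div_pos (hL k) (hL p)).le
      refine add_nonneg ?_ (by positivity)
      split_ifs <;> positivity
    have e : ∀ W : Fin m → ℝ, 0 ≤ W → ENNReal.ofReal (∑ k, c k * W k) =
        ∑ k, ENNReal.ofReal (c k) * ENNReal.ofReal (W k) := fun W hW => by
      rw [ENNReal.ofReal_sum_of_nonneg fun k _ => mul_nonneg (hc0 k) (hW k)]
      exact sum_congr rfl fun k _ => ENNReal.ofReal_mul (hc0 k)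
    -- The bound for one step is linear in the moments with nonnegative coefficients, so integrating
    -- it over the past reproduces `bandStep` applied to the bounds already obtained.
    have hstep : ∀ W, bandStep L (fun i => (1 - 1 / κ i) ^ 2) (C * D / n) W p i =
        ∑ k, c k * W k := fun W => bandStep_eq_sum _ _ _ _ _ _
    simp_rw [hstep]
    rw [e V ih0]
    have e' : ∀ x : Vec d, ENNReal.ofReal (∑ k, c k * bandSq xopt u band x k) =
        ∑ k, ENNReal.ofReal (c k) * ENNReal.ofReal (bandSq xopt u band x k) :=
      fun x => e _ (bandSq_nonneg x)
    simp_rw [e']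
    rw [lintegral_finsetSum _ fun k _ => (hmeas k).const_mul _]
    refine sum_le_sum fun k _ => ?_
    rw [lintegral_const_mul _ (hmeas k)]
    exact mul_le_mul_right (ih1 k) _

/-- The mean squared distance to the minimizer along a sequence of minibatch steps. -/
theorem Problem.lintegral_dist_gdRun_le (hp : Problem 𝒟 xopt β u lam band C) {n : ℕ}
    (hn : 0 < n) {L κ : Fin m → ℝ} (hL : ∀ i, 0 < L i) (hmono : Monotone L) (hκ : ∀ i, 1 ≤ κ i)
    (hcov : BandCover lam band L κ) (hC : 0 ≤ C) {D : ℝ} (hD0 : 0 ≤ D)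
    (hD : ∀ i, (#{k | band k = i} : ℝ) ≤ D) (x : Vec d) (ps : List (Fin m)) {B : ℝ}
    (hB : ∑ i, ps.foldl (bandStep L (fun i => (1 - 1 / κ i) ^ 2) (C * D / n))
        (bandSq xopt u band x) i ≤ B) :
    ∫⁻ z, ENNReal.ofReal (‖(gdRun n z (ps.map fun p => 1 / L p) (x, 0)).1 - xopt‖ ^ 2)
      ∂(sampleStream 𝒟) ≤ ENNReal.ofReal B := by
  obtain ⟨h0, h1⟩ := hp.lintegral_bandSq_gdRun_le hn hL hmono hκ hcov hC hD0 hD x ps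
  refine le_trans ?_ (ENNReal.ofReal_le_ofReal hB)
  rw [ENNReal.ofReal_sum_of_nonneg fun i _ => h0 i]
  have e : ∀ x : Vec d, ENNReal.ofReal (‖x - xopt‖ ^ 2) =
      ∑ i, ENNReal.ofReal (bandSq xopt u band x i) := fun x => by
    rw [← sum_bandSq (band := band) (u := u), ENNReal.ofReal_sum_of_nonneg fun i _ => bandSq_nonneg x i]
  simp_rw [e]
  have hmeas : ∀ i, Measurable fun z : ℕ → Sample d => ENNReal.ofReal (bandSq xopt u band
      (gdRun n z (ps.map fun p => 1 / L p) (x, 0)).1 i) := fun i =>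
    ((measurable_bandSq i).comp (measurable_gdRun n _ _)).ennreal_ofReal
  rw [lintegral_finsetSum _ fun i _ => hmeas i]
  exact sum_le_sum fun i _ => h1 i

end Bands

end StochBSLS

namespace StochBSLS

/-! ### Known bands -/

open ProbabilityTheory Finset

lemma integrable_and_integral_le_of_lintegral {α : Type*} [MeasurableSpace α] {μ : Measure α}
    {f : α → ℝ} (hf : Measurable f) (h0 : ∀ x, 0 ≤ f x) {B : ℝ} (hB : 0 ≤ B)
    (h : ∫⁻ x, ENNReal.ofReal (f x) ∂μ ≤ ENNReal.ofReal B) :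
    Integrable f μ ∧ ∫ x, f x ∂μ ≤ B := by
  refine ⟨⟨hf.aestronglyMeasurable, ?_⟩, ?_⟩
  · rw [hasFiniteIntegral_iff_ofReal (ae_of_all _ h0)]
    exact h.trans_lt ENNReal.ofReal_lt_top
  · rw [integral_eq_lintegral_of_nonneg_ae (ae_of_all _ h0) hf.aestronglyMeasurable]
    exact ENNReal.toReal_le_of_le_ofReal hB h

section Bands

variable {m : ℕ} [NeZero m] (β : Bands m)

lemma Bands.hi_pos (i : Fin m) : 0 < β.hi i := (β.lo_pos i).trans_le (β.lo_le_hi i)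

lemma Bands.hi_mono : Monotone β.hi := fun i j h => by
  rcases h.eq_or_lt with rfl | h
  · exact le_rfl
  · exact (β.hi_lt_lo i j h).le.trans (β.lo_le_hi j)

lemma Bands.one_le_cond (i : Fin m) : 1 ≤ β.cond i := (one_le_div (β.lo_pos i)).2 (β.lo_le_hi i)

lemma Bands.lo_zero_le (i : Fin m) : β.lo 0 ≤ β.lo i := by
  rcases (Fin.zero_le i).eq_or_lt with h | h
  · rw [h]
  · exact (β.lo_le_hi 0).trans (β.hi_lt_lo 0 i h).le

lemma Bands.le_globalCond (p q : Fin m) : β.hi p / β.hi q ≤ β.globalCond :=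
  div_le_div₀ (β.hi_pos _).le (β.hi_mono le_top) (β.lo_pos 0)
    ((β.lo_zero_le q).trans (β.lo_le_hi q))

lemma Bands.cond_le_globalCond (i : Fin m) : β.cond i ≤ β.globalCond :=
  div_le_div₀ (β.hi_pos _).le (β.hi_mono le_top) (β.lo_pos 0) (β.lo_zero_le i)

end Bands

section Problem

variable {d m : ℕ} [NeZero m] {𝒟 : Measure (Sample d)} [IsProbabilityMeasure 𝒟] {xopt : Vec d}
  {β : Bands m} {u : OrthonormalBasis (Fin d) ℝ (Vec d)} {lam : Fin d → ℝ} {band : Fin d → Fin m}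
  {C : ℝ}

/-- The square of a coordinate has nonnegative variance, so its second moment is at least the square
of its mean, which is positive. -/
lemma Problem.one_le_kurtosis (hp : Problem 𝒟 xopt β u lam band C) (k : Fin d) : 1 ≤ C := by
  have h2 : ∫ z, inner ℝ (u k) z.1 ^ 2 ∂𝒟 = lam k := by
    have := hp.integral_inner_two k (u k)
    rw [real_inner_self_eq_norm_sq, u.norm_eq_one, one_pow, mul_one] at this
    rw [← this]
    exact integral_congr_ae (ae_of_all _ fun z => by ring)
  have hL : MemLp (fun z : Sample d => inner ℝ (u k) z.1 ^ 2) 2 𝒟 := by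
    rw [memLp_two_iff_integrable_sq (by fun_prop)]
    refine (integrable_inner_four hp.fourth_moment (u k) (u k) (u k) (u k)).congr
      (ae_of_all _ fun z => ?_)
    simp only; ring
  have h3 := variance_eq_sub hL
  have h4 := variance_nonneg (fun z : Sample d => inner ℝ (u k) z.1 ^ 2) 𝒟
  have h5 := hp.kurtosis (u k)
  rw [h2] at h3 h5
  have h6 : ∫ z, ((fun z : Sample d => inner ℝ (u k) z.1 ^ 2) ^ 2) z ∂𝒟 =
      ∫ z, inner ℝ (u k) z.1 ^ 4 ∂𝒟 :=
    integral_congr_ae (ae_of_all _ fun z => by simp only [Pi.pow_apply]; ring)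
  rw [h6] at h3
  have h7 := hp.lam_pos k
  by_contra h
  nlinarith [mul_pos h7 h7]

lemma card_band_le_maxMult (band : Fin d → Fin m) (i : Fin m) :
    (#{k | band k = i} : ℝ) ≤ maxMult band := by
  exact_mod_cast Finset.le_sup (f := fun i => #{k | band k = i}) (mem_univ i)

lemma one_le_maxMult (band : Fin d → Fin m) (k : Fin d) : 1 ≤ maxMult band := by
  have h := Finset.le_sup (f := fun i => #{k | band k = i}) (mem_univ (band k))
  have h2 : 0 < #{j | band j = band k} := card_pos.2 ⟨k, by simp⟩
  exact h2.trans_le h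

lemma Problem.bandCover (hp : Problem 𝒟 xopt β u lam band C) :
    BandCover lam band β.hi β.cond := fun k => by
  have h := hp.mem_band k
  refine ⟨?_, h.2⟩
  have e : β.hi (band k) / β.cond (band k) = β.lo (band k) := by
    have := (β.hi_pos (band k)).ne'
    have := (β.lo_pos (band k)).ne'
    rw [Bands.cond]; field_simp
  rw [e]; exact h.1

lemma Problem.regime (hp : Problem 𝒟 xopt β u lam band C) {T : Fin m → ℕ} {R ε : ℝ}
    (hT : SufficientSteps β R ε T) : Regime β.hi β.cond T β.globalCond where
  pos := β.hi_pos
  mono := β.hi_mono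
  one_le_cond := β.one_le_cond
  ratio := β.le_globalCond
  bands := by have := hp.bands_le_log; linarith
  steps p h := hT.2 p fun e => by rw [e] at h; simp at h

/-- The labels carry no noise, so the objective is a pure quadratic form in `x - xopt` and its
minimum is zero. -/
lemma Problem.objective_eq (hp : Problem 𝒟 xopt β u lam band C) (x : Vec d) :
    objective 𝒟 x = (1 / 2) * ∑ k, lam k * inner ℝ (u k) (x - xopt) ^ 2 := by
  rw [← hp.integral_sq_inner (x - xopt), ← integral_const_mul, objective]
  refine integral_congr_ae ?_
  filter_upwards [hp.label] with z hz
  rw [hz, ← inner_sub_right, real_inner_comm]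

lemma Problem.objective_nonneg (hp : Problem 𝒟 xopt β u lam band C) (x : Vec d) :
    0 ≤ objective 𝒟 x := by
  rw [hp.objective_eq]
  have : ∀ k, 0 ≤ lam k := fun k => (hp.lam_pos k).le
  refine mul_nonneg (by norm_num) (sum_nonneg fun k _ => mul_nonneg (this k) (sq_nonneg _))

lemma Problem.objective_le (hp : Problem 𝒟 xopt β u lam band C) (x : Vec d) :
    objective 𝒟 x ≤ β.hi ⊤ / 2 * ‖x - xopt‖ ^ 2 := by
  rw [hp.objective_eq, ← u.sum_sq_norm_inner_right (x - xopt), mul_sum, mul_sum]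
  refine sum_le_sum fun k _ => ?_
  rw [Real.norm_eq_abs, sq_abs]
  have h1 : lam k ≤ β.hi ⊤ := (hp.mem_band k).2.trans (β.hi_mono le_top)
  have := mul_le_mul_of_nonneg_right h1 (sq_nonneg (inner ℝ (u k) (x - xopt)))
  linarith

lemma Problem.measurable_objective (hp : Problem 𝒟 xopt β u lam band C) :
    Measurable (objective 𝒟) := by
  have : objective 𝒟 = fun x => (1 / 2) * ∑ k, lam k * inner ℝ (u k) (x - xopt) ^ 2 :=
    funext hp.objective_eq
  rw [this]; fun_prop

/-- Provides a coordinate, so that `1 ≤ C` and `1 ≤ maxMult band` become available. -/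
lemma exists_index_of_ne {x y : Vec d} (h : x ≠ y) : Nonempty (Fin d) := by
  rw [← Fin.pos_iff_nonempty]
  by_contra hd
  obtain rfl : d = 0 := by omega
  exact h (Subsingleton.elim _ _)

/-- The accuracy of stochastic BSLS for a sufficiently large batch size. -/
theorem Problem.bslsStoch_accuracy (hp : Problem 𝒟 xopt β u lam band C) {x₀ : Vec d} {ε : ℝ}
    {T : Fin m → ℕ} {n : ℕ} (hε : 0 < ε) (hn : 0 < n) (hr : ε < 9 * ‖x₀ - xopt‖ ^ 2)
    (hT : SufficientSteps β ‖x₀ - xopt‖ ε T)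
    (hγ : (m = 1 ∧ C * maxMult band / n * T 0 ≤ 1) ∨
      m * (C * maxMult band / n) * ∏ j, (T j : ℝ) ≤ 1 / 40) :
    Integrable (fun z => ‖(bslsStoch d n T β.hi).result x₀ z - xopt‖ ^ 2) (sampleStream 𝒟) ∧
      ∫ z, ‖(bslsStoch d n T β.hi).result x₀ z - xopt‖ ^ 2 ∂(sampleStream 𝒟) ≤ ε := by
  have hne : x₀ ≠ xopt := by
    rintro rfl
    simp only [sub_self, norm_zero] at hr
    norm_num at hr
    linarith
  obtain ⟨k₀⟩ := exists_index_of_ne hne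
  have hC := hp.one_le_kurtosis k₀
  have hreg := hp.regime hT
  set r := ‖x₀ - xopt‖ with hr_def
  have hr2 : 0 < r ^ 2 := by nlinarith
  have hκ := β.one_le_cond 0
  have hT0 := hT.1
  have hlog : 0 < Real.log (9 * r ^ 2 / ε) := Real.log_pos ((one_lt_div hε).2 hr)
  have hT0pos : T 0 ≠ 0 := by
    intro h
    rw [h, Nat.cast_zero] at hT0
    have : 0 < β.cond 0 * Real.log (9 * r ^ 2 / ε) := by positivity
    linarith
  have hγ0 : 0 ≤ C * maxMult band / n := by positivity
  have hγ' : (m = 1 ∧ C * maxMult band / n * T 0 ≤ 1 ∧ 2 ≤ β.cond 0) ∨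
      m * (C * maxMult band / n) * ∏ j, (T j : ℝ) ≤ 1 / 40 := by
    -- With one band, its condition number is the global one, and `m ≤ log κ / 3` forces `κ ≥ 4`.
    refine hγ.imp_left fun ⟨h1, h2⟩ => ⟨h1, h2, ?_⟩
    have e : β.cond 0 = β.globalCond := by
      subst h1
      rw [Bands.cond, Bands.globalCond, Subsingleton.elim (⊤ : Fin 1) 0]
    have h3 := hp.bands_le_log
    have h4 : (1 : ℝ) ≤ m := by rw [h1]; norm_num
    have h5 : 0 < β.globalCond := lt_of_lt_of_le one_pos (e ▸ hκ)
    have h6 := Real.log_le_sub_one_of_pos h5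
    rw [e]; linarith
  have htot := hreg.contraction_of_le hγ0 (o := 0) (by simp) hT0pos hγ'
    (bandSq_nonneg (xopt := xopt) (u := u) (band := band) x₀)
  rw [sum_bandSq] at htot
  have hexp : 9 * Real.exp (-(T 0 / β.cond 0)) * r ^ 2 ≤ ε := by
    have h1 : Real.exp (-(T 0 / β.cond 0)) ≤ ε / (9 * r ^ 2) := by
      have h2 : Real.log (9 * r ^ 2 / ε) ≤ T 0 / β.cond 0 := by
        rw [le_div_iff₀ (by linarith)]; linarith
      calc Real.exp (-(T 0 / β.cond 0)) ≤ Real.exp (-Real.log (9 * r ^ 2 / ε)) :=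
            Real.exp_le_exp.2 (by linarith)
        _ = ε / (9 * r ^ 2) := by
            rw [Real.exp_neg, Real.exp_log (by positivity), inv_div]
    calc 9 * Real.exp (-(T 0 / β.cond 0)) * r ^ 2 ≤ 9 * (ε / (9 * r ^ 2)) * r ^ 2 := by gcongr
      _ = ε := by have := hr2.ne'; rw [mul_div_assoc', mul_div_mul_left _ _ (by norm_num), div_mul_cancel₀ _ this]
  have hl := hp.lintegral_dist_gdRun_le hn β.hi_pos β.hi_mono β.one_le_cond hp.bandCover
    (by linarith) (Nat.cast_nonneg (maxMult band)) (card_band_le_maxMult band) x₀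
    (schedule T 0) (htot.trans hexp)
  simp only [bslsStoch_result]
  exact integrable_and_integral_le_of_lintegral
    (((measurable_gdRun n _ _).sub_const _).norm.pow_const 2) (fun z => by positivity) hε.le hl

/-- A bound for the squared distance bounds the objective. -/
lemma Problem.optimalInExpectation (hp : Problem 𝒟 xopt β u lam band C) {x₀ : Vec d} {ε : ℝ}
    (hε : 0 < ε) {n : ℕ} {T : Fin m → ℕ}
    (h : Integrable (fun z => ‖(bslsStoch d n T β.hi).result x₀ z - xopt‖ ^ 2)
      (sampleStream 𝒟) ∧
      ∫ z, ‖(bslsStoch d n T β.hi).result x₀ z - xopt‖ ^ 2 ∂(sampleStream 𝒟) ≤ ε / β.hi ⊤) :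
    OptimalInExpectation 𝒟 (bslsStoch d n T β.hi) x₀ ε := by
  obtain ⟨h1, h2⟩ := h
  have hL := β.hi_pos ⊤
  have hmeas : Measurable fun z => objective 𝒟 ((bslsStoch d n T β.hi).result x₀ z) := by
    simp only [bslsStoch_result]
    exact hp.measurable_objective.comp (measurable_gdRun n _ _)
  have hint : Integrable (fun z => objective 𝒟 ((bslsStoch d n T β.hi).result x₀ z))
      (sampleStream 𝒟) := by
    refine (h1.const_mul (β.hi ⊤ / 2)).mono' hmeas.aestronglyMeasurable (ae_of_all _ fun z => ?_)
    rw [Real.norm_eq_abs, abs_of_nonneg (hp.objective_nonneg _)]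
    exact hp.objective_le _
  refine ⟨hint, fun y => ?_⟩
  have h3 : ∫ z, objective 𝒟 ((bslsStoch d n T β.hi).result x₀ z) ∂(sampleStream 𝒟) ≤
      ∫ z, β.hi ⊤ / 2 * ‖(bslsStoch d n T β.hi).result x₀ z - xopt‖ ^ 2 ∂(sampleStream 𝒟) :=
    integral_mono hint (h1.const_mul _) fun z => hp.objective_le _
  rw [integral_const_mul] at h3
  have h4 := mul_le_mul_of_nonneg_left h2 (show 0 ≤ β.hi ⊤ / 2 by positivity)
  have e : β.hi ⊤ / 2 * (ε / β.hi ⊤) = ε / 2 := by field_simp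
  have h5 := hp.objective_nonneg y
  linarith

/-- The prescribed batch size suffices. -/
lemma Problem.batchSize_suffices (hp : Problem 𝒟 xopt β u lam band C) {x₀ : Vec d} {ε : ℝ}
    {T : Fin m → ℕ} {n : ℕ} (hε : 0 < ε) (hr : ε < 9 * ‖x₀ - xopt‖ ^ 2)
    (hT : SufficientSteps β ‖x₀ - xopt‖ ε T) (hn : batchSize C (maxMult band) T ≤ n) :
    0 < n ∧ ((m = 1 ∧ C * maxMult band / n * T 0 ≤ 1) ∨
      m * (C * maxMult band / n) * ∏ j, (T j : ℝ) ≤ 1 / 40) := by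
  have hne : x₀ ≠ xopt := by
    rintro rfl
    simp only [sub_self, norm_zero] at hr
    norm_num at hr
    linarith
  obtain ⟨k₀⟩ := exists_index_of_ne hne
  have hC := hp.one_le_kurtosis k₀
  have hreg := hp.regime hT
  have hm : 0 < m := NeZero.pos m
  have hD : (1 : ℝ) ≤ maxMult band := by exact_mod_cast one_le_maxMult band k₀
  have hlog : 0 < Real.log (9 * ‖x₀ - xopt‖ ^ 2 / ε) := Real.log_pos ((one_lt_div hε).2 hr)
  have hκ := β.one_le_cond 0
  have hTpos : ∀ i, 0 < T i := by
    intro i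
    rcases (Fin.zero_le i).eq_or_lt with h | h
    · rw [← h]
      have : (0 : ℝ) < T 0 := lt_of_lt_of_le (by positivity) hT.1
      exact_mod_cast this
    · have h1 := hreg.le_steps (p := i) (by rw [Fin.lt_def, Fin.val_zero] at h; exact h)
      have h2 := β.one_le_cond i
      have h3 : (1 : ℝ) ≤ m := by exact_mod_cast hm
      have : (0 : ℝ) < T i := by nlinarith
      exact_mod_cast this
  set A : ℝ := C * maxMult band with hA
  have hA0 : 0 < A := by positivity
  set P : ℝ := ∏ j, (T j : ℝ) with hP
  have hP0 : 0 < P := prod_pos fun j _ => by exact_mod_cast hTpos j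
  have hS : ∀ i, (T i : ℝ) ≤ ((univ.sup T : ℕ) : ℝ) := fun i => by
    exact_mod_cast Finset.le_sup (f := T) (mem_univ i)
  set S : ℝ := ((univ.sup T : ℕ) : ℝ)
  have hS1 : 1 ≤ S := le_trans (by exact_mod_cast hTpos 0) (hS 0)
  have hm' : (0 : ℝ) < m := by exact_mod_cast hm
  have hb : batchSize C (maxMult band) T = A * m ^ 2 * P * S := rfl
  rw [hb] at hn
  have hn0 : (0 : ℝ) < n := lt_of_lt_of_le (by positivity) hn
  refine ⟨by exact_mod_cast hn0, ?_⟩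
  rcases Nat.lt_or_ge 1 m with h1 | h1
  -- A later band has `T ≥ 24 m κ ≥ 48`, so the factor `m * max T` of the batch size covers the
  -- constant `40`.
  · right
    have hm2 : (2 : ℝ) ≤ m := by exact_mod_cast h1
    have h3 := hreg.le_steps (p := ⟨1, h1⟩) Nat.one_pos
    have h4 := β.one_le_cond ⟨1, h1⟩
    have h5 := hS ⟨1, h1⟩
    have h6 : 48 ≤ S := by nlinarith
    rw [← mul_div_assoc, div_mul_eq_mul_div, div_le_div_iff₀ hn0 (by norm_num), one_mul]
    refine le_trans ?_ hn
    have h7 : 40 ≤ m * S := by nlinarith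
    calc m * A * P * 40 ≤ m * A * P * (m * S) := by gcongr
      _ = A * m ^ 2 * P * S := by ring
  -- With one band `max T` can be as small as `1` and cannot cover the constant `40`; the weaker
  -- bound `γ T 0 ≤ 1` is what remains.
  · left
    have hm1 : m = 1 := by omega
    refine ⟨hm1, ?_⟩
    have hPT : P = T 0 := by
      subst hm1
      simp [hP]
    rw [div_mul_eq_mul_div, div_le_one hn0]
    refine le_trans ?_ hn
    have hmr : (m : ℝ) = 1 := by exact_mod_cast hm1
    rw [hPT, hmr]
    have h0 : (0 : ℝ) ≤ T 0 := Nat.cast_nonneg _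
    have := mul_le_mul_of_nonneg_left hS1 (mul_nonneg hA0.le h0)
    simpa using this

lemma sufficientSteps_stepCount (β : Bands m) (R ε : ℝ) :
    SufficientSteps β R ε (stepCount β R ε) := by
  refine ⟨?_, fun i hi => ?_⟩
  · rw [stepCount, if_pos rfl]; exact Nat.le_ceil _
  · rw [stepCount, if_neg hi]
    push_cast
    have := Nat.le_ceil (β.cond i * Real.log β.globalCond)
    linarith

lemma prod_ite_zero (A B : ℝ) : ∏ i : Fin m, (if i = 0 then A else B) = A * B ^ (m - 1) := by
  rw [← mul_prod_erase univ _ (mem_univ (0 : Fin m)), if_pos rfl]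
  congr 1
  rw [prod_congr rfl fun i hi => if_neg (ne_of_mem_erase hi)]
  simp

/-- For a later band the rounding at most doubles a quantity that is at least `1`, hence `8 * 2 =
16`. In the first band the logarithm may be close to zero, hence `1 + log`. -/
lemma prod_stepCount_le (β : Bands m) (hlog : 1 ≤ Real.log β.globalCond) {R ε : ℝ}
    (hℓ : 0 ≤ Real.log (9 * R ^ 2 / ε)) :
    ∏ i, (stepCount β R ε i : ℝ) ≤ 16 ^ m * (∏ i, β.cond i) *
      (Real.log β.globalCond ^ (m - 1) * (1 + Real.log (9 * R ^ 2 / ε))) := by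
  set lg := Real.log β.globalCond
  set ℓ := Real.log (9 * R ^ 2 / ε) with hℓdef
  calc ∏ i, (stepCount β R ε i : ℝ)
      ≤ ∏ i, (16 * β.cond i * (if i = 0 then 1 + ℓ else lg)) := by
        refine prod_le_prod (fun i _ => Nat.cast_nonneg _) fun i _ => ?_
        have hκ := β.one_le_cond i
        rw [stepCount]
        split_ifs with h
        · subst h
          have h1 := (Nat.ceil_lt_add_one (a := β.cond 0 * ℓ) (by positivity)).le
          have h2 : 0 ≤ β.cond 0 * ℓ := by positivity
          have e : β.cond 0 * Real.log (9 * R ^ 2 / ε) = β.cond 0 * ℓ := rfl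
          rw [e]
          nlinarith
        · have h1 := (Nat.ceil_lt_add_one (a := β.cond i * lg) (by positivity)).le
          push_cast
          have h2 : 1 ≤ β.cond i * lg := by nlinarith
          linarith
    _ = _ := by
        rw [prod_mul_distrib, prod_mul_distrib, prod_ite_zero]
        simp only [prod_const, card_univ, Fintype.card_fin]; ring

/-- The total number of samples for known bands, with the smaller batch size. -/
theorem Problem.exists_batchSize (hp : Problem 𝒟 xopt β u lam band C) {x₀ : Vec d} {ε : ℝ}
    (hε : 0 < ε) (hr : ε < 9 * β.hi ⊤ * ‖x₀ - xopt‖ ^ 2) :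
    ∃ n : ℕ, 0 < n ∧
      OptimalInExpectation 𝒟
        (bslsStoch d n (stepCount β ‖x₀ - xopt‖ (ε / β.hi ⊤)) β.hi) x₀ ε ∧
      ∀ z, ((bslsStoch d n (stepCount β ‖x₀ - xopt‖ (ε / β.hi ⊤)) β.hi).queries x₀ z : ℝ) ≤
        (80 * m * 2 ^ m * 256 ^ m) * C * maxMult band * (∏ i, β.cond i ^ 2) *
          Real.log β.globalCond ^ (2 * (m - 1)) *
          (1 + Real.log (9 * ‖x₀ - xopt‖ ^ 2 / (ε / β.hi ⊤))) ^ 2 := by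
  have hL := β.hi_pos ⊤
  have hε' : 0 < ε / β.hi ⊤ := by positivity
  have hr' : ε / β.hi ⊤ < 9 * ‖x₀ - xopt‖ ^ 2 := by
    rw [div_lt_iff₀ hL]; linarith
  have hne : x₀ ≠ xopt := by
    rintro rfl
    simp only [sub_self, norm_zero] at hr'
    norm_num at hr'
    linarith
  obtain ⟨k₀⟩ := exists_index_of_ne hne
  have hC := hp.one_le_kurtosis k₀
  have hD : (1 : ℝ) ≤ maxMult band := by exact_mod_cast one_le_maxMult band k₀
  have hT := sufficientSteps_stepCount β ‖x₀ - xopt‖ (ε / β.hi ⊤)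
  have hreg := hp.regime hT
  have hm : 0 < m := NeZero.pos m
  have hm1 : (1 : ℝ) ≤ m := by exact_mod_cast hm
  have hlog : 0 < Real.log (9 * ‖x₀ - xopt‖ ^ 2 / (ε / β.hi ⊤)) :=
    Real.log_pos ((one_lt_div hε').2 hr')
  have hlg : 1 ≤ Real.log β.globalCond := by have := hreg.bands; linarith
  have hPle := prod_stepCount_le β hlg hlog.le
  have hκ := β.one_le_cond 0
  set T := stepCount β ‖x₀ - xopt‖ (ε / β.hi ⊤) with hTdef
  have hTpos : ∀ i, 1 ≤ T i := by
    intro i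
    rcases (Fin.zero_le i).eq_or_lt with h | h
    · rw [← h]
      have : (0 : ℝ) < T 0 := lt_of_lt_of_le (by positivity) hT.1
      exact_mod_cast this
    · have h1 := hreg.le_steps (p := i) (by rw [Fin.lt_def, Fin.val_zero] at h; exact h)
      have h2 := β.one_le_cond i
      have : (0 : ℝ) < T i := by nlinarith
      exact_mod_cast this
  set P : ℝ := ∏ j, (T j : ℝ) with hP
  have hP1 : 1 ≤ P := by
    have : 1 ≤ ∏ j, T j := Nat.succ_le_of_lt (prod_pos fun j _ => hTpos j)
    rw [hP]; exact_mod_cast this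
  -- The smallest batch allowed by the noise condition. Leaving out `max T` makes the total
  -- quadratic in `∏ T`, with `16 ^ 2 = 256` per band.
  set n := ⌈40 * (m * (C * maxMult band) * P)⌉₊ with hn
  have harg : 1 ≤ m * (C * maxMult band) * P := by
    have h1 : 1 ≤ C * maxMult band := one_le_mul_of_one_le_of_one_le hC hD
    exact one_le_mul_of_one_le_of_one_le (one_le_mul_of_one_le_of_one_le hm1 h1) hP1
  have hnle := Nat.le_ceil (40 * (m * (C * maxMult band) * P))
  have hn0 : (0 : ℝ) < n := by rw [← hn] at hnle; linarith
  refine ⟨n, by exact_mod_cast hn0, ?_, fun z => ?_⟩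
  · refine hp.optimalInExpectation hε (hp.bslsStoch_accuracy hε' (by exact_mod_cast hn0) hr' hT
      (Or.inr ?_))
    rw [← mul_div_assoc, div_mul_eq_mul_div, div_le_div_iff₀ hn0 (by norm_num), one_mul]
    linarith
  · have h1 := bslsStoch_queries_le (d := d) z n β.hi x₀ hTpos
    have h2 : ((bslsStoch d n T β.hi).queries x₀ z : ℝ) ≤ n * 2 ^ m * P := by
      rw [hP]; exact_mod_cast h1
    refine h2.trans ?_
    have h3 : (n : ℝ) ≤ 80 * (m * (C * maxMult band) * P) := by
      have := (Nat.ceil_lt_add_one (a := 40 * (m * (C * maxMult band) * P)) (by linarith)).le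
      linarith
    have h4 : P ^ 2 ≤ (16 ^ m * (∏ i, β.cond i) * (Real.log β.globalCond ^ (m - 1) *
        (1 + Real.log (9 * ‖x₀ - xopt‖ ^ 2 / (ε / β.hi ⊤))))) ^ 2 :=
      pow_le_pow_left₀ (by linarith) hPle 2
    calc (n : ℝ) * 2 ^ m * P ≤ 80 * (m * (C * maxMult band) * P) * 2 ^ m * P := by gcongr
      _ = (80 * m * 2 ^ m * (C * maxMult band)) * P ^ 2 := by ring
      _ ≤ (80 * m * 2 ^ m * (C * maxMult band)) *
          (16 ^ m * (∏ i, β.cond i) * (Real.log β.globalCond ^ (m - 1) *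
        (1 + Real.log (9 * ‖x₀ - xopt‖ ^ 2 / (ε / β.hi ⊤))))) ^ 2 := by gcongr
      _ = _ := by
          rw [prod_pow, pow_mul' _ 2 (m - 1)]
          have : (256 : ℝ) ^ m = (16 ^ m) ^ 2 := by rw [← pow_mul, mul_comm, pow_mul]; norm_num
          rw [this]; ring

end Problem

end StochBSLS

namespace StochBSLS

/-! ### Renaming of registers -/

namespace Prog

variable {d : ℕ} {W W' : Type}

/-- The program with its registers renamed. -/
def map (ρ : Reg d W → Reg d W') : Prog d W → Prog d W'
  | skip => skip
  | const i c => const (ρ i) c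
  | add i j k => add (ρ i) (ρ j) (ρ k)
  | sub i j k => sub (ρ i) (ρ j) (ρ k)
  | mul i j k => mul (ρ i) (ρ j) (ρ k)
  | div i j k => div (ρ i) (ρ j) (ρ k)
  | query a b => query (ρ ∘ a) (ρ b)
  | seq p q => seq (map ρ p) (map ρ q)
  | loop n p => loop n (map ρ p)
  | ifPos i p q => ifPos (ρ i) (map ρ p) (map ρ q)

lemma loopDepth_map (ρ : Reg d W → Reg d W') (p : Prog d W) :
    (p.map ρ).loopDepth = p.loopDepth := by
  induction p <;> simp_all [map, loopDepth]

lemma length_map (ρ : Reg d W → Reg d W') (p : Prog d W) : (p.map ρ).length = p.length := by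
  induction p <;> simp_all [map, length]

lemma length_forList_le {ι : Type*} (l : List ι) {f : ι → Prog d W} {B : ℕ}
    (h : ∀ k, (f k).length ≤ B) : (forList l f).length ≤ l.length * B := by
  induction l with
  | nil => exact Nat.zero_le _
  | cons k l ih =>
    have := h k
    change (f k).length + (forList l f).length ≤ (l.length + 1) * B
    linarith

/-- A configuration seen through a renaming. -/
def pull (ρ : Reg d W → Reg d W') (σ : Config d W') : Config d W := (σ.1 ∘ ρ, σ.2)

variable [DecidableEq W] [DecidableEq W']

/-- A simulation: an injective renaming keeps distinct registers distinct, so writing commutes with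
reading through `ρ`. It serves to embed the gradient code of a single run into the parallel program,
and to number the work registers at the end. -/
lemma pull_exec_map {ρ : Reg d W → Reg d W'} (hρ : Function.Injective ρ) (z : ℕ → Sample d)
    (p : Prog d W) (σ : Config d W') : pull ρ (exec z (p.map ρ) σ) = exec z p (pull ρ σ) := by
  induction p generalizing σ with
  | skip => rfl
  | const i c => simp [map, exec, pull, Function.update_comp_eq_of_injective _ hρ]
  | add i j k => simp [map, exec, pull, Function.update_comp_eq_of_injective _ hρ]
  | sub i j k => simp [map, exec, pull, Function.update_comp_eq_of_injective _ hρ]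
  | mul i j k => simp [map, exec, pull, Function.update_comp_eq_of_injective _ hρ]
  | div i j k => simp [map, exec, pull, Function.update_comp_eq_of_injective _ hρ]
  | query a b =>
    simp only [map, exec, pull, Function.update_comp_eq_of_injective _ hρ]
    congr 2
    funext r
    simp only [Function.comp_apply, Function.extend_def, hρ.eq_iff]
  | seq p q hp hq => simp only [map, exec, hp, hq]
  | loop n p hp =>
    simp only [map, exec]
    induction n generalizing σ with
    | zero => rfl
    | succ n ih => rw [Function.iterate_succ_apply, Function.iterate_succ_apply, ih, hp]
  | ifPos i p q hp hq =>
    simp only [map, exec]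
    have : (pull ρ σ).1 i = σ.1 (ρ i) := rfl
    rw [this]
    split_ifs
    · exact hp σ
    · exact hq σ

lemma exec_map_of_notMem (ρ : Reg d W → Reg d W') (z : ℕ → Sample d)
    (p : Prog d W) (σ : Config d W') {r : Reg d W'} (hr : ∀ i, r ≠ ρ i) :
    (exec z (p.map ρ) σ).1 r = σ.1 r := by
  induction p generalizing σ with
  | skip => rfl
  | const i c => simp [map, exec, hr]
  | add i j k => simp [map, exec, hr]
  | sub i j k => simp [map, exec, hr]
  | mul i j k => simp [map, exec, hr]
  | div i j k => simp [map, exec, hr]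
  | query a b =>
    simp only [map, exec]
    rw [Function.update_of_ne (hr b),
      Function.extend_apply' _ _ _ (by rintro ⟨k, hk⟩; exact hr _ hk.symm)]
  | seq p q hp hq => simp only [map, exec, hp, hq]
  | loop n p hp =>
    simp only [map, exec]
    induction n generalizing σ with
    | zero => rfl
    | succ n ih => rw [Function.iterate_succ_apply, ih, hp]
  | ifPos i p q hp hq =>
    simp only [map, exec]
    split_ifs
    · exact hp σ
    · exact hq σ

lemma exec_query_of_ne (z : ℕ → Sample d) (a : Fin d → Reg d W) (b : Reg d W) (σ : Config d W)
    {r : Reg d W} (hb : r ≠ b) (ha : ∀ k, r ≠ a k) : (exec z (query a b) σ).1 r = σ.1 r := by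
  simp only [exec]
  rw [Function.update_of_ne hb, Function.extend_apply' _ _ _ (by rintro ⟨k, rfl⟩; exact ha k rfl)]

lemma exec_query_apply (z : ℕ → Sample d) {a : Fin d → Reg d W} (ha : Function.Injective a)
    {b : Reg d W} (hb : ∀ k, a k ≠ b) (σ : Config d W) (k : Fin d) :
    (exec z (query a b) σ).1 (a k) = (z σ.2).1 k := by
  simp only [exec]
  rw [Function.update_of_ne (hb k), ha.extend_apply]

/-- Renaming the work registers does not change the behaviour. -/
lemma pull_exec_map_start (e : W ≃ W') (z : ℕ → Sample d) (p : Prog d W) (x : Vec d) :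
    pull (Sum.map id e) (exec z (p.map (Sum.map id e)) (start x)) = exec z p (start x) := by
  rw [pull_exec_map (Sum.map_injective.2 ⟨Function.injective_id, e.injective⟩)]
  congr 1
  refine Prod.ext (funext fun r => ?_) rfl
  cases r <;> rfl

lemma result_map (e : W ≃ W') (z : ℕ → Sample d) (p : Prog d W) (x : Vec d) :
    (p.map (Sum.map id e)).result x z = p.result x z := by
  have h := pull_exec_map_start e z p x
  simp only [result, ← h]
  rfl

lemma queries_map (e : W ≃ W') (z : ℕ → Sample d) (p : Prog d W) (x : Vec d) :
    (p.map (Sum.map id e)).queries x z = p.queries x z :=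
  congrArg Prod.snd (pull_exec_map_start e z p x)

end Prog

/-! ### A mixed-radix counter that produces the step sizes -/

/-- The digits of the counter, the step size that it shows, and a flag for the overflow. -/
@[ext] structure Odometer (m : ℕ) where
  digit : Fin m → ℝ
  eta : ℝ
  flag : ℝ

namespace Odometer

variable {m : ℕ} (T : Fin m → ℕ) (L : Fin m → ℝ)

/-- Advance the digit `i`, with the continuation `k` for the overflow of the digit. -/
def digitTick (i : Fin m) (k : Odometer m → Odometer m) (o : Odometer m) : Odometer m :=
  if o.digit i < T i then { o with digit := Function.update o.digit i (o.digit i + 1), eta := 1 / L i }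
  else k { o with digit := Function.update o.digit i 0 }

/-- Advance the counter with digits `l`, the last of which is the least significant one. -/
def listTick : List (Fin m) → (Odometer m → Odometer m) → Odometer m → Odometer m
  | [], k => k
  | i :: l, k => listTick l (digitTick T L i k)

/-- Advance the counter; after an overflow the step size is zero. -/
def tick (o : Odometer m) : Odometer m :=
  if 0 < o.flag then { o with eta := 0 }
  else listTick T L (List.finRange m) (fun o => ⟨o.digit, 0, 1⟩) o

/-- The iteration of `F` from `o` shows the step sizes `es` and leads to `o'`. -/
def Shows (F : Odometer m → Odometer m) : List ℝ → Odometer m → Odometer m → Prop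
  | [], o, o' => o = o'
  | e :: es, o, o' => (F o).eta = e ∧ Shows F es (F o) o'

lemma Shows.append {F : Odometer m → Odometer m} {es es' : List ℝ} {o o₁ o₂ : Odometer m}
    (h : Shows F es o o₁) (h' : Shows F es' o₁ o₂) : Shows F (es ++ es') o o₂ := by
  induction es generalizing o with
  | nil => cases h; exact h'
  | cons e es ih => exact ⟨h.1, ih h.2⟩

variable {T L}

/-- The carry: when all digits of `l` are at their maximum they return to zero and control passes to
`k`, which advances the preceding digit. A full cycle of the digits in `l` is a complete inner run.
-/
lemma listTick_full {l : List (Fin m)} (hl : l.Nodup) {k : Odometer m → Odometer m} {o : Odometer m}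
    (h : ∀ i ∈ l, o.digit i = T i) :
    listTick T L l k o = k { o with digit := fun i => if i ∈ l then 0 else o.digit i } := by
  induction l generalizing k with
  | nil => simp [listTick]
  | cons i l ih =>
    obtain ⟨hi, hl⟩ := List.nodup_cons.1 hl
    rw [listTick, ih hl fun j hj => h j (List.mem_cons_of_mem _ hj), digitTick]
    simp only [if_neg hi, h i List.mem_cons_self, lt_irrefl, if_false]
    congr 2
    funext j
    by_cases hj : j = i
    · subst hj; simp
    · simp [hj]

/-- The step sizes of the bands in `l`. -/
def listEtas (T : Fin m → ℕ) (L : Fin m → ℝ) (l : List (Fin m)) : List ℝ :=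
  (bslsSteps (l.map fun i => (T i, i))).map fun p => 1 / L p

lemma listEtas_cons (i : Fin m) (l : List (Fin m)) :
    listEtas T L (i :: l) =
      (List.replicate (T i) (listEtas T L l ++ [1 / L i])).flatten ++ listEtas T L l := by
  simp [listEtas, bslsSteps, List.map_flatten]

/-- The digits count completed rounds of each band. Induction on `l` works for an arbitrary
continuation `k`, because the inner run must be repeated with the digit of the outer band as
continuation; during the run itself `k` is never reached. -/
lemma exists_shows_listEtas {l : List (Fin m)} (hl : l.Nodup) {k F : Odometer m → Odometer m}
    (hF : ∀ o, o.flag = 0 → F o = listTick T L l k o) {o : Odometer m} (h0 : o.flag = 0)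
    (hd : ∀ i ∈ l, o.digit i = 0) :
    ∃ o', Shows F (listEtas T L l) o o' ∧ o'.flag = 0 ∧ (∀ i ∈ l, o'.digit i = T i) ∧
      ∀ i, i ∉ l → o'.digit i = o.digit i := by
  induction l generalizing k o with
  | nil => exact ⟨o, rfl, h0, by simp, fun _ _ => rfl⟩
  | cons i l ih =>
    obtain ⟨hi, hl⟩ := List.nodup_cons.1 hl
    -- After `t` rounds of band `i` its digit is `t` and the inner digits are again zero, since the
    -- carry that shows `1 / L i` also resets them.
    have hrep : ∀ t ≤ T i, ∃ o', Shows F (List.replicate t (listEtas T L l ++ [1 / L i])).flatten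
        o o' ∧ o'.flag = 0 ∧ o'.digit i = t ∧ (∀ j ∈ l, o'.digit j = 0) ∧
        ∀ j, j ∉ i :: l → o'.digit j = o.digit j := by
      intro t
      induction t with
      | zero =>
        intro _
        exact ⟨o, rfl, h0, by simpa using hd i List.mem_cons_self,
          fun j hj => hd j (List.mem_cons_of_mem _ hj), fun _ _ => rfl⟩
      | succ t iht =>
        intro ht
        obtain ⟨o₁, a1, a2, a3, a4, a5⟩ := iht (by omega)
        obtain ⟨o₂, b1, b2, b3, b4⟩ := ih hl hF a2 a4
        have hlt : (t : ℝ) < T i := by exact_mod_cast ht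
        have hstep : F o₂ = ⟨Function.update (fun j => if j ∈ l then 0 else o₂.digit j) i (t + 1),
            1 / L i, o₂.flag⟩ := by
          rw [hF o₂ b2, listTick, listTick_full hl b3, digitTick]
          simp only [if_neg hi, b4 i hi, a3, hlt, if_true]
        refine ⟨F o₂, ?_, by rw [hstep]; exact b2, by rw [hstep]; simp, fun j hj => ?_,
          fun j hj => ?_⟩
        · rw [List.replicate_succ', List.flatten_append, List.flatten_singleton]
          refine a1.append (b1.append ⟨?_, rfl⟩)
          rw [hstep]
        · rw [hstep]
          have : j ≠ i := fun h => hi (h ▸ hj)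
          simp [Function.update_of_ne this, hj]
        · rw [hstep]
          have h1 : j ≠ i := fun h => hj (h ▸ List.mem_cons_self)
          have h2 : j ∉ l := fun h => hj (List.mem_cons_of_mem _ h)
          simp only [Function.update_of_ne h1, if_neg h2]
          rw [b4 j h2, a5 j hj]
    obtain ⟨o₁, a1, a2, a3, a4, a5⟩ := hrep (T i) le_rfl
    obtain ⟨o₂, b1, b2, b3, b4⟩ := ih hl hF a2 a4
    refine ⟨o₂, ?_, b2, fun j hj => ?_, fun j hj => ?_⟩
    · rw [listEtas_cons]
      exact a1.append b1
    · rcases List.mem_cons.1 hj with rfl | hj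
      · rw [b4 j hi, a3]
      · exact b3 j hj
    · rw [b4 j fun h => hj (List.mem_cons_of_mem _ h), a5 j hj]

/-- The counter at the start. -/
def zero : Odometer m := ⟨0, 0, 0⟩

/-- The first `N` step sizes that the counter shows. -/
def etas (T : Fin m → ℕ) (L : Fin m → ℝ) (N : ℕ) : List ℝ :=
  (List.range N).map fun t => ((tick T L)^[t + 1] zero).eta

lemma Shows.eq_map {F : Odometer m → Odometer m} {es : List ℝ} {o o' : Odometer m}
    (h : Shows F es o o') : es = (List.range es.length).map fun t => (F^[t + 1] o).eta := by
  induction es generalizing o with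
  | nil => rfl
  | cons e es ih =>
    rw [List.length_cons, List.range_succ_eq_map, List.map_cons, List.map_map]
    congr 1
    · exact h.1.symm
    · exact ih h.2

lemma shows_replicate_zero {o : Odometer m} (h : 0 < o.flag) (N : ℕ) :
    ∃ o', Shows (tick T L) (List.replicate N 0) o o' := by
  induction N generalizing o with
  | zero => exact ⟨o, rfl⟩
  | succ N ih =>
    have e : tick T L o = { o with eta := 0 } := by rw [tick, if_pos h]
    obtain ⟨o', h'⟩ := ih (o := tick T L o) (by rw [e]; exact h)
    exact ⟨o', by rw [e], h'⟩

/-- The counter shows the step sizes of stochastic BSLS, followed by zeros. -/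
lemma etas_eq {N : ℕ} (hN : (bslsEtas T L).length ≤ N) :
    ∃ r, etas T L N = bslsEtas T L ++ List.replicate r 0 := by
  have hE : bslsEtas T L = listEtas T L (List.finRange m) := by
    rw [bslsEtas, schedule, List.drop_zero]; rfl
  obtain ⟨o, h1, h2, h3, -⟩ := exists_shows_listEtas (T := T) (L := L) (F := tick T L) (o := zero)
    (List.nodup_finRange m) (fun o ho => by rw [tick, if_neg (by rw [ho]; exact lt_irrefl _)])
    rfl (fun _ _ => rfl)
  have h4 : tick T L o = ⟨fun i => if i ∈ List.finRange m then 0 else o.digit i, 0, 1⟩ := by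
    rw [tick, if_neg (by rw [h2]; exact lt_irrefl _), listTick_full (List.nodup_finRange m) h3]
  rw [← hE] at h1
  obtain ⟨r, rfl⟩ := Nat.exists_eq_add_of_le hN
  rcases r with - | r
  · exact ⟨0, by simpa [etas] using h1.eq_map.symm⟩
  · obtain ⟨o', h5⟩ := shows_replicate_zero (T := T) (L := L) (o := tick T L o)
      (by rw [h4]; exact one_pos) r
    have h6 : Shows (tick T L) (bslsEtas T L ++ List.replicate (r + 1) 0) zero o' :=
      h1.append ⟨by rw [h4], h5⟩
    refine ⟨r + 1, ?_⟩
    have := h6.eq_map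
    rw [List.length_append, List.length_replicate] at this
    exact this.symm

end Odometer

lemma gdRun_replicate_zero {d : ℕ} (n : ℕ) (z : ℕ → Sample d) (r : ℕ) (s : Vec d × ℕ) :
    (gdRun n z (List.replicate r 0) s).1 = s.1 := by
  induction r generalizing s with
  | zero => rfl
  | succ r ih =>
    rw [List.replicate_succ]
    refine (ih (batchStep 0 (block n s.2 z) s.1, s.2 + n)).trans ?_
    simp [batchStep]

/-- Steps of size zero draw samples but do not move the iterate. So runs of different lengths can
share a single loop of `N` steps. -/
lemma gdRun_etas {d m : ℕ} (n : ℕ) (z : ℕ → Sample d) {T : Fin m → ℕ} {L : Fin m → ℝ} {N : ℕ}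
    (hN : ∏ i, (T i + 1) ≤ N) (s : Vec d × ℕ) :
    (gdRun n z (Odometer.etas T L N) s).1 = (gdRun n z (bslsEtas T L) s).1 := by
  obtain ⟨r, hr⟩ := Odometer.etas_eq (T := T) (L := L) (N := N) (by
    have := length_schedule T
    rw [bslsEtas, List.length_map]; omega)
  rw [hr, gdRun, List.foldl_append]
  exact gdRun_replicate_zero n z r _

end StochBSLS

namespace StochBSLS

/-! ### Running stochastic BSLS for several parameters on the same samples -/

open Prog

/-- The registers of the parallel program: the sample `(a, b)`, three scalars of scratch space, and
for each run the iterate, the gradient, and the counter with step size, flag and test error. -/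
abbrev ParWork (d m : ℕ) (G : Type) :=
  (Fin d ⊕ Fin 4) ⊕ (G × ((Fin d ⊕ Fin d) ⊕ (Fin m ⊕ Fin 3)))

section Parallel

variable {d m : ℕ} {G : Type}

abbrev pA (k : Fin d) : Reg d (ParWork d m G) := Sum.inr (Sum.inl (Sum.inl k))
abbrev pB : Reg d (ParWork d m G) := Sum.inr (Sum.inl (Sum.inr 0))
abbrev pS : Reg d (ParWork d m G) := Sum.inr (Sum.inl (Sum.inr 1))
abbrev pT : Reg d (ParWork d m G) := Sum.inr (Sum.inl (Sum.inr 2))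
abbrev pC : Reg d (ParWork d m G) := Sum.inr (Sum.inl (Sum.inr 3))
abbrev pOwn (g : G) (q : (Fin d ⊕ Fin d) ⊕ (Fin m ⊕ Fin 3)) : Reg d (ParWork d m G) :=
  Sum.inr (Sum.inr (g, q))
abbrev pX (g : G) (k : Fin d) : Reg d (ParWork d m G) := pOwn g (Sum.inl (Sum.inl k))
abbrev pG (g : G) (k : Fin d) : Reg d (ParWork d m G) := pOwn g (Sum.inl (Sum.inr k))
abbrev pDigit (g : G) (i : Fin m) : Reg d (ParWork d m G) := pOwn g (Sum.inr (Sum.inl i))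
abbrev pEta (g : G) : Reg d (ParWork d m G) := pOwn g (Sum.inr (Sum.inr 0))
abbrev pFlag (g : G) : Reg d (ParWork d m G) := pOwn g (Sum.inr (Sum.inr 1))
abbrev pRes (g : G) : Reg d (ParWork d m G) := pOwn g (Sum.inr (Sum.inr 2))

/-- The state of one run. -/
@[ext] structure Runner (d m : ℕ) where
  x : Vec d
  grad : Fin d → ℝ
  odo : Odometer m
  res : ℝ

def runner (g : G) (σ : Config d (ParWork d m G)) : Runner d m where
  x := WithLp.toLp 2 fun k => σ.1 (pX g k)
  grad k := σ.1 (pG g k)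
  odo := ⟨fun i => σ.1 (pDigit g i), σ.1 (pEta g), σ.1 (pFlag g)⟩
  res := σ.1 (pRes g)

def heldSample (σ : Config d (ParWork d m G)) : Sample d :=
  (WithLp.toLp 2 fun k => σ.1 (pA k), σ.1 pB)

def output (σ : Config d (ParWork d m G)) : Vec d := WithLp.toLp 2 fun k => σ.1 (Sum.inl k)

/-- Registers that the program of run `g` may change. -/
def Owned (g : G) (r : Reg d (ParWork d m G)) : Prop :=
  r = pS ∨ r = pT ∨ r = pC ∨ ∃ q, r = pOwn g q

variable [DecidableEq G]

/-- The program `p` transforms the state of run `g` by `Φ` and leaves the other runs alone. -/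
def Acts (z : ℕ → Sample d) (g : G) (p : Prog d (ParWork d m G))
    (Φ : Sample d → Vec d → Runner d m → Runner d m) : Prop :=
  ∀ σ, (exec z p σ).2 = σ.2 ∧ (∀ r, ¬ Owned g r → (exec z p σ).1 r = σ.1 r) ∧
    runner g (exec z p σ) = Φ (heldSample σ) (output σ) (runner g σ)

variable {z : ℕ → Sample d} {g : G} {p q : Prog d (ParWork d m G)}
  {Φ Ψ : Sample d → Vec d → Runner d m → Runner d m}

lemma Acts.heldSample_eq (h : Acts z g p Φ) (σ : Config d (ParWork d m G)) :
    heldSample (exec z p σ) = heldSample σ := by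
  have h1 := (h σ).2.1
  simp only [heldSample]
  rw [h1 pB (by simp [Owned])]
  congr 2
  funext k
  exact h1 _ (by simp [Owned])

lemma Acts.output_eq (h : Acts z g p Φ) (σ : Config d (ParWork d m G)) :
    output (exec z p σ) = output σ := by
  simp only [output]
  congr 1
  funext k
  exact (h σ).2.1 _ (by simp [Owned])

lemma Acts.runner_of_ne (h : Acts z g p Φ) (σ : Config d (ParWork d m G)) {g' : G} (hg : g' ≠ g) :
    runner g' (exec z p σ) = runner g' σ := by
  have h1 : ∀ q, (exec z p σ).1 (pOwn g' q) = σ.1 (pOwn g' q) := fun q =>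
    (h σ).2.1 _ (by simp [Owned, hg])
  simp only [runner, h1]

/-- The held sample and the output registers are not owned by any run, so the second program sees
them unchanged. The shared scratch registers may change, since no transformation `Φ` refers to them.
-/
lemma Acts.seq (hp : Acts z g p Φ) (hq : Acts z g q Ψ) :
    Acts z g (seq p q) fun s y r => Ψ s y (Φ s y r) := fun σ => by
  obtain ⟨a1, a2, a3⟩ := hp σ
  obtain ⟨b1, b2, b3⟩ := hq (exec z p σ)
  refine ⟨b1.trans a1, fun r hr => (b2 r hr).trans (a2 r hr), ?_⟩
  rw [hp.heldSample_eq, hp.output_eq, a3] at b3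
  exact b3

/-- All runs execute their programs in turn. -/
lemma exec_forList_acts {f : G → Prog d (ParWork d m G)}
    {Φ : G → Sample d → Vec d → Runner d m → Runner d m} (hf : ∀ g, Acts z g (f g) (Φ g))
    {l : List G} (hl : l.Nodup) (σ : Config d (ParWork d m G)) :
    (exec z (forList l f) σ).2 = σ.2 ∧ heldSample (exec z (forList l f) σ) = heldSample σ ∧
    output (exec z (forList l f) σ) = output σ ∧
    (∀ g ∈ l, runner g (exec z (forList l f) σ) =
      Φ g (heldSample σ) (output σ) (runner g σ)) ∧
    ∀ g, g ∉ l → runner g (exec z (forList l f) σ) = runner g σ := by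
  induction l generalizing σ with
  | nil => exact ⟨rfl, rfl, rfl, by simp, fun _ _ => rfl⟩
  | cons g l ih =>
    obtain ⟨hg, hl⟩ := List.nodup_cons.1 hl
    obtain ⟨a1, a2, a3, a4, a5⟩ := ih hl (exec z (f g) σ)
    have b := hf g
    rw [exec_forList_cons]
    refine ⟨a1.trans (b σ).1, a2.trans (b.heldSample_eq σ), a3.trans (b.output_eq σ),
      fun g' hg' => ?_, fun g' hg' => ?_⟩
    · rcases List.mem_cons.1 hg' with rfl | h
      · rw [a5 _ hg, (b σ).2.2]
      · rw [a4 _ h, b.heldSample_eq, b.output_eq, b.runner_of_ne _ fun e => hg (e ▸ h)]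
    · rw [a5 _ fun h => hg' (List.mem_cons_of_mem _ h),
        b.runner_of_ne _ fun e => hg' (e ▸ List.mem_cons_self)]

/-! #### The programs of a single run -/

/-- Copy the input. -/
def copyIn (g : G) : Prog d (ParWork d m G) :=
  -- Copying a register is done by adding zero.
  forEach fun k => seq (const pT 0) (add (pX g k) (Sum.inl k) pT)

def zeroGradient (g : G) : Prog d (ParWork d m G) := forEach fun k => const (pG g k) 0

def stepAlongGradient (g : G) : Prog d (ParWork d m G) :=
  forEach fun k => seq (mul pT (pEta g) (pG g k)) (sub (pX g k) (pX g k) pT)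

/-- The registers of the single run `g` within those of the parallel program. -/
def embedRun (g : G) : Reg d (Work d) → Reg d (ParWork d m G)
  | Sum.inl k => pX g k
  | Sum.inr (Sum.inl (Sum.inl k)) => pG g k
  | Sum.inr (Sum.inl (Sum.inr k)) => pA k
  | Sum.inr (Sum.inr i) => Sum.inr (Sum.inl (Sum.inr i))

lemma embedRun_injective (g : G) : Function.Injective (embedRun (d := d) (m := m) g) := by
  rintro (k | (k | k) | i) (k' | (k' | k') | i') h <;> simp_all [embedRun]

def addError (g : G) : Prog d (ParWork d m G) :=
  seq (const pS 0) <|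
  seq (forEach fun k => seq (mul pT (pA k) (pX g k)) (add pS pS pT)) <|
  seq (sub pS pS pB) <|
  seq (mul pS pS pS) (add (pRes g) (pRes g) pS)

/-- Advance one digit of the counter, with the program `k` for the overflow. -/
def digitProg (T : Fin m → ℕ) (L : Fin m → ℝ) (g : G) (i : Fin m) (k : Prog d (ParWork d m G)) :
    Prog d (ParWork d m G) :=
  seq (const pS (T i)) <|
  seq (sub pT pS (pDigit g i)) <|
  ifPos pT
    (seq (const pT 1) (seq (add (pDigit g i) (pDigit g i) pT) (const (pEta g) (1 / L i))))
    (seq (const (pDigit g i) 0) k)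

def listTickProg (T : Fin m → ℕ) (L : Fin m → ℝ) (g : G) :
    List (Fin m) → Prog d (ParWork d m G) → Prog d (ParWork d m G)
  | [], k => k
  | i :: l, k => listTickProg T L g l (digitProg T L g i k)

def tickProg (T : Fin m → ℕ) (L : Fin m → ℝ) (g : G) : Prog d (ParWork d m G) :=
  ifPos (pFlag g) (const (pEta g) 0)
    (listTickProg T L g (List.finRange m) (seq (const (pEta g) 0) (const (pFlag g) 1)))

variable (z g)

lemma acts_copyIn : Acts (m := m) z g (copyIn g) fun _ y r => { r with x := y } := fun σ => by
  obtain ⟨h1, h2, h3⟩ := exec_forEach_update z (t := pT) (G := pX g)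
    (f := fun k => seq (const pT 0) (add (pX g k) (Sum.inl k) pT)) (F := fun k ρ => ρ (Sum.inl k))
    (fun i j h => by simpa using h) (by simp) (fun k σ => rfl)
    (fun k σ => by simp [exec]) (fun k σ r hr hr' => by simp [exec, hr, hr'])
    (fun k ρ ρ' h => h _ (by simp) (by simp)) σ
  refine ⟨h1, fun r hr => ?_, ?_⟩
  · simp only [Owned, not_or, not_exists] at hr
    exact h3 r hr.2.1 fun k => hr.2.2.2 _
  · have h4 : ∀ q, (∀ k, q ≠ Sum.inl (Sum.inl k)) →
        (exec z (copyIn g) σ).1 (pOwn g q) = σ.1 (pOwn g q) := fun q hq =>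
      h3 _ (by simp) fun k h => hq k (by simpa using h)
    ext
    · exact h2 _
    · exact h4 _ (by simp)
    · exact h4 _ (by simp)
    · exact h4 _ (by simp)
    · exact h4 _ (by simp)
    · exact h4 _ (by simp)

lemma acts_zeroGradient : Acts (m := m) z g (zeroGradient g) fun _ _ r => { r with grad := 0 } :=
  fun σ => by
  obtain ⟨h1, h2, h3⟩ := exec_forEach_update z (t := pT) (G := pG g)
    (f := fun k => const (pG g k) 0) (F := fun k ρ => 0)
    (fun i j h => by simpa using h) (by simp) (fun k σ => rfl)
    (fun k σ => by simp [exec]) (fun k σ r hr hr' => by simp [exec, hr'])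
    (fun k ρ ρ' h => rfl) σ
  refine ⟨h1, fun r hr => ?_, ?_⟩
  · simp only [Owned, not_or, not_exists] at hr
    exact h3 r hr.2.1 fun k => hr.2.2.2 _
  · have h4 : ∀ q, (∀ k, q ≠ Sum.inl (Sum.inr k)) →
        (exec z (zeroGradient g) σ).1 (pOwn g q) = σ.1 (pOwn g q) := fun q hq =>
      h3 _ (by simp) fun k h => hq k (by simpa using h)
    ext
    · exact h4 _ (by simp)
    · exact h2 _
    · exact h4 _ (by simp)
    · exact h4 _ (by simp)
    · exact h4 _ (by simp)
    · exact h4 _ (by simp)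

lemma acts_stepAlongGradient : Acts (m := m) z g (stepAlongGradient g) fun _ _ r =>
    { r with x := WithLp.toLp 2 fun k => r.x k - r.odo.eta * r.grad k } := fun σ => by
  obtain ⟨h1, h2, h3⟩ := exec_forEach_update z (t := pT) (G := pX g)
    (f := fun k => seq (mul pT (pEta g) (pG g k)) (sub (pX g k) (pX g k) pT))
    (F := fun k ρ => ρ (pX g k) - ρ (pEta g) * ρ (pG g k))
    (fun i j h => by simpa using h) (by simp) (fun k σ => rfl)
    (fun k σ => by simp [exec]) (fun k σ r hr hr' => by simp [exec, hr, hr'])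
    (fun k ρ ρ' h => by
      rw [h (pX g k) (by simp) (fun j hj => by simpa using hj.symm), h (pEta g) (by simp) (by simp),
        h (pG g k) (by simp) (by simp)]) σ
  refine ⟨h1, fun r hr => ?_, ?_⟩
  · simp only [Owned, not_or, not_exists] at hr
    exact h3 r hr.2.1 fun k => hr.2.2.2 _
  · have h4 : ∀ q, (∀ k, q ≠ Sum.inl (Sum.inl k)) →
        (exec z (stepAlongGradient g) σ).1 (pOwn g q) = σ.1 (pOwn g q) := fun q hq =>
      h3 _ (by simp) fun k h => hq k (by simpa using h)
    ext
    · exact h2 _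
    · exact h4 _ (by simp)
    · exact h4 _ (by simp)
    · exact h4 _ (by simp)
    · exact h4 _ (by simp)
    · exact h4 _ (by simp)

/-- Transfers `exec_addGradient` along the embedding of registers. Of the registers in its image,
the sample is shared and kept; everything else is owned by the run or is scratch. -/
lemma acts_addGradient (n : ℕ) : Acts (m := m) z g ((addGradient d n).map (embedRun g))
    fun s _ r => { r with
      grad := fun k => r.grad k + (1 / (n : ℝ)) * (inner ℝ s.1 r.x - s.2) * s.1 k } := fun σ => by
  have h0 := pull_exec_map (embedRun_injective (m := m) g) z (addGradient d n) σ
  obtain ⟨h1, h2, h3, h4, h5⟩ := exec_addGradient z n (pull (embedRun g) σ)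
  rw [← h0] at h1 h2 h3 h4 h5
  have hout := fun r => exec_map_of_notMem (embedRun (m := m) g) z (addGradient d n) σ (r := r)
  refine ⟨h1, fun r hr => ?_, ?_⟩
  · simp only [Owned, not_or, not_exists] at hr
    by_cases h : ∃ i, r = embedRun g i
    · obtain ⟨i, rfl⟩ := h
      rcases i with k | (k | k) | i
      · exact absurd rfl (hr.2.2.2 _)
      · exact absurd rfl (hr.2.2.2 _)
      · exact h3 k
      · fin_cases i
        · exact h4
        · exact absurd rfl hr.1
        · exact absurd rfl hr.2.1
        · exact absurd rfl hr.2.2.1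
    · exact hout r fun i hi => h ⟨i, hi⟩
  · have h6 : ∀ q, (exec z ((addGradient d n).map (embedRun g)) σ).1 (pOwn g (Sum.inr q)) =
        σ.1 (pOwn g (Sum.inr q)) := fun q =>
      hout _ (by rintro (k | (k | k) | i) <;> simp [embedRun])
    ext
    · exact h2 _
    · refine (h5 _).trans ?_
      simp only [inner_eq_sum]
      rfl
    · exact h6 _
    · exact h6 _
    · exact h6 _
    · exact h6 _

lemma acts_addError : Acts (m := m) z g (addError g) fun s _ r =>
    { r with res := r.res + (inner ℝ s.1 r.x - s.2) ^ 2 } := fun σ => by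
  set σ1 := exec z (const pS 0) σ with hσ1
  obtain ⟨h1, h2, h3⟩ := exec_dot z (s := pS) (t := pT) (A := pA) (X := pX g)
    (by simp) (by simp) (by simp) σ1
  set σ2 := exec z (forEach fun k => seq (mul pT (pA k) (pX g k)) (add pS pS pT)) σ1 with hσ2
  have hE : exec z (addError g) σ = exec z (seq (sub pS pS pB)
    (seq (mul pS pS pS) (add (pRes g) (pRes g) pS))) σ2 := rfl
  have hfr : ∀ r, r ≠ pS → r ≠ pT → σ2.1 r = σ.1 r := fun r hs ht => by
    rw [h3 r hs ht, hσ1]; simp [exec, hs]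
  have hfr2 : ∀ r, r ≠ pS → r ≠ pT → r ≠ pRes g → (exec z (addError g) σ).1 r = σ.1 r :=
    fun r hs ht hr => by
      rw [hE, ← hfr r hs ht]; simp [exec, hs, hr]
  refine ⟨?_, fun r hr => ?_, ?_⟩
  · rw [hE]; exact h1
  · simp only [Owned, not_or, not_exists] at hr
    exact hfr2 r hr.1 hr.2.1 (hr.2.2.2 _)
  · ext
    · exact hfr2 _ (by simp) (by simp) (by simp)
    · exact hfr2 _ (by simp) (by simp) (by simp)
    · exact hfr2 _ (by simp) (by simp) (by simp)
    · exact hfr2 _ (by simp) (by simp) (by simp)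
    · exact hfr2 _ (by simp) (by simp) (by simp)
    · have e : (exec z (addError g) σ).1 (pRes g) =
          σ2.1 (pRes g) + (σ2.1 pS - σ2.1 pB) * (σ2.1 pS - σ2.1 pB) := by
        rw [hE]; simp [exec]
      refine e.trans ?_
      have e1 : σ1.1 pS = 0 := by rw [hσ1]; simp [exec]
      have e2 : ∀ r, r ≠ pS → σ1.1 r = σ.1 r := fun r hr => by rw [hσ1]; simp [exec, hr]
      rw [hfr (pRes g) (by simp) (by simp), hfr pB (by simp) (by simp), h2, e1, zero_add,
        ← pow_two]
      simp only [inner_eq_sum, e2 _ (show pA _ ≠ pS by simp), e2 _ (show pX g _ ≠ pS by simp)]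
      rfl

variable {z g}

lemma acts_digitProg (T : Fin m → ℕ) (L : Fin m → ℝ) (i : Fin m)
    {κ : Odometer m → Odometer m} (h : Acts z g p fun _ _ r => { r with odo := κ r.odo }) :
    Acts z g (digitProg T L g i p)
      fun _ _ r => { r with odo := Odometer.digitTick T L i κ r.odo } := fun σ => by
  set σ1 := exec z (seq (const pS (T i)) (sub pT pS (pDigit g i))) σ with hσ1
  have hfr : ∀ r, r ≠ pS → r ≠ pT → σ1.1 r = σ.1 r := fun r hs ht => by
    rw [hσ1]; simp [exec, hs, ht]
  have hT : σ1.1 pT = T i - σ.1 (pDigit g i) := by rw [hσ1]; simp [exec]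
  have hE : exec z (digitProg T L g i p) σ = if 0 < σ1.1 pT then
      exec z (seq (const pT 1) (seq (add (pDigit g i) (pDigit g i) pT)
        (const (pEta g) (1 / L i)))) σ1
      else exec z p (exec z (const (pDigit g i) 0) σ1) := rfl
  have hr1 : runner g σ1 = runner g σ := by
    simp only [runner, hfr _ (show pOwn g _ ≠ pS by simp) (show pOwn g _ ≠ pT by simp)]
  rw [hE, hT]
  by_cases hlt : σ.1 (pDigit g i) < T i
  · rw [if_pos (by linarith)]
    refine ⟨rfl, fun r hr => ?_, ?_⟩
    · simp only [Owned, not_or, not_exists] at hr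
      rw [← hfr r hr.1 hr.2.1]
      simp [exec, hr.2.1, hr.2.2.2]
    · have hd : (runner g σ).odo.digit i < T i := hlt
      beta_reduce
      rw [Odometer.digitTick, if_pos hd, ← hr1]
      ext j
      · simp [runner, exec]
      · simp [runner, exec]
      · by_cases hj : j = i
        · subst hj; simp [runner, exec]
        · simp [runner, exec, hj]
      · simp [runner, exec]
      · simp [runner, exec]
      · simp [runner, exec]
  · rw [if_neg (by linarith)]
    set σ2 := exec z (const (pDigit g i) 0) σ1 with hσ2
    obtain ⟨a1, a2, a3⟩ := h σ2
    refine ⟨a1, fun r hr => ?_, ?_⟩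
    · rw [a2 r hr]
      simp only [Owned, not_or, not_exists] at hr
      rw [← hfr r hr.1 hr.2.1, hσ2]
      simp [exec, hr.2.2.2]
    · have hd : ¬ (runner g σ).odo.digit i < T i := hlt
      rw [a3]
      beta_reduce
      rw [Odometer.digitTick, if_neg hd, ← hr1]
      have e : runner g σ2 = { runner g σ1 with odo := { (runner g σ1).odo with
          digit := Function.update (runner g σ1).odo.digit i 0 } } := by
        rw [hσ2]
        ext j
        · simp [runner, exec]
        · simp [runner, exec]
        · by_cases hj : j = i
          · subst hj; simp [runner, exec]
          · simp [runner, exec, hj]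
        · simp [runner, exec]
        · simp [runner, exec]
        · simp [runner, exec]
      rw [e]

lemma acts_listTickProg (T : Fin m → ℕ) (L : Fin m → ℝ) (l : List (Fin m))
    {κ : Odometer m → Odometer m} (h : Acts z g p fun _ _ r => { r with odo := κ r.odo }) :
    Acts z g (listTickProg T L g l p)
      fun _ _ r => { r with odo := Odometer.listTick T L l κ r.odo } := by
  induction l generalizing p κ with
  | nil => exact h
  | cons i l ih => exact ih (acts_digitProg T L i h)

lemma acts_tickProg (T : Fin m → ℕ) (L : Fin m → ℝ) : Acts z g (tickProg T L g)
    fun _ _ r => { r with odo := Odometer.tick T L r.odo } := fun σ => by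
  have hE : exec z (tickProg T L g) σ = if 0 < σ.1 (pFlag g) then
      exec z (const (pEta g) 0) σ else exec z (listTickProg T L g (List.finRange m)
        (seq (const (pEta g) 0) (const (pFlag g) 1))) σ := rfl
  have h0 : Acts z g (seq (const (pEta g) 0) (const (pFlag g) 1))
      fun _ _ r => { r with odo := (fun o : Odometer m => ⟨o.digit, 0, 1⟩) r.odo } := fun σ => by
    refine ⟨rfl, fun r hr => ?_, ?_⟩
    · simp only [Owned, not_or, not_exists] at hr
      simp [exec, hr.2.2.2]
    · ext <;> simp [runner, exec]
  rw [hE]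
  by_cases hf : 0 < σ.1 (pFlag g)
  · have hf' : 0 < (runner g σ).odo.flag := hf
    rw [if_pos hf]
    beta_reduce
    rw [Odometer.tick, if_pos hf']
    refine ⟨rfl, fun r hr => ?_, ?_⟩
    · simp only [Owned, not_or, not_exists] at hr
      simp [exec, hr.2.2.2]
    · ext <;> simp [runner, exec]
  · have hf' : ¬ 0 < (runner g σ).odo.flag := hf
    rw [if_neg hf]
    beta_reduce
    rw [Odometer.tick, if_neg hf']
    exact acts_listTickProg T L _ h0 σ

end Parallel

end StochBSLS

namespace StochBSLS

/-! #### The parallel program -/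

section Parallel

open Prog

variable {d m : ℕ} {G : Type} [DecidableEq G]

/-- Draw `n` samples, each of which is processed by all runs. -/
def sampleLoop (n : ℕ) (l : List G) (f : G → Prog d (ParWork d m G)) : Prog d (ParWork d m G) :=
  loop n (seq (query pA pB) (forList l f))

lemma exec_query_par (z : ℕ → Sample d) (σ : Config d (ParWork d m G)) :
    heldSample (exec z (query pA pB) σ) = z σ.2 ∧ output (exec z (query pA pB) σ) = output σ ∧
    ∀ g, runner g (exec z (query pA pB) σ) = runner g σ := by
  have hinj : Function.Injective (pA (d := d) (m := m) (G := G)) := fun i j h => by simpa using h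
  have hfr := fun r (hr : r ≠ pB) hr' => exec_query_of_ne z (pA (d := d) (m := m) (G := G)) pB σ hr hr'
  refine ⟨Prod.ext ?_ (by simp [heldSample, exec]), ?_, fun g => ?_⟩
  · ext k
    exact exec_query_apply z hinj (b := pB) (by simp) σ k
  · simp only [output, hfr (Sum.inl _) (by simp) (by simp)]
  · simp only [runner, hfr (pOwn g _) (by simp) (by simp)]

variable {z : ℕ → Sample d} {l : List G}

lemma exec_sampleLoop {f : G → Prog d (ParWork d m G)}
    {Φ : G → Sample d → Vec d → Runner d m → Runner d m} (hf : ∀ g, Acts z g (f g) (Φ g))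
    (hl : l.Nodup) (hmem : ∀ g, g ∈ l) (i : ℕ) (σ : Config d (ParWork d m G)) :
    (exec z (sampleLoop i l f) σ).2 = σ.2 + i ∧ output (exec z (sampleLoop i l f) σ) = output σ ∧
    ∀ g, runner g (exec z (sampleLoop i l f) σ) =
      (List.range i).foldl (fun r j => Φ g (z (σ.2 + j)) (output σ) r) (runner g σ) := by
  induction i with
  | zero => exact ⟨rfl, rfl, fun _ => rfl⟩
  | succ i ih =>
    obtain ⟨h1, h2, h3⟩ := ih
    set σ1 := exec z (sampleLoop i l f) σ
    have hE : exec z (sampleLoop (i + 1) l f) σ =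
        exec z (forList l f) (exec z (query pA pB) σ1) := by
      simp only [sampleLoop, exec, Function.iterate_succ', Function.comp_apply]
      rfl
    obtain ⟨q1, q2, q3⟩ := exec_query_par z σ1
    set σ2 := exec z (query pA pB) σ1 with hσ2
    have q0 : σ2.2 = σ1.2 + 1 := rfl
    obtain ⟨a1, -, a3, a4, -⟩ := exec_forList_acts hf hl σ2
    rw [hE]
    refine ⟨by rw [a1, q0, h1, add_assoc], by rw [a3, q2, h2], fun g => ?_⟩
    rw [a4 g (hmem g), q1, q2, q3, h1, h2, h3, List.range_succ, List.foldl_append]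
    rfl

lemma foldl_grad (n i off : ℕ) (r : Runner d m) :
    (List.range i).foldl (fun r j => { r with
      grad := fun k => r.grad k + (1 / (n : ℝ)) *
        (inner ℝ (z (off + j)).1 r.x - (z (off + j)).2) * (z (off + j)).1 k }) r =
    { r with grad := fun k => r.grad k + ∑ j ∈ Finset.range i, (1 / (n : ℝ)) *
        (inner ℝ (z (off + j)).1 r.x - (z (off + j)).2) * (z (off + j)).1 k } := by
  induction i with
  | zero => simp
  | succ i ih =>
    rw [List.range_succ, List.foldl_append, ih]
    simp only [List.foldl_cons, List.foldl_nil, Finset.sum_range_succ, add_assoc]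

lemma foldl_res (i off : ℕ) (r : Runner d m) :
    (List.range i).foldl (fun r j => { r with
      res := r.res + (inner ℝ (z (off + j)).1 r.x - (z (off + j)).2) ^ 2 }) r =
    { r with res := r.res + ∑ j ∈ Finset.range i,
      (inner ℝ (z (off + j)).1 r.x - (z (off + j)).2) ^ 2 } := by
  induction i with
  | zero => simp
  | succ i ih =>
    rw [List.range_succ, List.foldl_append, ih]
    simp only [List.foldl_cons, List.foldl_nil, Finset.sum_range_succ, add_assoc]

variable (T : G → Fin m → ℕ) (L : G → Fin m → ℝ)

/-- One minibatch step of all runs. -/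
def parStep (n : ℕ) (l : List G) : Prog d (ParWork d m G) :=
  seq (forList l zeroGradient) <|
  seq (sampleLoop n l fun g => (addGradient d n).map (embedRun g)) <|
  forList l fun g => seq (tickProg (T g) (L g) g) (stepAlongGradient g)

lemma exec_parStep (hl : l.Nodup) (hmem : ∀ g, g ∈ l) (n : ℕ) (σ : Config d (ParWork d m G)) :
    (exec z (parStep T L n l) σ).2 = σ.2 + n ∧ output (exec z (parStep T L n l) σ) = output σ ∧
    ∀ g, (runner g (exec z (parStep T L n l) σ)).odo = ((runner g σ).odo).tick (T g) (L g) ∧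
      (runner g (exec z (parStep T L n l) σ)).res = (runner g σ).res ∧
      (runner g (exec z (parStep T L n l) σ)).x =
        batchStep (((runner g σ).odo).tick (T g) (L g)).eta (block n σ.2 z) (runner g σ).x := by
  obtain ⟨a1, -, a3, a4, -⟩ := exec_forList_acts (m := m) (acts_zeroGradient z) hl σ
  set σ1 := exec z (forList l zeroGradient) σ
  obtain ⟨b1, b2, b3⟩ := exec_sampleLoop (m := m) (fun g => acts_addGradient z g n) hl hmem n σ1
  set σ2 := exec z (sampleLoop n l fun g => (addGradient d n).map (embedRun g)) σ1
  obtain ⟨c1, -, c3, c4, -⟩ := exec_forList_acts (m := m)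
    (fun g => (acts_tickProg (z := z) (T g) (L g)).seq (acts_stepAlongGradient z g)) hl σ2
  have hE : exec z (parStep T L n l) σ =
    exec z (forList l fun g => seq (tickProg (T g) (L g) g) (stepAlongGradient g)) σ2 := rfl
  rw [hE]
  refine ⟨by rw [c1, b1, a1], by rw [c3, b2, a3], fun g => ?_⟩
  rw [c4 g (hmem g), b3 g, a4 g (hmem g), a1, foldl_grad]
  refine ⟨rfl, rfl, ?_⟩
  ext k
  simp only [Pi.zero_apply, zero_add, Finset.sum_range, batchStep, block]
  simp

lemma exec_loop_parStep (hl : l.Nodup) (hmem : ∀ g, g ∈ l) (n N : ℕ)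
    (σ : Config d (ParWork d m G)) :
    (exec z (loop N (parStep T L n l)) σ).2 = σ.2 + n * N ∧
    output (exec z (loop N (parStep T L n l)) σ) = output σ ∧
    ∀ g, (runner g (exec z (loop N (parStep T L n l)) σ)).odo =
        (Odometer.tick (T g) (L g))^[N] (runner g σ).odo ∧
      (runner g (exec z (loop N (parStep T L n l)) σ)).res = (runner g σ).res ∧
      (runner g (exec z (loop N (parStep T L n l)) σ)).x =
        (gdRun n z ((List.range N).map fun t =>
          ((Odometer.tick (T g) (L g))^[t + 1] (runner g σ).odo).eta) ((runner g σ).x, σ.2)).1 := by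
  induction N with
  | zero => exact ⟨rfl, rfl, fun _ => ⟨rfl, rfl, rfl⟩⟩
  | succ N ih =>
    obtain ⟨h1, h2, h3⟩ := ih
    set σ1 := exec z (loop N (parStep T L n l)) σ
    have hE : exec z (loop (N + 1) (parStep T L n l)) σ = exec z (parStep T L n l) σ1 := by
      simp only [exec, Function.iterate_succ', Function.comp_apply]
      rfl
    obtain ⟨a1, a2, a3⟩ := exec_parStep (z := z) T L hl hmem n σ1
    rw [hE]
    refine ⟨by rw [a1, h1]; ring, a2.trans h2, fun g => ?_⟩
    obtain ⟨b1, b2, b3⟩ := h3 g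
    obtain ⟨c1, c2, c3⟩ := a3 g
    refine ⟨?_, c2.trans b2, ?_⟩
    · rw [c1, b1, Function.iterate_succ_apply']
    · rw [c3, b3, b1, h1, List.range_succ, List.map_append, List.map_singleton, gdRun_append,
        List.length_map, List.length_range, Function.iterate_succ_apply']

/-- Copy the iterate of run `g` to the output if its test error is less than `θ`. -/
def selectRun (θ : ℝ) (g : G) : Prog d (ParWork d m G) :=
  seq (const pS θ) <|
  seq (sub pT pS (pRes g)) <|
  ifPos pT (forEach fun k => seq (const pS 0) (add (Sum.inl k) (pX g k) pS)) skip

lemma exec_selectRun (θ : ℝ) (g : G) (σ : Config d (ParWork d m G)) :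
    (exec z (selectRun θ g) σ).2 = σ.2 ∧
    (∀ g', runner g' (exec z (selectRun θ g) σ) = runner g' σ) ∧
    output (exec z (selectRun θ g) σ) =
      if (runner g σ).res < θ then (runner g σ).x else output σ := by
  set σ1 := exec z (seq (const pS θ) (sub pT pS (pRes g))) σ with hσ1
  have hfr : ∀ r, r ≠ pS → r ≠ pT → σ1.1 r = σ.1 r := fun r hs ht => by
    rw [hσ1]; simp [exec, hs, ht]
  have hT : σ1.1 pT = θ - σ.1 (pRes g) := by rw [hσ1]; simp [exec]
  have hE : exec z (selectRun θ g) σ = if 0 < σ1.1 pT then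
      exec z (forEach fun k => seq (const pS 0) (add (Sum.inl k) (pX g k) pS)) σ1 else σ1 := rfl
  have hr1 : ∀ g', runner g' σ1 = runner g' σ := fun g' => by
    simp only [runner, hfr _ (show pOwn g' _ ≠ pS by simp) (show pOwn g' _ ≠ pT by simp)]
  obtain ⟨h1, h2, h3⟩ := exec_forEach_update z (t := (pS : Reg d (ParWork d m G)))
    (G := fun k => Sum.inl k)
    (f := fun k => seq (const pS 0) (add (Sum.inl k) (pX g k) pS)) (F := fun k ρ => ρ (pX g k))
    (fun i j h => by simpa using h) (by simp) (fun k σ => rfl)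
    (fun k σ => by simp [exec]) (fun k σ r hr hr' => by simp [exec, hr, hr'])
    (fun k ρ ρ' h => h _ (by simp) (by simp)) σ1
  rw [hE, hT]
  by_cases hlt : (runner g σ).res < θ
  · have hlt' : σ.1 (pRes g) < θ := hlt
    rw [if_pos (by linarith), if_pos hlt]
    refine ⟨h1, fun g' => ?_, ?_⟩
    · rw [← hr1]
      simp only [runner, h3 _ (show pOwn g' _ ≠ pS by simp) (show ∀ k, pOwn g' _ ≠ Sum.inl k by simp)]
    · rw [← hr1]
      ext k
      exact h2 k
  · have hlt' : ¬ σ.1 (pRes g) < θ := hlt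
    rw [if_neg (by linarith), if_neg hlt]
    refine ⟨rfl, hr1, ?_⟩
    simp only [output, hfr (Sum.inl _) (by simp) (by simp)]

/-- The first alternative is the invariant of the pass: an output taken from a run that passed can
be overwritten, but only by another run that passes. -/
lemma exec_forList_selectRun (θ : ℝ) (l : List G) (σ : Config d (ParWork d m G)) :
    (exec z (forList l (selectRun θ)) σ).2 = σ.2 ∧
    ((∃ g, (runner g σ).res < θ ∧ output σ = (runner g σ).x) ∨ (∃ g ∈ l, (runner g σ).res < θ) →
      ∃ g, (runner g σ).res < θ ∧ output (exec z (forList l (selectRun θ)) σ) =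
        (runner g σ).x) := by
  induction l generalizing σ with
  | nil => exact ⟨rfl, fun h => h.elim id (by simp)⟩
  | cons g l ih =>
    obtain ⟨h1, h2⟩ := ih (exec z (selectRun θ g) σ)
    obtain ⟨a1, a2, a3⟩ := exec_selectRun (z := z) θ g σ
    rw [exec_forList_cons]
    refine ⟨h1.trans a1, fun h => ?_⟩
    simp only [a2, a3] at h2
    refine h2 ?_
    by_cases hg : (runner g σ).res < θ
    · exact Or.inl ⟨g, hg, if_pos hg⟩
    · rw [if_neg hg]
      refine h.imp_right ?_
      rintro ⟨g', hg', h'⟩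
      rcases List.mem_cons.1 hg' with rfl | hg'
      · exact absurd h' hg
      · exact ⟨g', hg', h'⟩

/-- Run all parameters on the same samples, estimate the error of all runs on `S` fresh samples, and
return the result of a run with a small estimate. -/
def parallelProg (n N S : ℕ) (θ : ℝ) (l : List G) : Prog d (ParWork d m G) :=
  seq (forList l copyIn) <|
  seq (loop N (parStep T L n l)) <|
  seq (sampleLoop S l addError) <|
  forList l (selectRun θ)

/-- The iterate of the run with the parameters `T` and `L` after `N` steps. -/
def runOutput (n N : ℕ) (T : Fin m → ℕ) (L : Fin m → ℝ) (x : Vec d) (z : ℕ → Sample d) : Vec d :=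
  (gdRun n z (Odometer.etas T L N) (x, 0)).1

/-- The sum of the squared errors of `x` on the samples `y`. -/
def sqError {S : ℕ} (y : Fin S → Sample d) (x : Vec d) : ℝ :=
  ∑ j, (inner ℝ (y j).1 x - (y j).2) ^ 2

/-- Each sample is drawn once and processed by all runs, so the number of samples does not depend on
the number of runs. The test uses the `S` samples after all those that the candidates depend on. -/
theorem parallelProg_spec (hl : l.Nodup) (hmem : ∀ g, g ∈ l) (n N S : ℕ) (θ : ℝ) (x : Vec d) :
    (parallelProg T L n N S θ l).queries x z = n * N + S ∧
    ((∃ g, sqError (block S (n * N) z) (runOutput n N (T g) (L g) x z) < θ) →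
      ∃ g, sqError (block S (n * N) z) (runOutput n N (T g) (L g) x z) < θ ∧
        (parallelProg T L n N S θ l).result x z = runOutput n N (T g) (L g) x z) := by
  set σ0 : Config d (ParWork d m G) := start x
  obtain ⟨a1, -, -, a4, -⟩ := exec_forList_acts (m := m) (acts_copyIn z) hl σ0
  set σ1 := exec z (forList l copyIn) σ0
  obtain ⟨b1, -, b3⟩ := exec_loop_parStep (z := z) T L hl hmem n N σ1
  set σ2 := exec z (loop N (parStep T L n l)) σ1
  obtain ⟨c1, -, c3⟩ := exec_sampleLoop (m := m) (acts_addError z) hl hmem S σ2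
  set σ3 := exec z (sampleLoop S l addError) σ2
  obtain ⟨e1, e2⟩ := exec_forList_selectRun (z := z) θ l σ3
  have h01 : σ1.2 = 0 := a1
  have h02 : σ2.2 = n * N := by rw [b1, h01, zero_add]
  have hr1 : ∀ g, runner g σ1 = ⟨x, 0, Odometer.zero, 0⟩ := fun g => by
    rw [a4 g (hmem g)]; rfl
  have hx2 : ∀ g, (runner g σ2).x = runOutput n N (T g) (L g) x z := fun g => by
    rw [(b3 g).2.2, hr1, h01]; rfl
  have hres2 : ∀ g, (runner g σ2).res = 0 := fun g => by rw [(b3 g).2.1, hr1]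
  have hx3 : ∀ g, (runner g σ3).x = runOutput n N (T g) (L g) x z := fun g => by
    rw [c3 g, foldl_res]; exact hx2 g
  have hres3 : ∀ g, (runner g σ3).res =
      sqError (block S (n * N) z) (runOutput n N (T g) (L g) x z) := fun g => by
    rw [c3 g, foldl_res]
    simp only [hres2, zero_add, h02, hx2, Finset.sum_range]
    rfl
  refine ⟨?_, fun h => ?_⟩
  · change (exec z (forList l (selectRun θ)) σ3).2 = _
    rw [e1, c1, h02]
  · simp only [hres3, hx3] at e2
    exact e2 (Or.inr (h.imp fun g hg => ⟨hmem g, hg⟩))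

/-! #### Size of the parallel program -/

lemma length_forEach_le {W : Type} {f : Fin d → Prog d W} {B : ℕ} (h : ∀ k, (f k).length ≤ B) :
    (forEach f).length ≤ d * B := by
  have := length_forList_le (List.finRange d) h
  rwa [List.length_finRange] at this

lemma loopDepth_forEach {W : Type} {f : Fin d → Prog d W} (h : ∀ k, (f k).loopDepth = 0) :
    (forEach f).loopDepth = 0 :=
  Nat.le_zero.1 (loopDepth_forList (List.finRange d) fun k => (h k).le)

lemma length_addGradient_le (n : ℕ) : (addGradient d n).length ≤ 4 * d + 4 := by
  have h1 := length_forEach_le (B := 2)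
    (f := fun k : Fin d => seq (mul tReg (aReg k) (xReg k)) (add sReg sReg tReg)) fun k => le_rfl
  have h2 := length_forEach_le (B := 2)
    (f := fun k : Fin d => seq (mul tReg sReg (aReg k)) (add (gReg k) (gReg k) tReg)) fun k => le_rfl
  simp only [addGradient, Prog.length]
  omega

lemma length_loopDepth_listTickProg (T : Fin m → ℕ) (L : Fin m → ℝ) (g : G) (l : List (Fin m))
    (p : Prog d (ParWork d m G)) :
    (listTickProg T L g l p).length = 7 * l.length + p.length ∧
    (listTickProg T L g l p).loopDepth = p.loopDepth := by
  induction l generalizing p with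
  | nil => simp [listTickProg]
  | cons i l ih =>
    obtain ⟨h1, h2⟩ := ih (digitProg T L g i p)
    rw [listTickProg, h1, h2]
    simp only [digitProg, Prog.length, loopDepth, List.length_cons]
    omega

lemma length_tickProg (T : Fin m → ℕ) (L : Fin m → ℝ) (g : G) :
    (tickProg (d := d) T L g).length = 7 * m + 4 ∧ (tickProg (d := d) T L g).loopDepth = 0 := by
  obtain ⟨h1, h2⟩ := length_loopDepth_listTickProg (d := d) T L g (List.finRange m)
    (seq (const (pEta g) 0) (const (pFlag g) 1))
  simp only [tickProg, Prog.length, loopDepth, h1, h2, List.length_finRange]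
  omega

lemma parallelProg_size_le [Fintype G] (hl : l.length = Fintype.card G) (n N S : ℕ) (θ : ℝ) :
    (parallelProg (d := d) T L n N S θ l).space + (parallelProg (d := d) T L n N S θ l).length ≤
      Fintype.card G * (15 * d + 8 * m + 18) + (4 * d + 11) := by
  have hcopy : ∀ g : G, (copyIn (d := d) (m := m) g).length ≤ d * 2 := fun g =>
    length_forEach_le fun k => le_rfl
  have hcopy0 : ∀ g : G, (copyIn (d := d) (m := m) g).loopDepth = 0 := fun g =>
    loopDepth_forEach fun k => rfl
  have hzero : ∀ g : G, (zeroGradient (d := d) (m := m) g).length ≤ d * 1 := fun g =>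
    length_forEach_le fun k => le_rfl
  have hzero0 : ∀ g : G, (zeroGradient (d := d) (m := m) g).loopDepth = 0 := fun g =>
    loopDepth_forEach fun k => rfl
  have hadd : ∀ g : G, ((addGradient d n).map (embedRun (m := m) g)).length ≤ 4 * d + 4 :=
    fun g => by rw [length_map]; exact length_addGradient_le n
  have hadd0 : ∀ g : G, ((addGradient d n).map (embedRun (m := m) g)).loopDepth = 0 :=
    fun g => by rw [loopDepth_map, loopDepth_addGradient]
  have hstep : ∀ g : G, (seq (tickProg (T g) (L g) g) (stepAlongGradient (d := d) g)).length ≤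
      7 * m + 4 + d * 2 := fun g =>
    add_le_add (length_tickProg _ _ g).1.le (length_forEach_le fun k => le_rfl)
  have hstep0 : ∀ g : G, (seq (tickProg (T g) (L g) g)
      (stepAlongGradient (d := d) g)).loopDepth = 0 := fun g => by
    have h1 := (length_tickProg (d := d) (T g) (L g) g).2
    have h2 : (stepAlongGradient (d := d) (m := m) g).loopDepth = 0 :=
      loopDepth_forEach fun k => rfl
    simp only [loopDepth, h1, h2, max_self]
  have herr : ∀ g : G, (addError (d := d) (m := m) g).length ≤ d * 2 + 4 := fun g => by
    have := length_forEach_le (B := 2) (f := fun k : Fin d =>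
      (seq (mul pT (pA k) (pX g k)) (add pS pS pT) : Prog d (ParWork d m G))) fun k => le_rfl
    simp only [addError, Prog.length]
    omega
  have herr0 : ∀ g : G, (addError (d := d) (m := m) g).loopDepth = 0 := fun g => by
    have := loopDepth_forEach (f := fun k : Fin d =>
      (seq (mul pT (pA k) (pX g k)) (add pS pS pT) : Prog d (ParWork d m G))) fun k => rfl
    simp only [addError, loopDepth, this, max_self]
  have hsel : ∀ g : G, (selectRun (d := d) (m := m) θ g).length ≤ d * 2 + 3 := fun g => by
    have := length_forEach_le (B := 2) (f := fun k : Fin d =>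
      (seq (const pS 0) (add (Sum.inl k) (pX g k) pS) : Prog d (ParWork d m G))) fun k => le_rfl
    simp only [selectRun, Prog.length]
    omega
  have hsel0 : ∀ g : G, (selectRun (d := d) (m := m) θ g).loopDepth = 0 := fun g => by
    have := loopDepth_forEach (f := fun k : Fin d =>
      (seq (const pS 0) (add (Sum.inl k) (pX g k) pS) : Prog d (ParWork d m G))) fun k => rfl
    simp only [selectRun, loopDepth, this, max_self]
  have a1 := length_forList_le l hcopy
  have a2 := length_forList_le l hzero
  have a3 := length_forList_le l hadd
  have a4 := length_forList_le l hstep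
  have a5 := length_forList_le l herr
  have a6 := length_forList_le l hsel
  have b1 := loopDepth_forList l fun g => (hcopy0 g).le
  have b2 := loopDepth_forList l fun g => (hzero0 g).le
  have b3 := loopDepth_forList l fun g => (hadd0 g).le
  have b4 := loopDepth_forList l fun g => (hstep0 g).le
  have b5 := loopDepth_forList l fun g => (herr0 g).le
  have b6 := loopDepth_forList l fun g => (hsel0 g).le
  rw [hl] at a1 a2 a3 a4 a5 a6
  simp only [space, parallelProg, parStep, sampleLoop, Prog.length, loopDepth, Fintype.card_sum,
    Fintype.card_prod, Fintype.card_fin]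
  have hd : ∀ x1 x2 x3 x4 x5 x6 : ℕ, x1 ≤ 0 → x2 ≤ 0 → x3 ≤ 0 → x4 ≤ 0 → x5 ≤ 0 → x6 ≤ 0 →
      max x1 (max (max x2 (max (max 0 x3 + 1) x4) + 1) (max (max 0 x5 + 1) x6)) ≤ 2 := by
    intros; omega
  have := hd _ _ _ _ _ _ b1 b2 b3 b4 b5 b6
  nlinarith

end Parallel

end StochBSLS

namespace StochBSLS

/-! ### Testing candidates on fresh samples -/

section Testing

open ProbabilityTheory Finset

variable {d m : ℕ} [NeZero m] {𝒟 : Measure (Sample d)} [IsProbabilityMeasure 𝒟] {xopt : Vec d}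
  {β : Bands m} {u : OrthonormalBasis (Fin d) ℝ (Vec d)} {lam : Fin d → ℝ} {band : Fin d → Fin m}
  {C : ℝ}

lemma exp_neg_le_quadratic {x : ℝ} (hx : 0 ≤ x) : Real.exp (-x) ≤ 1 - x + x ^ 2 / 2 := by
  have h1 := Real.quadratic_le_exp_of_nonneg hx
  have h2 : 0 < 1 - x + x ^ 2 / 2 := by nlinarith [sq_nonneg (x - 1)]
  rw [Real.exp_neg, inv_le_iff_one_le_mul₀ (Real.exp_pos x)]
  have h3 := mul_le_mul_of_nonneg_left h1 h2.le
  nlinarith [sq_nonneg (x ^ 2)]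

/-- The lower tail of a sum of nonnegative independent variables with bounded kurtosis. -/
lemma pi_sum_lt_le {α : Type*} [MeasurableSpace α] {μ : Measure α} [IsProbabilityMeasure μ]
    {Z : α → ℝ} (hZ : Measurable Z) (h0 : ∀ x, 0 ≤ Z x) (hi : Integrable Z μ)
    (hi2 : Integrable (fun x => Z x ^ 2) μ) (hC : 0 < C) (hμ : 0 < ∫ x, Z x ∂μ)
    (hkur : ∫ x, Z x ^ 2 ∂μ ≤ C * (∫ x, Z x ∂μ) ^ 2) {S : ℕ} {θ : ℝ}
    (hθ : θ ≤ S * (∫ x, Z x ∂μ) / 2) :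
    Measure.pi (fun _ : Fin S => μ) {y | ∑ j, Z (y j) < θ} ≤
      ENNReal.ofReal (Real.exp (-(S / (8 * C)))) := by
  set E := ∫ x, Z x ∂μ with hE
  -- This minimizes the exponent `S * (-(t * E) / 2 + t ^ 2 * C * E ^ 2 / 2)`, with minimum `-S / (8
  -- * C)`.
  set t := 1 / (2 * C * E) with ht
  have ht0 : 0 < t := by positivity
  have hexpi : Integrable (fun x => Real.exp (-(t * Z x))) μ := by
    refine (integrable_const (1 : ℝ)).mono' (by fun_prop) (ae_of_all _ fun x => ?_)
    rw [Real.norm_eq_abs, abs_of_pos (Real.exp_pos _), Real.exp_le_one_iff]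
    have := mul_nonneg ht0.le (h0 x)
    linarith
  -- As `Z` is nonnegative, `exp (-t Z)` is at most its quadratic Taylor polynomial; the second
  -- moment then suffices and no bound on `Z` is needed.
  have hmgf : ∫ x, Real.exp (-(t * Z x)) ∂μ ≤ Real.exp (-(t * E) + t ^ 2 * (C * E ^ 2) / 2) := by
    have h1 : ∫ x, Real.exp (-(t * Z x)) ∂μ ≤ ∫ x, (1 - t * Z x + t ^ 2 / 2 * Z x ^ 2) ∂μ := by
      refine integral_mono hexpi (((integrable_const _).sub (hi.const_mul t)).add
        (hi2.const_mul _)) fun x => ?_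
      have := exp_neg_le_quadratic (mul_nonneg ht0.le (h0 x))
      simp only
      linarith [mul_pow t (Z x) 2]
    have h2 : ∫ x, (1 - t * Z x + t ^ 2 / 2 * Z x ^ 2) ∂μ =
        1 - t * E + t ^ 2 / 2 * ∫ x, Z x ^ 2 ∂μ := by
      have i1 : Integrable (fun x => 1 - t * Z x) μ := (integrable_const _).sub (hi.const_mul t)
      rw [integral_add i1 (hi2.const_mul _), integral_sub (integrable_const _) (hi.const_mul t),
        integral_const_mul, integral_const_mul]
      simp [hE]
    have h3 := mul_le_mul_of_nonneg_left hkur (show 0 ≤ t ^ 2 / 2 by positivity)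
    have h4 := Real.add_one_le_exp (-(t * E) + t ^ 2 * (C * E ^ 2) / 2)
    linarith
  have hprod : ∫⁻ y, ENNReal.ofReal (Real.exp (t * θ) * ∏ j, Real.exp (-(t * Z (y j))))
      ∂(Measure.pi fun _ : Fin S => μ) =
      ENNReal.ofReal (Real.exp (t * θ) * (∫ x, Real.exp (-(t * Z x)) ∂μ) ^ S) := by
    rw [← ofReal_integral_eq_lintegral_ofReal
      ((Integrable.fintype_prod (fun _ => hexpi)).const_mul _)
      (ae_of_all _ fun y => by positivity), integral_const_mul,
      integral_fintype_prod_eq_pow (ι := Fin S) (fun x => Real.exp (-(t * Z x))), Fintype.card_fin]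
  have hexponent : Real.exp (t * θ) * (∫ x, Real.exp (-(t * Z x)) ∂μ) ^ S ≤
      Real.exp (-(S / (8 * C))) := by
    have h1 : 0 ≤ ∫ x, Real.exp (-(t * Z x)) ∂μ := integral_nonneg fun x => (Real.exp_pos _).le
    calc Real.exp (t * θ) * (∫ x, Real.exp (-(t * Z x)) ∂μ) ^ S
        ≤ Real.exp (t * (S * E / 2)) * Real.exp (-(t * E) + t ^ 2 * (C * E ^ 2) / 2) ^ S := by
          gcongr
      _ = Real.exp (-(S / (8 * C))) := by
          rw [← Real.exp_nat_mul, ← Real.exp_add]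
          congr 1
          rw [ht]; field_simp; ring
  refine le_trans ?_ ((hprod.le).trans (ENNReal.ofReal_le_ofReal hexponent))
  have hms : MeasurableSet {y : Fin S → α | ∑ j, Z (y j) < θ} :=
    measurableSet_lt (by fun_prop) measurable_const
  rw [← lintegral_indicator_one hms]
  refine lintegral_mono fun y => ?_
  by_cases hy : y ∈ {y : Fin S → α | ∑ j, Z (y j) < θ}
  · rw [Set.indicator_of_mem hy, Pi.one_apply, ← ENNReal.ofReal_one]
    refine ENNReal.ofReal_le_ofReal ?_
    rw [← Real.exp_sum, ← Real.exp_add, Real.one_le_exp_iff, sum_neg_distrib, ← mul_sum]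
    have : ∑ j, Z (y j) < θ := hy
    nlinarith
  · rw [Set.indicator_of_notMem hy]; exact zero_le

/-- The squared error on one sample. -/
def lossSq (x : Vec d) (s : Sample d) : ℝ := (inner ℝ s.1 x - s.2) ^ 2

lemma measurable_lossSq (x : Vec d) : Measurable (lossSq x) := by
  unfold lossSq; fun_prop

lemma measurable_sqError (S : ℕ) :
    Measurable fun q : Vec d × (Fin S → Sample d) => sqError q.2 q.1 := by
  unfold sqError; fun_prop

lemma Problem.lossSq_ae (hp : Problem 𝒟 xopt β u lam band C) (x : Vec d) :
    lossSq x =ᵐ[𝒟] fun z => inner ℝ (x - xopt) z.1 ^ 2 := by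
  filter_upwards [hp.label] with z hz
  rw [lossSq, hz, ← inner_sub_right, real_inner_comm]

lemma Problem.integrable_lossSq (hp : Problem 𝒟 xopt β u lam band C) (x : Vec d) :
    Integrable (lossSq x) 𝒟 := by
  refine (integrable_inner_two hp.fourth_moment (x - xopt) (x - xopt)).congr ?_
  filter_upwards [hp.lossSq_ae x] with z hz
  rw [hz]; ring

lemma integral_lossSq (x : Vec d) : ∫ s, lossSq x s ∂𝒟 = 2 * objective 𝒟 x := by
  rw [objective, integral_const_mul, ← mul_assoc]
  norm_num [lossSq]

lemma Problem.integrable_lossSq_sq (hp : Problem 𝒟 xopt β u lam band C) (x : Vec d) :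
    Integrable (fun s => lossSq x s ^ 2) 𝒟 := by
  refine (integrable_inner_four hp.fourth_moment (x - xopt) (x - xopt) (x - xopt)
    (x - xopt)).congr ?_
  filter_upwards [hp.lossSq_ae x] with z hz
  rw [hz]; ring

lemma Problem.integral_lossSq_sq_le (hp : Problem 𝒟 xopt β u lam band C) (x : Vec d) :
    ∫ s, lossSq x s ^ 2 ∂𝒟 ≤ C * (∫ s, lossSq x s ∂𝒟) ^ 2 := by
  have h1 : ∫ s, lossSq x s ^ 2 ∂𝒟 = ∫ z, inner ℝ (x - xopt) z.1 ^ 4 ∂𝒟 := by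
    refine integral_congr_ae ?_
    filter_upwards [hp.lossSq_ae x] with z hz
    rw [hz]; ring
  rw [h1, integral_congr_ae (hp.lossSq_ae x)]
  exact hp.kurtosis _

lemma Problem.lintegral_sqError (hp : Problem 𝒟 xopt β u lam band C) (x : Vec d) (S : ℕ) :
    ∫⁻ y, ENNReal.ofReal (sqError y x) ∂(Measure.pi fun _ : Fin S => 𝒟) =
      ENNReal.ofReal (2 * S) * ENNReal.ofReal (objective 𝒟 x) := by
  have hi : ∀ j : Fin S, Integrable (fun y : Fin S → Sample d => lossSq x (y j))
      (Measure.pi fun _ => 𝒟) := fun j =>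
    integrable_comp_eval (μ := fun _ : Fin S => 𝒟) (hp.integrable_lossSq x)
  have h1 : ∫ y, sqError y x ∂(Measure.pi fun _ : Fin S => 𝒟) = S * (2 * objective 𝒟 x) := by
    have e : ∀ y : Fin S → Sample d, sqError y x = ∑ j, lossSq x (y j) := fun y => rfl
    simp_rw [e]
    rw [integral_finsetSum _ fun j _ => hi j]
    have : ∀ j : Fin S, ∫ y : Fin S → Sample d, lossSq x (y j) ∂(Measure.pi fun _ => 𝒟) =
        2 * objective 𝒟 x := fun j => by
      rw [← integral_lossSq]
      exact integral_comp_eval (μ := fun _ : Fin S => 𝒟) (i := j)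
        (hp.integrable_lossSq x).aestronglyMeasurable
    simp [this]
  have hi' : Integrable (fun y : Fin S → Sample d => sqError y x) (Measure.pi fun _ => 𝒟) :=
    integrable_finsetSum _ fun j _ => hi j
  rw [← ofReal_integral_eq_lintegral_ofReal hi' (ae_of_all _ fun y => sum_nonneg fun j _ => sq_nonneg _), h1,
    ← ENNReal.ofReal_mul (by positivity)]
  congr 1; ring

variable {off : ℕ} {X : (ℕ → Sample d) → Vec d}

/-- A candidate with small mean objective passes the test. -/
lemma Problem.measure_test_ge_le (hp : Problem 𝒟 xopt β u lam band C) (hX : Measurable X)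
    (hdep : ∀ z z', (∀ i < off, z i = z' i) → X z = X z') {S : ℕ} (hS : 0 < S) {ε δ : ℝ}
    (hε : 0 < ε) (hE : ∫⁻ z, ENNReal.ofReal (objective 𝒟 (X z)) ∂(sampleStream 𝒟) ≤
      ENNReal.ofReal (ε * δ / 4)) :
    sampleStream 𝒟 {z | S * ε ≤ sqError (block S off z) (X z)} ≤ ENNReal.ofReal (δ / 2) := by
  have hS' : (0 : ℝ) < S := by exact_mod_cast hS
  have hmeas : Measurable (Function.uncurry fun (x : Vec d) (y : Fin S → Sample d) =>
      ENNReal.ofReal (sqError y x)) := (measurable_sqError S).ennreal_ofReal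
  have h1 := lintegral_block (𝒟 := 𝒟) hX hdep S hmeas
  simp only [hp.lintegral_sqError] at h1
  have h0 : Measurable fun z => ENNReal.ofReal (objective 𝒟 (X z)) :=
    (hp.measurable_objective.comp hX).ennreal_ofReal
  rw [lintegral_const_mul _ h0] at h1
  have h2 : Measurable fun z => ENNReal.ofReal (sqError (block S off z) (X z)) :=
    ((measurable_sqError S).comp (hX.prodMk (measurable_block S off))).ennreal_ofReal
  have hSε : 0 < S * ε := by positivity
  have h3 := mul_meas_ge_le_lintegral₀ (μ := sampleStream 𝒟) h2.aemeasurable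
    (ENNReal.ofReal (S * ε))
  rw [h1] at h3
  have h4 := h3.trans (mul_le_mul_right hE (ENNReal.ofReal (2 * S)))
  rw [← ENNReal.ofReal_mul (by positivity)] at h4
  -- Markov's inequality: the mean of the test error is `2 S` times the mean objective, a fraction
  -- `δ / 2` of the threshold `S ε`.
  have e : 2 * S * (ε * δ / 4) = S * ε * (δ / 2) := by ring
  rw [e, ENNReal.ofReal_mul (p := S * ε) hSε.le] at h4
  have h5 := (ENNReal.mul_le_mul_iff_right (ENNReal.ofReal_pos.2 hSε).ne'
    ENNReal.ofReal_ne_top).1 h4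
  refine le_trans (measure_mono fun z hz => ?_) h5
  exact ENNReal.ofReal_le_ofReal hz

/-- A candidate with large objective does not pass the test. -/
lemma Problem.measure_test_lt_le (hp : Problem 𝒟 xopt β u lam band C) (hC : 0 < C)
    (hX : Measurable X) (hdep : ∀ z z', (∀ i < off, z i = z' i) → X z = X z') (S : ℕ) {ε : ℝ}
    (hε : 0 < ε) :
    sampleStream 𝒟 {z | ε < objective 𝒟 (X z) ∧ sqError (block S off z) (X z) < S * ε} ≤
      ENNReal.ofReal (Real.exp (-(S / (8 * C)))) := by
  set A : Set (Vec d × (Fin S → Sample d)) :=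
    {q | ε < objective 𝒟 q.1 ∧ sqError q.2 q.1 < S * ε} with hA
  have hAm : MeasurableSet A :=
    (measurableSet_lt measurable_const (hp.measurable_objective.comp measurable_fst)).inter
      (measurableSet_lt (measurable_sqError S) measurable_const)
  have hF : Measurable (Function.uncurry fun (x : Vec d) (y : Fin S → Sample d) =>
      A.indicator (1 : Vec d × (Fin S → Sample d) → ENNReal) (x, y)) := measurable_const.indicator hAm
  have h1 := lintegral_block (𝒟 := 𝒟) hX hdep S hF
  have hm : MeasurableSet {z : ℕ → Sample d | (X z, block S off z) ∈ A} :=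
    (hX.prodMk (measurable_block S off)) hAm
  have h2 : sampleStream 𝒟 {z | (X z, block S off z) ∈ A} =
      ∫⁻ z, A.indicator (1 : Vec d × (Fin S → Sample d) → ENNReal) (X z, block S off z) ∂(sampleStream 𝒟) := by
    rw [← lintegral_indicator_one hm]; rfl
  change sampleStream 𝒟 {z | (X z, block S off z) ∈ A} ≤ _
  rw [h2, h1]
  have h3 : ∀ x : Vec d, ∫⁻ y, A.indicator (1 : Vec d × (Fin S → Sample d) → ENNReal) (x, y)
      ∂(Measure.pi fun _ : Fin S => 𝒟) ≤ ENNReal.ofReal (Real.exp (-(S / (8 * C)))) := by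
    intro x
    by_cases hx : ε < objective 𝒟 x
    -- The squared error has mean `2 * objective 𝒟 x > 2 ε`, so the threshold `S ε` is below half of
    -- the expected sum.
    · have h4 := pi_sum_lt_le (μ := 𝒟) (Z := lossSq x) (C := C) (S := S) (θ := S * ε)
        (measurable_lossSq x) (fun s => sq_nonneg _)
        (hp.integrable_lossSq x) (hp.integrable_lossSq_sq x) hC
        (by rw [integral_lossSq]; linarith) (hp.integral_lossSq_sq_le x) (by
          rw [integral_lossSq]
          have : (S : ℝ) * ε ≤ S * objective 𝒟 x := by gcongr
          linarith)
      have hms : MeasurableSet {y : Fin S → Sample d | ∑ j, lossSq x (y j) < S * ε} :=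
        measurableSet_lt (Finset.measurable_sum _ fun j _ =>
          (measurable_lossSq x).comp (measurable_pi_apply j)) measurable_const
      refine le_trans ?_ h4
      rw [← lintegral_indicator_one hms]
      refine lintegral_mono fun y => ?_
      by_cases hy : (x, y) ∈ A
      · rw [Set.indicator_of_mem hy, Set.indicator_of_mem (by exact hy.2)]
        exact le_rfl
      · rw [Set.indicator_of_notMem hy]; exact zero_le
    · have : ∀ y : Fin S → Sample d, A.indicator (1 : Vec d × (Fin S → Sample d) → ENNReal) (x, y) = 0 := fun y =>
        Set.indicator_of_notMem (fun h => hx h.1) _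
      simp [this]
  calc _ ≤ ∫⁻ _, ENNReal.ofReal (Real.exp (-(S / (8 * C)))) ∂(sampleStream 𝒟) :=
        lintegral_mono fun z => h3 (X z)
    _ = _ := by simp

/-- The test of finitely many candidates, one of which has small mean objective. -/
theorem Problem.measure_selection_le (hp : Problem 𝒟 xopt β u lam band C) (hC : 0 < C) {G : Type}
    [Fintype G] {X : G → (ℕ → Sample d) → Vec d} (hX : ∀ g, Measurable (X g))
    (hdep : ∀ g z z', (∀ i < off, z i = z' i) → X g z = X g z') {S : ℕ} (hS : 0 < S) {ε δ : ℝ}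
    (hε : 0 < ε) (hδ : 0 < δ) {g₀ : G}
    (hE : ∫⁻ z, ENNReal.ofReal (objective 𝒟 (X g₀ z)) ∂(sampleStream 𝒟) ≤
      ENNReal.ofReal (ε * δ / 4))
    (hexp : Fintype.card G * Real.exp (-(S / (8 * C))) ≤ δ / 2) :
    sampleStream 𝒟 {z | ¬ (sqError (block S off z) (X g₀ z) < S * ε ∧
      ∀ g, sqError (block S off z) (X g z) < S * ε → objective 𝒟 (X g z) ≤ ε)} ≤
        ENNReal.ofReal δ := by
  have hsub : {z | ¬ (sqError (block S off z) (X g₀ z) < S * ε ∧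
      ∀ g, sqError (block S off z) (X g z) < S * ε → objective 𝒟 (X g z) ≤ ε)} ⊆
      {z | S * ε ≤ sqError (block S off z) (X g₀ z)} ∪
        ⋃ g, {z | ε < objective 𝒟 (X g z) ∧ sqError (block S off z) (X g z) < S * ε} := by
    intro z hz
    by_cases h : sqError (block S off z) (X g₀ z) < S * ε
    · right
      have hz' : ∃ g, sqError (block S off z) (X g z) < S * ε ∧ ε < objective 𝒟 (X g z) := by
        by_contra! h'
        exact hz ⟨h, h'⟩
      obtain ⟨g, h1, h2⟩ := hz'
      exact Set.mem_iUnion.2 ⟨g, h2, h1⟩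
    · left; exact not_lt.1 h
  refine (measure_mono hsub).trans ((measure_union_le _ _).trans ?_)
  have h1 := hp.measure_test_ge_le (hX g₀) (hdep g₀) hS hε hE
  have h2 : sampleStream 𝒟 (⋃ g, {z | ε < objective 𝒟 (X g z) ∧
      sqError (block S off z) (X g z) < S * ε}) ≤ ENNReal.ofReal (δ / 2) := by
    refine (measure_iUnion_fintype_le _ _).trans ?_
    refine (Finset.sum_le_sum fun g _ =>
      hp.measure_test_lt_le hC (hX g) (hdep g) S hε).trans ?_
    rw [sum_const, card_univ, nsmul_eq_mul, ← ENNReal.ofReal_natCast,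
      ← ENNReal.ofReal_mul (Nat.cast_nonneg _)]
    exact ENNReal.ofReal_le_ofReal hexp
  refine (add_le_add h1 h2).trans ?_
  rw [← ENNReal.ofReal_add (by linarith) (by linarith), add_halves]

end Testing

end StochBSLS

namespace StochBSLS

/-! ### Unknown bands -/

section Guesses

open ProbabilityTheory Finset

variable {m : ℕ} [NeZero m]

/-- A guess of the tops and of the condition numbers of the bands, up to constant factors. -/
abbrev Guess (m M : ℕ) := Fin m → Fin (M + 2) × Fin (M + 2)

variable {M : ℕ}

def guessTop (μ₁ : ℝ) (g : Guess m M) (i : Fin m) : ℝ := μ₁ * Real.exp ((g i).1 : ℕ)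

def guessCond (g : Guess m M) (i : Fin m) : ℝ := Real.exp ((g i).2 : ℕ)

/-- The guessed tops can have ratios up to `e` times the global condition number; its logarithm is
therefore replaced by `lg + 1`. -/
def guessSteps (lg Λ : ℝ) (g : Guess m M) (i : Fin m) : ℕ :=
  if i = 0 then ⌈guessCond g i * Λ⌉₊ else ⌈8 * (guessCond g i * (lg + 1))⌉₊

lemma exp_ceil_log {y : ℝ} (hy : 1 ≤ y) :
    y ≤ Real.exp (⌈Real.log y⌉₊ : ℕ) ∧ Real.exp (⌈Real.log y⌉₊ : ℕ) ≤ Real.exp 1 * y := by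
  have h0 : 0 < y := by linarith
  have h1 := Nat.le_ceil (Real.log y)
  have h2 := (Nat.ceil_lt_add_one (Real.log_nonneg hy)).le
  refine ⟨(Real.log_le_iff_le_exp h0).1 h1, ?_⟩
  calc Real.exp (⌈Real.log y⌉₊ : ℕ) ≤ Real.exp (1 + Real.log y) := Real.exp_le_exp.2 (by linarith)
    _ = Real.exp 1 * y := by rw [Real.exp_add, Real.exp_log h0]

/-- The guess approximates the bands. -/
structure Fits (β : Bands m) (g : Guess m M) : Prop where
  le_top : ∀ i, β.hi i ≤ guessTop (β.lo 0) g i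
  top_le : ∀ i, guessTop (β.lo 0) g i ≤ Real.exp 1 * β.hi i
  le_cond : ∀ i, Real.exp 1 * β.cond i ≤ guessCond g i
  cond_le : ∀ i, guessCond g i ≤ Real.exp 1 ^ 2 * β.cond i
  mono : Monotone (guessTop (β.lo 0) g)

/-- Each top and each condition number is rounded up to a power of `e`, relative to `β.lo 0` for the
tops. The exponents are at most `M`, and the additional `1` for the condition numbers explains the
range `M + 2`. -/
lemma Bands.exists_fits (β : Bands m) (hM : Real.log β.globalCond ≤ M) :
    ∃ g : Guess m M, Fits β g := by
  have hμ := β.lo_pos 0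
  have hy : ∀ i, 1 ≤ β.hi i / β.lo 0 := fun i =>
    (one_le_div hμ).2 ((β.lo_zero_le i).trans (β.lo_le_hi i))
  have hk : ∀ i, ⌈Real.log (β.hi i / β.lo 0)⌉₊ < M + 2 := fun i => by
    have h1 : β.hi i / β.lo 0 ≤ β.globalCond :=
      div_le_div_of_nonneg_right (β.hi_mono le_top) hμ.le
    have h2 := Real.log_le_log (by have := hy i; linarith) h1
    have := Nat.ceil_le.2 (h2.trans hM)
    omega
  have hj : ∀ i, ⌈Real.log (β.cond i)⌉₊ + 1 < M + 2 := fun i => by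
    have h2 := Real.log_le_log (by have := β.one_le_cond i; linarith) (β.cond_le_globalCond i)
    have := Nat.ceil_le.2 (h2.trans hM)
    omega
  refine ⟨fun i => (⟨_, hk i⟩, ⟨_, hj i⟩), fun i => ?_, fun i => ?_, fun i => ?_, fun i => ?_,
    fun i j h => ?_⟩
  · have := (exp_ceil_log (hy i)).1
    rw [div_le_iff₀ hμ] at this
    rw [guessTop, mul_comm]; exact this
  · have := (exp_ceil_log (hy i)).2
    rw [← mul_div_assoc, le_div_iff₀ hμ] at this
    rw [guessTop, mul_comm]; exact this
  · have := (exp_ceil_log (β.one_le_cond i)).1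
    simp only [guessCond]
    push_cast
    rw [Real.exp_add, mul_comm]
    gcongr
  · have := (exp_ceil_log (β.one_le_cond i)).2
    simp only [guessCond]
    push_cast
    rw [Real.exp_add, pow_two, mul_comm, mul_assoc]
    gcongr
  · simp only [guessTop]
    refine mul_le_mul_of_nonneg_left (Real.exp_le_exp.2 (Nat.cast_le.2 (Nat.ceil_mono
      (Real.log_le_log (by have := hy i; linarith) ?_)))) hμ.le
    exact div_le_div_of_nonneg_right (β.hi_mono h) hμ.le

variable {β : Bands m} {g : Guess m M} {lg Λ : ℝ}

lemma exp_one_sq_le : Real.exp 1 ^ 2 ≤ 15 / 2 := by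
  have h1 := Real.exp_one_lt_d9
  have h2 := Real.exp_pos 1
  nlinarith

/-- The guessed bands may overlap and even have equal tops. The recursion only needs monotone tops
with bounded ratios, so the contraction theorem applies to the guess as it stands. -/
lemma Fits.regime (h : Fits β g) (hm : 3 * (m : ℝ) ≤ Real.log β.globalCond) :
    Regime (guessTop (β.lo 0) g) (guessCond g) (guessSteps (Real.log β.globalCond) Λ g)
      (Real.exp 1 * β.globalCond) := by
  have hμ := β.lo_pos 0
  have hκ : 0 < β.globalCond := div_pos (β.hi_pos _) hμ
  have hlog : Real.log (Real.exp 1 * β.globalCond) = Real.log β.globalCond + 1 := by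
    rw [Real.log_mul (Real.exp_pos 1).ne' hκ.ne', Real.log_exp, add_comm]
  refine ⟨fun i => (β.hi_pos i).trans_le (h.le_top i), h.mono, fun i => Real.one_le_exp (by positivity),
    fun p q => ?_, by rw [hlog]; linarith, fun p hp => ?_⟩
  · have h1 := (h.top_le p).trans (mul_le_mul_of_nonneg_left (β.hi_mono (_root_.le_top : p ≤ ⊤)) (Real.exp_pos 1).le)
    have h2 : β.lo 0 ≤ guessTop (β.lo 0) g q :=
      ((β.lo_zero_le q).trans (β.lo_le_hi q)).trans (h.le_top q)
    rw [Bands.globalCond, ← mul_div_assoc]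
    exact div_le_div₀ (mul_nonneg (Real.exp_pos 1).le (β.hi_pos _).le) h1 hμ h2
  · have : p ≠ 0 := fun e => by rw [e] at hp; simp at hp
    rw [hlog, guessSteps, if_neg this]
    exact Nat.le_ceil _

/-- The factor `8 * e ^ 2 ≤ 60` with `lg + 1 ≤ 4 / 3 * lg` gives `80`; the rest up to `100` covers
the rounding and the additional `1`. -/
lemma Fits.steps_succ_le (h : Fits β g) (hlg : 3 ≤ lg) (hΛ : 2 ≤ Λ) (i : Fin m) :
    (guessSteps lg Λ g i : ℝ) + 1 ≤ 100 * β.cond i * (if i = 0 then Λ else lg) := by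
  have h1 := h.cond_le i
  have h2 := exp_one_sq_le
  have hκ := β.one_le_cond i
  have h3 : guessCond g i ≤ 15 / 2 * β.cond i := h1.trans (by gcongr)
  have h0 : 0 ≤ guessCond g i := (Real.exp_pos _).le
  rw [guessSteps]
  split_ifs with hi
  · have h4 := (Nat.ceil_lt_add_one (a := guessCond g i * Λ) (by positivity)).le
    have h5 := mul_le_mul_of_nonneg_right h3 (show 0 ≤ Λ by linarith)
    nlinarith
  · have h4 := (Nat.ceil_lt_add_one (a := 8 * (guessCond g i * (lg + 1))) (by positivity)).le
    have h5 := mul_le_mul_of_nonneg_right h3 (show 0 ≤ lg + 1 by linarith)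
    nlinarith

lemma Fits.prod_steps_succ_le (h : Fits β g) (hlg : 3 ≤ lg) (hΛ : 2 ≤ Λ) :
    ((∏ i, (guessSteps lg Λ g i + 1) : ℕ) : ℝ) ≤ 100 ^ m * β.condProd * lg ^ (m - 1) * Λ := by
  push_cast
  calc ∏ i, ((guessSteps lg Λ g i : ℝ) + 1)
      ≤ ∏ i, (100 * β.cond i * (if i = 0 then Λ else lg)) :=
        prod_le_prod (fun i _ => by positivity) fun i _ => h.steps_succ_le hlg hΛ i
    _ = _ := by
        rw [prod_mul_distrib, prod_mul_distrib, prod_ite_zero, Bands.condProd]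
        simp only [prod_const, card_univ, Fintype.card_fin]; ring

/-- This is the quantity in the noise condition of `Regime.contraction`. It is free of `Λ`, and so
the batch size of the search does not depend on the accuracy. -/
lemma Fits.cond_mul_prod_steps_le (h : Fits β g) (hlg : 3 ≤ lg) (hΛ : 2 ≤ Λ) :
    guessCond g 0 * ∏ j ∈ Ioi (0 : Fin m), (guessSteps lg Λ g j : ℝ) ≤
      100 ^ m * β.condProd * lg ^ (m - 1) := by
  have e : Ioi (0 : Fin m) = univ.erase 0 := by
    ext i; simp [Fin.pos_iff_ne_zero']
  calc guessCond g 0 * ∏ j ∈ Ioi (0 : Fin m), (guessSteps lg Λ g j : ℝ)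
      = ∏ i, (if i = 0 then guessCond g 0 else (guessSteps lg Λ g i : ℝ)) := by
        rw [← mul_prod_erase univ _ (mem_univ (0 : Fin m)), if_pos rfl, e]
        congr 1
        exact prod_congr rfl fun i hi => (if_neg (ne_of_mem_erase hi)).symm
    _ ≤ ∏ i, (100 * β.cond i * (if i = 0 then 1 else lg)) := by
        refine prod_le_prod (fun i _ => ?_) fun i _ => ?_
        · split_ifs
          · exact (Real.exp_pos _).le
          · positivity
        · split_ifs with hi
          · subst hi
            have h1 := h.cond_le 0
            have h2 := exp_one_sq_le
            have hκ := β.one_le_cond 0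
            have h3 : guessCond g 0 ≤ 15 / 2 * β.cond 0 := h1.trans (by gcongr)
            linarith
          · have := h.steps_succ_le hlg hΛ i
            rw [if_neg hi] at this
            linarith
    _ = _ := by
        rw [prod_mul_distrib, prod_mul_distrib, prod_ite_zero, Bands.condProd]
        simp only [prod_const, card_univ, Fintype.card_fin]; ring

variable {d : ℕ} {𝒟 : Measure (Sample d)} [IsProbabilityMeasure 𝒟] {xopt : Vec d}
  {u : OrthonormalBasis (Fin d) ℝ (Vec d)} {lam : Fin d → ℝ} {band : Fin d → Fin m} {C : ℝ}

/-- A top that is too large by up to `e` raises the lower end of the guessed band; the factor `e`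
built into the guessed condition number compensates for this. -/
lemma Problem.bandCover_guess (hp : Problem 𝒟 xopt β u lam band C) (h : Fits β g) :
    BandCover lam band (guessTop (β.lo 0) g) (guessCond g) := fun k => by
  have hk := hp.mem_band k
  refine ⟨?_, hk.2.trans (h.le_top _)⟩
  have h1 := h.top_le (band k)
  have h2 := h.le_cond (band k)
  have hc := β.one_le_cond (band k)
  have he := Real.exp_pos 1
  refine le_trans ?_ hk.1
  rw [div_le_iff₀ (show 0 < guessCond g (band k) from Real.exp_pos _)]
  have e : β.cond (band k) * β.lo (band k) = β.hi (band k) :=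
    div_mul_cancel₀ _ (β.lo_pos _).ne'
  calc guessTop (β.lo 0) g (band k) ≤ Real.exp 1 * β.hi (band k) := h1
    _ = β.lo (band k) * (Real.exp 1 * β.cond (band k)) := by rw [← e]; ring
    _ ≤ β.lo (band k) * guessCond g (band k) :=
        mul_le_mul_of_nonneg_left h2 (β.lo_pos _).le

/-- The run of a guess that fits reaches a small mean objective. -/
theorem Problem.lintegral_objective_runOutput_le (hp : Problem 𝒟 xopt β u lam band C)
    (h : Fits β g) (hC : 0 ≤ C) (hΛ : 2 ≤ Λ) {n N : ℕ} (hn : 0 < n)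
    (hnA : 40 * (m * (C * d) * (100 ^ m * β.condProd *
      Real.log β.globalCond ^ (m - 1))) ≤ n)
    (hN : ∏ i, (guessSteps (Real.log β.globalCond) Λ g i + 1) ≤ N) {x₀ : Vec d} {R : ℝ}
    (hR : ‖x₀ - xopt‖ ≤ R) :
    ∫⁻ z, ENNReal.ofReal (objective 𝒟 (runOutput n N (guessSteps (Real.log β.globalCond) Λ g)
      (guessTop (β.lo 0) g) x₀ z)) ∂(sampleStream 𝒟) ≤
      ENNReal.ofReal (β.hi ⊤ * Real.exp (-Λ) * R ^ 2) := by
  have hL := β.hi_pos ⊤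
  have hm : 0 < m := NeZero.pos m
  have hm3 : 3 * (m : ℝ) ≤ Real.log β.globalCond := by have := hp.bands_le_log; linarith
  have hm1 : (1 : ℝ) ≤ m := by exact_mod_cast hm
  have hreg := h.regime (Λ := Λ) hm3
  set T := guessSteps (Real.log β.globalCond) Λ g with hT
  have hκ0 : 0 < guessCond g 0 := Real.exp_pos _
  have hT0 : guessCond g 0 * Λ ≤ T 0 := by
    rw [hT, guessSteps, if_pos rfl]; exact Nat.le_ceil _
  have hT0pos : T 0 ≠ 0 := by
    intro e
    rw [e, Nat.cast_zero] at hT0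
    have : 0 < guessCond g 0 * Λ := by positivity
    linarith
  have hn' : (0 : ℝ) < n := by exact_mod_cast hn
  -- The dimension replaces the largest multiplicity of a band, which the program does not know.
  have hγ : m * (C * d / n) * ∏ j ∈ Ioi (0 : Fin m), (T j : ℝ) ≤ 1 / (40 * guessCond g 0) := by
    have h1 := h.cond_mul_prod_steps_le (lg := Real.log β.globalCond) (by linarith) hΛ
    rw [← hT] at h1
    rw [← mul_div_assoc, div_mul_eq_mul_div, div_le_div_iff₀ hn' (by positivity), one_mul]
    refine le_trans ?_ hnA
    calc m * (C * d) * (∏ j ∈ Ioi (0 : Fin m), (T j : ℝ)) * (40 * guessCond g 0)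
        = 40 * (m * (C * d) * (guessCond g 0 * ∏ j ∈ Ioi (0 : Fin m), (T j : ℝ))) := by ring
      _ ≤ _ := by gcongr
  have hcon := hreg.contraction (o := 0) (by positivity) (by simp) hT0pos hγ
    (bandSq_nonneg (xopt := xopt) (u := u) (band := band) x₀)
  rw [sum_bandSq] at hcon
  have hD : ∀ i, (#{k | band k = i} : ℝ) ≤ (d : ℝ) := fun i => by
    have := card_le_univ ({k | band k = i} : Finset (Fin d))
    rw [Fintype.card_fin] at this
    exact_mod_cast this
  have hB : 2 * Real.exp (-(T 0 / guessCond g 0)) * ‖x₀ - xopt‖ ^ 2 ≤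
      2 * Real.exp (-Λ) * R ^ 2 := by
    have h1 : Real.exp (-(T 0 / guessCond g 0)) ≤ Real.exp (-Λ) := by
      refine Real.exp_le_exp.2 (neg_le_neg ?_)
      rw [le_div_iff₀ hκ0]; linarith
    gcongr
  have hl := hp.lintegral_dist_gdRun_le hn hreg.pos hreg.mono hreg.one_le_cond
    (hp.bandCover_guess h) hC (Nat.cast_nonneg d) hD x₀ (schedule T 0) (hcon.trans hB)
  have hX : ∀ z, runOutput n N T (guessTop (β.lo 0) g) x₀ z =
      (gdRun n z ((schedule T 0).map fun p => 1 / guessTop (β.lo 0) g p) (x₀, 0)).1 := fun z =>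
    gdRun_etas n z hN _
  simp only [hX]
  have hmeas : Measurable fun z : ℕ → Sample d => ENNReal.ofReal (‖(gdRun n z
      ((schedule T 0).map fun p => 1 / guessTop (β.lo 0) g p) (x₀, 0)).1 - xopt‖ ^ 2) :=
    (((measurable_gdRun n _ _).sub_const _).norm.pow_const 2).ennreal_ofReal
  calc _ ≤ ∫⁻ z, ENNReal.ofReal (β.hi ⊤ / 2) * ENNReal.ofReal (‖(gdRun n z
      ((schedule T 0).map fun p => 1 / guessTop (β.lo 0) g p) (x₀, 0)).1 - xopt‖ ^ 2)
        ∂(sampleStream 𝒟) := by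
        refine lintegral_mono fun z => ?_
        rw [← ENNReal.ofReal_mul (by positivity)]
        exact ENNReal.ofReal_le_ofReal (hp.objective_le _)
    _ ≤ ENNReal.ofReal (β.hi ⊤ / 2) * ENNReal.ofReal (2 * Real.exp (-Λ) * R ^ 2) := by
        rw [lintegral_const_mul _ hmeas]
        exact mul_le_mul_right hl _
    _ = _ := by
        rw [← ENNReal.ofReal_mul (by positivity)]
        congr 1; ring

end Guesses

end StochBSLS

namespace StochBSLS

/-! ### Search parameters, program size and number of samples -/

section UnknownBands

open ProbabilityTheory Finset

variable {d m : ℕ} [NeZero m] {𝒟 : Measure (Sample d)} [IsProbabilityMeasure 𝒟] {xopt : Vec d}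
  {β : Bands m} {u : OrthonormalBasis (Fin d) ℝ (Vec d)} {lam : Fin d → ℝ} {band : Fin d → Fin m}
  {C : ℝ}

lemma sum_inner_invSqrtCov (u : OrthonormalBasis (Fin d) ℝ (Vec d)) (lam : Fin d → ℝ) (a : Vec d) :
    ‖invSqrtCov u lam a‖ ^ 2 = ∑ k, ((Real.sqrt (lam k))⁻¹ * inner ℝ (u k) a) ^ 2 := by
  rw [← u.sum_sq_norm_inner_right (invSqrtCov u lam a)]
  refine sum_congr rfl fun k _ => ?_
  rw [invSqrtCov, u.orthonormal.inner_right_fintype, Real.norm_eq_abs, sq_abs]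

/-- The bound for the whitened covariates is at least one. -/
lemma Problem.one_le_sq_of_boundedBy (hp : Problem 𝒟 xopt β u lam band C) {K : ℝ}
    (hK : BoundedBy 𝒟 u lam K) (hd : 0 < d) : 1 ≤ K ^ 2 := by
  set I := ∫ y, ‖invSqrtCov u lam y.1‖ ^ 2 ∂𝒟 with hI
  have hint : ∀ k, Integrable (fun z : Sample d => ((Real.sqrt (lam k))⁻¹ * inner ℝ (u k) z.1) ^ 2)
      𝒟 := fun k => by
    refine ((integrable_inner_two hp.fourth_moment (u k) (u k)).const_mul
      (((Real.sqrt (lam k))⁻¹) ^ 2)).congr (ae_of_all _ fun z => ?_)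
    simp only; ring
  -- Each whitened coordinate has second moment `1`. In particular `I > 0`, so that `I ≤ K ^ 2 * I`
  -- can be cancelled.
  have hId : I = d := by
    simp only [hI, sum_inner_invSqrtCov]
    rw [integral_finsetSum _ fun k _ => hint k]
    have : ∀ k, ∫ z : Sample d, ((Real.sqrt (lam k))⁻¹ * inner ℝ (u k) z.1) ^ 2 ∂𝒟 = 1 := by
      intro k
      have h1 := hp.integral_inner_two k (u k)
      rw [real_inner_self_eq_norm_sq, u.norm_eq_one, one_pow, mul_one] at h1
      have h2 : ∫ z : Sample d, ((Real.sqrt (lam k))⁻¹ * inner ℝ (u k) z.1) ^ 2 ∂𝒟 =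
          ∫ z : Sample d, ((Real.sqrt (lam k))⁻¹) ^ 2 *
            (inner ℝ (u k) z.1 * inner ℝ (u k) z.1) ∂𝒟 :=
        integral_congr_ae (ae_of_all _ fun z => by ring)
      rw [h2, integral_const_mul, h1, inv_pow, Real.sq_sqrt (hp.lam_pos k).le,
        inv_mul_cancel₀ (hp.lam_pos k).ne']
    simp [this]
  have hd' : (0 : ℝ) < d := by exact_mod_cast hd
  have hle : I ≤ K ^ 2 * I := by
    have h1 : I ≤ ∫ _, K ^ 2 * I ∂𝒟 := by
      refine integral_mono_ae ?_ (integrable_const _) ?_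
      · simp only [sum_inner_invSqrtCov]
        exact integrable_finsetSum _ fun k _ => hint k
      · filter_upwards [hK] with z hz
        calc ‖invSqrtCov u lam z.1‖ ^ 2 ≤ (K * Real.sqrt I) ^ 2 :=
              pow_le_pow_left₀ (norm_nonneg _) hz 2
          _ = K ^ 2 * I := by rw [mul_pow, Real.sq_sqrt (by rw [hId]; exact hd'.le)]
    simpa using h1
  rw [hId] at hle
  by_contra hlt
  nlinarith

lemma le_prod_stepCount (β : Bands m) {R ε : ℝ} (hlg : 0 ≤ Real.log β.globalCond)
    (hℓ : 0 ≤ Real.log (9 * R ^ 2 / ε)) :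
    β.condProd * Real.log β.globalCond ^ (m - 1) * Real.log (9 * R ^ 2 / ε) ≤
      ∏ i, (stepCount β R ε i : ℝ) := by
  calc β.condProd * Real.log β.globalCond ^ (m - 1) * Real.log (9 * R ^ 2 / ε)
      = ∏ i, (β.cond i * (if i = 0 then Real.log (9 * R ^ 2 / ε) else Real.log β.globalCond)) := by
        rw [prod_mul_distrib, prod_ite_zero, Bands.condProd]; ring
    _ ≤ _ := by
        refine prod_le_prod (fun i _ => ?_) fun i _ => ?_
        · have := β.one_le_cond i
          split_ifs <;> positivity
        · obtain ⟨h1, h2⟩ := sufficientSteps_stepCount β R ε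
          have := β.one_le_cond i
          split_ifs with h
          · subst h; exact h1
          · have h3 := h2 i h
            have : 0 ≤ β.cond i * Real.log β.globalCond := by positivity
            linarith

lemma Bands.one_le_condProd (β : Bands m) : 1 ≤ β.condProd := by
  calc (1 : ℝ) = ∏ _i : Fin m, 1 := by simp
    _ ≤ β.condProd := prod_le_prod (fun _ _ => zero_le_one) fun i _ => β.one_le_cond i

/-- Needed to absorb the number of tests, which is linear in the logarithm. For `m = 1` there is no
power of the logarithm, but then the product is the global condition number, which exceeds its
logarithm. -/
lemma log_le_condProd_mul_pow (β : Bands m) (hlg : 1 ≤ Real.log β.globalCond) :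
    Real.log β.globalCond ≤ β.condProd * Real.log β.globalCond ^ (m - 1) := by
  have hπ := β.one_le_condProd
  have hm : 0 < m := NeZero.pos m
  rcases Nat.lt_or_ge 1 m with h | h
  · calc Real.log β.globalCond = Real.log β.globalCond ^ 1 := (pow_one _).symm
      _ ≤ Real.log β.globalCond ^ (m - 1) := pow_le_pow_right₀ hlg (by omega)
      _ ≤ _ := le_mul_of_one_le_left (by positivity) hπ
  · obtain rfl : m = 1 := by omega
    have e : β.condProd = β.globalCond := by
      rw [Bands.condProd, Bands.globalCond, Fin.prod_univ_one, Bands.cond,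
        Subsingleton.elim (⊤ : Fin 1) 0]
    have h0 : 0 < β.globalCond := div_pos (β.hi_pos _) (β.lo_pos _)
    rw [e, Nat.sub_self, pow_zero, mul_one]
    exact Real.log_le_self h0.le

/-- The parameters of the search over the bands. -/
def searchBase (m : ℕ) (π lg : ℝ) : ℝ := 100 ^ m * π * lg ^ (m - 1)

/-- Chosen so that a fitting run has mean objective at most `Lm * exp (-Λ) * R ^ 2 = ε * δ / 4`, as
the test by Markov's inequality requires. -/
def searchLog (Lm R ε δ : ℝ) : ℝ := Real.log (4 * Lm * R ^ 2 / (ε * δ))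

def searchBatch (d m : ℕ) (C π lg : ℝ) : ℕ := ⌈40 * (m * (C * d) * searchBase m π lg)⌉₊

/-- Enough steps for every guess that fits some bands with product `π`; other guesses are simply cut
off. -/
def searchSteps (m : ℕ) (π lg Λ : ℝ) : ℕ := ⌈searchBase m π lg * Λ⌉₊

/-- The number for which the union bound over all guesses leaves failure probability at most `δ /
2`. -/
def searchTests (m : ℕ) (C lg δ : ℝ) : ℕ :=
  ⌈8 * C * Real.log (2 * Fintype.card (Guess m ⌈lg⌉₊) / δ)⌉₊

/-- The program that tries all guesses of the bands. -/
def searchProg (d m : ℕ) [NeZero m] (μ₁ lg Λ C π ε δ : ℝ) :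
    Prog d (ParWork d m (Guess m ⌈lg⌉₊)) :=
  parallelProg (guessSteps lg Λ) (guessTop μ₁) (searchBatch d m C π lg) (searchSteps m π lg Λ)
    (searchTests m C lg δ) (searchTests m C lg δ * ε) univ.toList

lemma card_guess_le {lg : ℝ} (hlg : 3 ≤ lg) :
    (Fintype.card (Guess m ⌈lg⌉₊) : ℝ) ≤ (2 * lg) ^ (2 * m) := by
  have h1 := (Nat.ceil_lt_add_one (show 0 ≤ lg by linarith)).le
  simp only [Fintype.card_pi, Fintype.card_prod, Fintype.card_fin, prod_const, card_univ]
  push_cast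
  rw [pow_mul, pow_two (2 * lg)]
  gcongr <;> linarith

lemma card_guess_pos (M : ℕ) : 0 < Fintype.card (Guess m M) := Fintype.card_pos

lemma searchProg_size_le (hd : 0 < d) {μ₁ lg Λ C π ε δ : ℝ} (hlg : 3 ≤ lg) :
    (((searchProg d m μ₁ lg Λ C π ε δ).space + (searchProg d m μ₁ lg Λ C π ε δ).length : ℕ) : ℝ) ≤
      240 * m * 10000 ^ m * d * lg ^ (2 * m) := by
  have h1 := parallelProg_size_le (d := d) (G := Guess m ⌈lg⌉₊) (l := univ.toList)
    (guessSteps lg Λ) (guessTop μ₁) (by rw [length_toList, card_univ])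
    (searchBatch d m C π lg) (searchSteps m π lg Λ) (searchTests m C lg δ)
    (searchTests m C lg δ * ε)
  have hm : 0 < m := NeZero.pos m
  have hG := card_guess_pos (m := m) ⌈lg⌉₊
  have h2 : Fintype.card (Guess m ⌈lg⌉₊) * (15 * d + 8 * m + 18) + (4 * d + 11) ≤
      Fintype.card (Guess m ⌈lg⌉₊) * (56 * (d * m)) := by
    have e1 : d ≤ d * m := Nat.le_mul_of_pos_right d hm
    have e2 : m ≤ d * m := Nat.le_mul_of_pos_left m hd
    have e3 : 1 ≤ d * m := Nat.mul_pos hd hm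
    have e4 : 4 * d + 11 ≤ Fintype.card (Guess m ⌈lg⌉₊) * (15 * (d * m)) :=
      le_trans (by omega) (Nat.le_mul_of_pos_left _ hG)
    have e5 : Fintype.card (Guess m ⌈lg⌉₊) * (15 * d + 8 * m + 18) ≤
        Fintype.card (Guess m ⌈lg⌉₊) * (41 * (d * m)) := Nat.mul_le_mul_left _ (by omega)
    nlinarith
  have h3 : (((searchProg d m μ₁ lg Λ C π ε δ).space +
      (searchProg d m μ₁ lg Λ C π ε δ).length : ℕ) : ℝ) ≤
      Fintype.card (Guess m ⌈lg⌉₊) * (56 * (d * m)) := by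
    exact_mod_cast h1.trans h2
  refine h3.trans ?_
  have h4 := card_guess_le (m := m) hlg
  have h5 : (4 : ℝ) ^ m ≤ 10000 ^ m := pow_le_pow_left₀ (by norm_num) (by norm_num) m
  calc (Fintype.card (Guess m ⌈lg⌉₊) : ℝ) * (56 * (d * m))
      ≤ (2 * lg) ^ (2 * m) * (56 * (d * m)) := by gcongr
    _ = 56 * m * 4 ^ m * d * lg ^ (2 * m) := by
        rw [mul_pow, pow_mul 2 2 m]; norm_num; ring
    _ ≤ 240 * m * 10000 ^ m * d * lg ^ (2 * m) := by gcongr; norm_num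

variable {R ε δ : ℝ}

lemma Bands.one_le_log (β : Bands m) (hε : 0 < ε) (hR : 2 * ε < β.hi ⊤ * R ^ 2) :
    1 ≤ Real.log (9 * R ^ 2 / (ε / β.hi ⊤)) := by
  have hL := β.hi_pos ⊤
  rw [Real.le_log_iff_exp_le (by rw [div_div_eq_mul_div]; apply div_pos _ hε; nlinarith),
    div_div_eq_mul_div, le_div_iff₀ hε]
  have := Real.exp_one_lt_d9
  nlinarith

lemma two_le_searchLog {Lm : ℝ} (hε : 0 < ε) (hδ : 0 < δ) (hδ1 : δ < 1)
    (hR : 2 * ε < Lm * R ^ 2) : 2 ≤ searchLog Lm R ε δ := by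
  have h1 : 0 < ε * δ := by positivity
  have h2 : 8 * (ε * δ) ≤ 4 * Lm * R ^ 2 := by nlinarith
  rw [searchLog, Real.le_log_iff_exp_le (div_pos (by linarith) h1), le_div_iff₀ h1]
  have h3 := exp_one_sq_le
  have e : Real.exp 2 = Real.exp 1 ^ 2 := by rw [← Real.exp_nat_mul]; norm_num
  rw [e]
  nlinarith

lemma one_le_log_four_mul_div (hd : 0 < d) (hδ : 0 < δ) (hδ1 : δ < 1) :
    1 + Real.log (1 / δ) ≤ Real.log (4 * d / δ) := by
  have hd' : (1 : ℝ) ≤ d := by exact_mod_cast hd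
  have h1 : (1 : ℝ) ≤ Real.log (4 * d) := by
    rw [Real.le_log_iff_exp_le (by positivity)]
    have := Real.exp_one_lt_d9
    linarith
  have e : 4 * d / δ = (4 * d) * (1 / δ) := by ring
  rw [e, Real.log_mul (by positivity) (by positivity)]
  linarith

/-- The logarithm splits into a part for the accuracy and `log (1 / δ)`. As the first part is at
least `1`, the sum is at most the product with `1 + log (1 / δ)`. -/
lemma searchLog_le {Lm : ℝ} (hd : 0 < d) (hε : 0 < ε) (hδ : 0 < δ) (hδ1 : δ < 1) (hL : 0 < Lm)
    (hR : 2 * ε < Lm * R ^ 2) (hℓ : 1 ≤ Real.log (9 * R ^ 2 / (ε / Lm))) :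
    searchLog Lm R ε δ ≤ Real.log (9 * R ^ 2 / (ε / Lm)) * Real.log (4 * d / δ) := by
  have h1 := one_le_log_four_mul_div hd hδ hδ1
  have hR2 : 0 < R ^ 2 := by
    by_contra h
    nlinarith
  have h2 : searchLog Lm R ε δ ≤ Real.log (9 * R ^ 2 / (ε / Lm)) + Real.log (1 / δ) := by
    rw [searchLog, ← Real.log_mul (by positivity) (by positivity)]
    refine Real.log_le_log (by positivity) ?_
    have e : 9 * R ^ 2 / (ε / Lm) * (1 / δ) = 9 * Lm * R ^ 2 / (ε * δ) := by
      field_simp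
    rw [e]
    gcongr
    norm_num
  have h3 : 0 ≤ Real.log (1 / δ) := Real.log_nonneg ((one_le_div hδ).2 hδ1.le)
  nlinarith

/-- The number of guesses enters only through its logarithm, which is at most `4 m lg`. So testing
costs no more than the runs. -/
lemma searchTests_le {C D q P lg : ℝ} (hC : 1 ≤ C) (hD : 1 ≤ D) (hlg : 3 ≤ lg) (hq : 1 ≤ q)
    (hδ : 0 < δ) (hδ1 : δ < 1) (h2q : Real.log (2 / δ) ≤ q) (hP : lg ≤ P) :
    (searchTests m C lg δ : ℝ) ≤ 80 * m * (C * D * q * P ^ 2) := by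
  have hm : (1 : ℝ) ≤ m := by exact_mod_cast NeZero.pos m
  have hG1 := card_guess_le (m := m) hlg
  have hG0 : (1 : ℝ) ≤ Fintype.card (Guess m ⌈lg⌉₊) := by
    exact_mod_cast card_guess_pos (m := m) _
  rw [searchTests]
  generalize (Fintype.card (Guess m ⌈lg⌉₊) : ℝ) = F at *
  have h0 : 0 ≤ Real.log (2 * F / δ) := by
    refine Real.log_nonneg ((one_le_div hδ).2 ?_)
    linarith
  have h1 : Real.log (2 * F / δ) = Real.log F + Real.log (2 / δ) := by
    rw [← Real.log_mul (by positivity) (by positivity)]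
    congr 1; ring
  have h2 : Real.log F ≤ 2 * m * (2 * lg) := by
    have h3 := Real.log_le_log (by linarith) hG1
    rw [Real.log_pow] at h3
    push_cast at h3
    have h4 := Real.log_le_self (show 0 ≤ 2 * lg by linarith)
    have : 2 * (m : ℝ) * Real.log (2 * lg) ≤ 2 * m * (2 * lg) := by gcongr
    linarith
  have h5 := (Nat.ceil_lt_add_one (a := 8 * C * Real.log (2 * F / δ)) (by positivity)).le
  have hP3 : 3 * P ≤ P ^ 2 := by nlinarith
  set Q := q * P ^ 2 with hQ
  have hPQ : P ^ 2 ≤ Q := le_mul_of_one_le_left (sq_nonneg P) hq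
  have h8 : m * lg ≤ m * Q := by
    gcongr
    linarith
  have h9 : q + 1 ≤ m * Q := by
    have h10 : q * 3 ≤ Q := by rw [hQ]; gcongr; linarith
    have h11 : Q ≤ m * Q := le_mul_of_one_le_left (by linarith) hm
    linarith
  have h6 : Real.log (2 * F / δ) ≤ 5 * (m * Q) - 1 := by linarith
  have h7 : 8 * C * Real.log (2 * F / δ) ≤ 8 * C * (5 * (m * Q) - 1) := by gcongr
  have h10 : 0 ≤ C * (m * Q) := by
    have : 0 ≤ Q := by linarith
    positivity
  have h12 : C * (m * Q) ≤ D * (C * (m * Q)) := le_mul_of_one_le_left h10 hD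
  have e : 80 * m * (C * D * q * P ^ 2) = 80 * (D * (C * (m * Q))) := by rw [hQ]; ring
  rw [e]
  linarith

/-- The batch size and the number of steps each contribute `B`, but only the latter contains `Λ`.
Since `ℓ ≤ ℓ ^ 2`, the product fits under `P ^ 2`, where `P` contains `ℓ` once. -/
lemma sq_mul_le_sq_mul {B P ℓ Λ q : ℝ} (hB : 0 ≤ B) (hℓ : 1 ≤ ℓ) (hq : 0 ≤ q) (hΛ : Λ ≤ ℓ * q)
    (hP : B * ℓ ≤ P) : B ^ 2 * Λ ≤ P ^ 2 * q := by
  have h1 : B ^ 2 * Λ ≤ B ^ 2 * (ℓ * q) := by gcongr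
  have h0 : 0 ≤ B * ℓ := by positivity
  have h2 : (B * ℓ) ^ 2 ≤ P ^ 2 := pow_le_pow_left₀ h0 hP 2
  have h3 : B ^ 2 * ℓ ≤ (B * ℓ) ^ 2 := by
    rw [mul_pow]; gcongr; nlinarith
  have h4 := mul_le_mul_of_nonneg_right (h3.trans h2) hq
  linarith

/-- The number of samples of the search. -/
lemma Problem.search_samples_le (hp : Problem 𝒟 xopt β u lam band C) (hd : 0 < d) (hε : 0 < ε)
    (hδ : 0 < δ) (hδ1 : δ < 1) (hR : 2 * ε < β.hi ⊤ * R ^ 2) :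
    ((searchBatch d m C β.condProd (Real.log β.globalCond) *
      searchSteps m β.condProd (Real.log β.globalCond) (searchLog (β.hi ⊤) R ε δ) +
      searchTests m C (Real.log β.globalCond) δ : ℕ) : ℝ) ≤
      240 * m * 10000 ^ m * (C * d * Real.log (4 * d / δ) *
        (∏ i, (stepCount β R (ε / β.hi ⊤) i : ℝ)) ^ 2) := by
  have hL := β.hi_pos ⊤
  have hC := hp.one_le_kurtosis ⟨0, hd⟩
  have hm : (1 : ℝ) ≤ m := by exact_mod_cast NeZero.pos m
  have hd' : (1 : ℝ) ≤ d := by exact_mod_cast hd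
  have hlg : 3 ≤ Real.log β.globalCond := by have := hp.bands_le_log; linarith
  have hℓ := β.one_le_log hε hR
  have hΛ2 := two_le_searchLog hε hδ hδ1 hR
  have hΛ := searchLog_le hd hε hδ hδ1 hL hR hℓ
  have hP := le_prod_stepCount β (R := R) (ε := ε / β.hi ⊤) (by linarith) (by linarith)
  have hB := log_le_condProd_mul_pow β (by linarith)
  have hq := one_le_log_four_mul_div hd hδ hδ1
  have hq0 : 0 ≤ Real.log (1 / δ) := Real.log_nonneg ((one_le_div hδ).2 hδ1.le)
  have h2q : Real.log (2 / δ) ≤ Real.log (4 * d / δ) := by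
    refine Real.log_le_log (by positivity) ?_
    gcongr
    linarith
  set lg := Real.log β.globalCond
  set Λ := searchLog (β.hi ⊤) R ε δ
  set ℓ := Real.log (9 * R ^ 2 / (ε / β.hi ⊤))
  set q := Real.log (4 * d / δ)
  set P := ∏ i, (stepCount β R (ε / β.hi ⊤) i : ℝ)
  set B := β.condProd * lg ^ (m - 1) with hBdef
  have hA : searchBase m β.condProd lg = 100 ^ m * B := by rw [searchBase, hBdef]; ring
  have hA1 : 1 ≤ 100 ^ m * B :=
    one_le_mul_of_one_le_of_one_le (one_le_pow₀ (by norm_num)) (by linarith)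
  have hPB : B ≤ P := by nlinarith
  have hn : (searchBatch d m C β.condProd lg : ℝ) ≤ 80 * (m * (C * d) * (100 ^ m * B)) := by
    have h1 : 1 ≤ m * (C * d) * (100 ^ m * B) :=
      one_le_mul_of_one_le_of_one_le (one_le_mul_of_one_le_of_one_le hm
        (one_le_mul_of_one_le_of_one_le hC hd')) hA1
    have h2 := (Nat.ceil_lt_add_one (a := 40 * (m * (C * d) * (100 ^ m * B))) (by linarith)).le
    rw [searchBatch, hA]
    linarith
  have hN : (searchSteps m β.condProd lg Λ : ℝ) ≤ 2 * ((100 ^ m * B) * Λ) := by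
    have h1 : 1 ≤ (100 ^ m * B) * Λ := one_le_mul_of_one_le_of_one_le hA1 (by linarith)
    have h2 := (Nat.ceil_lt_add_one (a := (100 ^ m * B) * Λ) (by linarith)).le
    rw [searchSteps, hA]
    linarith
  have hS : (searchTests m C lg δ : ℝ) ≤ 80 * m * (C * d * q * P ^ 2) :=
    searchTests_le hC hd' hlg (by linarith) hδ hδ1 h2q (hB.trans hPB)
  have hBP : B ^ 2 * Λ ≤ P ^ 2 * q :=
    sq_mul_le_sq_mul (by linarith) hℓ (by linarith) hΛ hP
  push_cast
  have hB0 : 0 ≤ B := by linarith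
  have hq1 : 1 ≤ q := by linarith
  have h10 : (10000 : ℝ) ^ m = 100 ^ m * 100 ^ m := by rw [← mul_pow]; norm_num
  calc (searchBatch d m C β.condProd lg : ℝ) * searchSteps m β.condProd lg Λ +
        searchTests m C lg δ
      ≤ 80 * (m * (C * d) * (100 ^ m * B)) * (2 * ((100 ^ m * B) * Λ)) +
        80 * m * (C * d * q * P ^ 2) := by gcongr
    _ = 160 * m * 10000 ^ m * (C * d) * (B ^ 2 * Λ) + 80 * m * (C * d * q * P ^ 2) := by
        rw [h10]; ring
    _ ≤ 160 * m * 10000 ^ m * (C * d) * (P ^ 2 * q) +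
        80 * m * 10000 ^ m * (C * d * q * P ^ 2) := by
        have : (1 : ℝ) ≤ 10000 ^ m := one_le_pow₀ (by norm_num)
        have h11 : 80 * (m : ℝ) ≤ 80 * m * 10000 ^ m := le_mul_of_one_le_right (by positivity) this
        gcongr
    _ = _ := by ring

end UnknownBands

end StochBSLS

namespace StochBSLS

section UnknownBands

open ProbabilityTheory Finset

variable {d m : ℕ} [NeZero m] {𝒟 : Measure (Sample d)} [IsProbabilityMeasure 𝒟] {xopt : Vec d}
  {β : Bands m} {u : OrthonormalBasis (Fin d) ℝ (Vec d)} {lam : Fin d → ℝ} {band : Fin d → Fin m}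
  {C R ε δ : ℝ}

/-! ### Success probability and the program for all bands -/

lemma Problem.isOptimal_of_objective_le (hp : Problem 𝒟 xopt β u lam band C) {x : Vec d}
    (h : objective 𝒟 x ≤ ε) : IsOptimal 𝒟 ε x := fun y => by
  have := hp.objective_nonneg y
  linarith

/-- The search succeeds with high probability. -/
theorem Problem.searchProg_failure_le (hp : Problem 𝒟 xopt β u lam band C) (hd : 0 < d) (hε : 0 < ε)
    (hδ : 0 < δ) (hδ1 : δ < 1) (hR : 2 * ε < β.hi ⊤ * R ^ 2) {x₀ : Vec d} (hx : ‖x₀ - xopt‖ ≤ R) :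
    sampleStream 𝒟 {z | ¬ IsOptimal 𝒟 ε ((searchProg d m (β.lo 0) (Real.log β.globalCond)
      (searchLog (β.hi ⊤) R ε δ) C β.condProd ε δ).result x₀ z)} ≤ ENNReal.ofReal δ := by
  have hL := β.hi_pos ⊤
  have hC := hp.one_le_kurtosis ⟨0, hd⟩
  have hC0 : 0 < C := by linarith
  have hm : (1 : ℝ) ≤ m := by exact_mod_cast NeZero.pos m
  have hd' : (1 : ℝ) ≤ d := by exact_mod_cast hd
  have hlg : 3 ≤ Real.log β.globalCond := by have := hp.bands_le_log; linarith
  have hΛ2 := two_le_searchLog hε hδ hδ1 hR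
  set lg := Real.log β.globalCond with hlgdef
  set Λ := searchLog (β.hi ⊤) R ε δ with hΛdef
  obtain ⟨g₀, hg⟩ := β.exists_fits (M := ⌈lg⌉₊) (Nat.le_ceil lg)
  have hNr := hg.prod_steps_succ_le hlg hΛ2
  have hA : 1 ≤ searchBase m β.condProd lg :=
    one_le_mul_of_one_le_of_one_le (one_le_mul_of_one_le_of_one_le (one_le_pow₀ (by norm_num))
      β.one_le_condProd) (one_le_pow₀ (by linarith))
  have hnle : 40 * (m * (C * d) * searchBase m β.condProd lg) ≤ searchBatch d m C β.condProd lg :=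
    Nat.le_ceil _
  have hn : 0 < searchBatch d m C β.condProd lg := by
    have : (0 : ℝ) < searchBatch d m C β.condProd lg := lt_of_lt_of_le (by positivity) hnle
    exact_mod_cast this
  have hN : ∏ i, (guessSteps lg Λ g₀ i + 1) ≤ searchSteps m β.condProd lg Λ := by
    have : (searchBase m β.condProd lg * Λ : ℝ) ≤ searchSteps m β.condProd lg Λ := Nat.le_ceil _
    exact_mod_cast hNr.trans this
  have hF : (0 : ℝ) < Fintype.card (Guess m ⌈lg⌉₊) := by exact_mod_cast card_guess_pos (m := m) _
  have hlogF : 0 < Real.log (2 * Fintype.card (Guess m ⌈lg⌉₊) / δ) := by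
    have hF1 : (1 : ℝ) ≤ Fintype.card (Guess m ⌈lg⌉₊) := by
      exact_mod_cast card_guess_pos (m := m) _
    refine Real.log_pos ((one_lt_div hδ).2 ?_)
    linarith
  have hSle : 8 * C * Real.log (2 * Fintype.card (Guess m ⌈lg⌉₊) / δ) ≤ searchTests m C lg δ :=
    Nat.le_ceil _
  have hS : 0 < searchTests m C lg δ := by
    have : (0 : ℝ) < searchTests m C lg δ := lt_of_lt_of_le (by positivity) hSle
    exact_mod_cast this
  have hexp : Fintype.card (Guess m ⌈lg⌉₊) * Real.exp (-(searchTests m C lg δ / (8 * C))) ≤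
      δ / 2 := by
    have h1 : Real.log (2 * Fintype.card (Guess m ⌈lg⌉₊) / δ) ≤
        searchTests m C lg δ / (8 * C) := by
      rw [le_div_iff₀ (by positivity)]; linarith
    calc Fintype.card (Guess m ⌈lg⌉₊) * Real.exp (-(searchTests m C lg δ / (8 * C)))
        ≤ Fintype.card (Guess m ⌈lg⌉₊) *
          Real.exp (-Real.log (2 * Fintype.card (Guess m ⌈lg⌉₊) / δ)) := by gcongr
      _ = δ / 2 := by
          rw [Real.exp_neg, Real.exp_log (by positivity)]
          field_simp
  have hE := hp.lintegral_objective_runOutput_le hg hC0.le hΛ2 hn hnle hN hx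
  have hΛexp : β.hi ⊤ * Real.exp (-Λ) * R ^ 2 = ε * δ / 4 := by
    have hR2 : 0 < R ^ 2 := by
      by_contra h
      nlinarith
    have hR0 : R ≠ 0 := by rintro rfl; simp at hR2
    rw [hΛdef, searchLog, Real.exp_neg, Real.exp_log (by positivity)]
    field_simp
  rw [hΛexp] at hE
  set n := searchBatch d m C β.condProd lg
  set N := searchSteps m β.condProd lg Λ
  set S := searchTests m C lg δ
  have hsel := hp.measure_selection_le hC0
    (X := fun g : Guess m ⌈lg⌉₊ => runOutput n N (guessSteps lg Λ g) (guessTop (β.lo 0) g) x₀)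
    (off := n * N) (fun g => measurable_gdRun n _ _) (fun g z z' h => by
      refine gdRun_congr n _ x₀ fun i hi => h i ?_
      rwa [Odometer.etas, List.length_map, List.length_range] at hi) hS hε hδ (g₀ := g₀) hE hexp
  -- Outside the exceptional event the fitting guess passes, so some run is selected, and every run
  -- that passes is good.
  refine le_trans (measure_mono fun z hz => ?_) hsel
  intro hgood
  obtain ⟨-, h2⟩ := parallelProg_spec (z := z) (guessSteps lg Λ) (guessTop (β.lo 0))
    (l := (univ : Finset (Guess m ⌈lg⌉₊)).toList) (nodup_toList _) (by simp) n N S (S * ε) x₀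
  obtain ⟨g, h3, h4⟩ := h2 ⟨g₀, hgood.1⟩
  refine hz (hp.isOptimal_of_objective_le ?_)
  have h5 : (searchProg d m (β.lo 0) lg Λ C β.condProd ε δ).result x₀ z =
    runOutput n N (guessSteps lg Λ g) (guessTop (β.lo 0) g) x₀ z := h4
  rw [h5]
  exact hgood.2 g h3

/-- The budget of samples for unknown bands. -/
def searchBudget (d m : ℕ) [NeZero m] (β : Bands m) (R C K ε δ : ℝ) : ℝ :=
  240 * m * 10000 ^ m * (K ^ 2 * d * Real.log (4 * d / δ) * (1 + Real.sqrt (ε / δ))) *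
    (batchSize C d (stepCount β R (ε / β.hi ⊤)) * 2 ^ m *
      ∏ i, (stepCount β R (ε / β.hi ⊤) i : ℝ))

lemma Problem.searchBudget_nonneg (hp : Problem 𝒟 xopt β u lam band C) (hδ : 0 < δ) (hδ1 : δ < 1)
    (R K : ℝ) : 0 ≤ searchBudget d m β R C K ε δ := by
  rcases Nat.eq_zero_or_pos d with rfl | hd
  · simp [searchBudget]
  have hC := hp.one_le_kurtosis ⟨0, hd⟩
  have hq := one_le_log_four_mul_div hd hδ hδ1
  have hq0 : 0 ≤ Real.log (1 / δ) := Real.log_nonneg ((one_le_div hδ).2 hδ1.le)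
  have hq1 : 0 ≤ Real.log (4 * d / δ) := by linarith
  unfold searchBudget batchSize
  positivity

/-- The search itself needs fewer samples than the budget: the additional factors `K ^ 2 * d`, `1 +
√(ε / δ)`, `m ^ 2`, `max T` and `2 ^ m` are all at least `1`. -/
lemma Problem.search_samples_le_budget (hp : Problem 𝒟 xopt β u lam band C) {K : ℝ}
    (hK : BoundedBy 𝒟 u lam K) (hd : 0 < d) (hε : 0 < ε) (hδ : 0 < δ) (hδ1 : δ < 1)
    (hR : 2 * ε < β.hi ⊤ * R ^ 2) :
    ((searchBatch d m C β.condProd (Real.log β.globalCond) *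
      searchSteps m β.condProd (Real.log β.globalCond) (searchLog (β.hi ⊤) R ε δ) +
      searchTests m C (Real.log β.globalCond) δ : ℕ) : ℝ) ≤ searchBudget d m β R C K ε δ := by
  refine (hp.search_samples_le hd hε hδ hδ1 hR).trans ?_
  have hC := hp.one_le_kurtosis ⟨0, hd⟩
  have hK1 := hp.one_le_sq_of_boundedBy hK hd
  have hm : (1 : ℝ) ≤ m := by exact_mod_cast NeZero.pos m
  have hd' : (1 : ℝ) ≤ d := by exact_mod_cast hd
  have hq := one_le_log_four_mul_div hd hδ hδ1
  have hq0 : 0 ≤ Real.log (1 / δ) := Real.log_nonneg ((one_le_div hδ).2 hδ1.le)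
  have hq1 : 0 ≤ Real.log (4 * d / δ) := by linarith
  have hℓ := β.one_le_log hε hR
  have hsup : (1 : ℝ) ≤ ((univ.sup (stepCount β R (ε / β.hi ⊤)) : ℕ) : ℝ) := by
    have h1 := (sufficientSteps_stepCount β R (ε / β.hi ⊤)).1
    have h2 : 1 ≤ β.cond 0 * Real.log (9 * R ^ 2 / (ε / β.hi ⊤)) :=
      one_le_mul_of_one_le_of_one_le (β.one_le_cond 0) hℓ
    refine (h2.trans h1).trans ?_
    exact_mod_cast Finset.le_sup (f := stepCount β R (ε / β.hi ⊤)) (mem_univ 0)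
  have hsqrt : 1 ≤ 1 + Real.sqrt (ε / δ) := by have := Real.sqrt_nonneg (ε / δ); linarith
  have h2m : (1 : ℝ) ≤ 2 ^ m := one_le_pow₀ (by norm_num)
  have hm2 : (1 : ℝ) ≤ (m : ℝ) ^ 2 := one_le_pow₀ hm
  unfold searchBudget batchSize
  set P := ∏ i, (stepCount β R (ε / β.hi ⊤) i : ℝ)
  have hP : 0 ≤ P := prod_nonneg fun i _ => Nat.cast_nonneg _
  generalize ((univ.sup (stepCount β R (ε / β.hi ⊤)) : ℕ) : ℝ) = V at *
  generalize Real.log (4 * d / δ) = q at *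
  generalize 1 + Real.sqrt (ε / δ) = w at *
  have h1 : 1 ≤ K ^ 2 * d * w := one_le_mul_of_one_le_of_one_le
    (one_le_mul_of_one_le_of_one_le hK1 hd') hsqrt
  have h2 : 1 ≤ (m : ℝ) ^ 2 * V * 2 ^ m := one_le_mul_of_one_le_of_one_le
    (one_le_mul_of_one_le_of_one_le hm2 hsup) h2m
  have h3 := one_le_mul_of_one_le_of_one_le h1 h2
  have h4 : 0 ≤ 240 * m * 10000 ^ m * (C * d * q * P ^ 2) := by positivity
  calc 240 * m * 10000 ^ m * (C * d * q * P ^ 2)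
      ≤ 240 * m * 10000 ^ m * (C * d * q * P ^ 2) *
        ((K ^ 2 * d * w) * ((m : ℝ) ^ 2 * V * 2 ^ m)) := le_mul_of_one_le_right h4 h3
    _ = _ := by ring

/-- Within the sample budget, one program serves all problems with the given parameters. -/
theorem exists_prog_unknown_bands (d m : ℕ) [NeZero m] (μ₁ Lm π R C K : ℝ) {ε δ : ℝ} (hε : 0 < ε)
    (hδ : 0 < δ) (hδ1 : δ < 1) (hm : (m : ℝ) ≤ Real.log (Lm / μ₁) / 3) :
    ∃ (s : ℕ) (p : Prog d (Fin d ⊕ Fin s)),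
      ((p.space + p.length : ℕ) : ℝ) ≤
        240 * m * 10000 ^ m * d * Real.log (Lm / μ₁) ^ (2 * m) ∧
      ∀ (β : Bands m) (𝒟 : Measure (Sample d)) [IsProbabilityMeasure 𝒟] (xopt : Vec d)
        (u : OrthonormalBasis (Fin d) ℝ (Vec d)) (lam : Fin d → ℝ) (band : Fin d → Fin m),
        Problem 𝒟 xopt β u lam band C → BoundedBy 𝒟 u lam K →
        β.lo 0 = μ₁ → β.hi ⊤ = Lm → β.condProd = π →
      ∀ x₀ : Vec d, ‖x₀ - xopt‖ ≤ R →
        sampleStream 𝒟 {z | ¬ IsOptimal 𝒟 ε (p.result x₀ z)} ≤ ENNReal.ofReal δ ∧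
        ∀ z, (p.queries x₀ z : ℝ) ≤ searchBudget d m β R C K ε δ := by
  have hm1 : (1 : ℝ) ≤ m := by exact_mod_cast NeZero.pos m
  have hlg : 3 ≤ Real.log (Lm / μ₁) := by linarith
  -- In these cases the input is already optimal to accuracy `ε` and the empty program will do.
  -- Otherwise `2 ε < Lm R ^ 2`, which keeps all logarithms away from zero.
  by_cases htriv : d = 0 ∨ Lm * R ^ 2 ≤ 2 * ε
  · refine ⟨0, Prog.skip, ?_, ?_⟩
    · simp only [Prog.space, Prog.length, Prog.loopDepth, Fintype.card_sum, Fintype.card_fin]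
      push_cast
      have h1 : 1 ≤ Real.log (Lm / μ₁) ^ (2 * m) := one_le_pow₀ (by linarith)
      have h2 : (1 : ℝ) ≤ 10000 ^ m := one_le_pow₀ (by norm_num)
      have h3 : 2 ≤ 240 * m * (10000 : ℝ) ^ m * Real.log (Lm / μ₁) ^ (2 * m) := by
        have := one_le_mul_of_one_le_of_one_le (one_le_mul_of_one_le_of_one_le hm1 h2) h1
        linarith
      have hd0 : (0 : ℝ) ≤ d := Nat.cast_nonneg d
      have := mul_le_mul_of_nonneg_right h3 hd0
      linarith
    · intro β 𝒟 _ xopt u lam band hp hK hμ hL hπ x₀ hx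
      refine ⟨?_, fun z => ?_⟩
      · have hopt : IsOptimal 𝒟 ε x₀ := by
          rcases htriv with rfl | htriv
          · intro y
            rw [Subsingleton.elim y x₀]
            linarith
          · refine hp.isOptimal_of_objective_le ((hp.objective_le x₀).trans ?_)
            have h1 : ‖x₀ - xopt‖ ^ 2 ≤ R ^ 2 := pow_le_pow_left₀ (norm_nonneg _) hx 2
            have h2 := mul_le_mul_of_nonneg_left h1 (β.hi_pos ⊤).le
            rw [hL] at h2 ⊢
            linarith
        have : {z : ℕ → Sample d | ¬ IsOptimal 𝒟 ε
            ((Prog.skip : Prog d (Fin d ⊕ Fin 0)).result x₀ z)} = ∅ :=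
          Set.eq_empty_iff_forall_notMem.2 fun z hz => hz hopt
        rw [this, measure_empty]
        exact zero_le
      · have : (Prog.skip : Prog d (Fin d ⊕ Fin 0)).queries x₀ z = 0 := rfl
        rw [this, Nat.cast_zero]
        exact hp.searchBudget_nonneg hδ hδ1 R K
  · push Not at htriv
    obtain ⟨hd0, hR⟩ := htriv
    have hd : 0 < d := Nat.pos_of_ne_zero hd0
    set lg := Real.log (Lm / μ₁) with hlgdef
    -- All work registers except the copy of `Fin d` that holds the sample are numbered, to reach
    -- the required index type.
    let Rest := Fin 4 ⊕ (Guess m ⌈lg⌉₊ × ((Fin d ⊕ Fin d) ⊕ (Fin m ⊕ Fin 3)))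
    let e : ParWork d m (Guess m ⌈lg⌉₊) ≃ Fin d ⊕ Fin (Fintype.card Rest) :=
      (Equiv.sumAssoc _ _ _).trans (Equiv.sumCongr (Equiv.refl _) (Fintype.equivFin Rest))
    refine ⟨Fintype.card Rest,
      (searchProg d m μ₁ lg (searchLog Lm R ε δ) C π ε δ).map (Sum.map id e), ?_, ?_⟩
    · have h1 := searchProg_size_le (m := m) hd (μ₁ := μ₁) (Λ := searchLog Lm R ε δ) (C := C)
        (π := π) (ε := ε) (δ := δ) hlg
      have h2 : Fintype.card (Reg d (Fin d ⊕ Fin (Fintype.card Rest))) =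
          Fintype.card (Reg d (ParWork d m (Guess m ⌈lg⌉₊))) :=
        Fintype.card_congr (Equiv.sumCongr (Equiv.refl _) e.symm)
      simp only [Prog.space, Prog.length_map, Prog.loopDepth_map, h2] at h1 ⊢
      exact h1
    · intro β 𝒟 _ xopt u lam band hp hK hμ hL hπ x₀ hx
      have hglob : Real.log β.globalCond = lg := by rw [Bands.globalCond, hμ, hL]
      simp only [Prog.result_map, Prog.queries_map]
      rw [← hL] at hR
      have h1 := hp.searchProg_failure_le hd hε hδ hδ1 hR hx
      have h2 := hp.search_samples_le_budget hK hd hε hδ hδ1 hR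
      rw [hglob, hπ, hL] at h1 h2
      rw [hμ] at h1
      refine ⟨h1, fun z => ?_⟩
      have h3 := (parallelProg_spec (z := z) (guessSteps lg (searchLog Lm R ε δ)) (guessTop μ₁)
        (l := (univ : Finset (Guess m ⌈lg⌉₊)).toList) (nodup_toList _) (by simp)
        (searchBatch d m C π lg) (searchSteps m π lg (searchLog Lm R ε δ)) (searchTests m C lg δ)
        (searchTests m C lg δ * ε) x₀).1
      have h4 : (searchProg d m μ₁ lg (searchLog Lm R ε δ) C π ε δ).queries x₀ z = _ := h3
      rw [h4]
      exact h2

end UnknownBands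

end StochBSLS

end

theorem mainTheorem7 :
    -- known bands: distance to the minimizer, objective, number of samples, space
    (∀ (d m : ℕ) [NeZero m] (β : StochBSLS.Bands m)
        (𝒟 : MeasureTheory.Measure (StochBSLS.Sample d))
        [MeasureTheory.IsProbabilityMeasure 𝒟] (xopt : StochBSLS.Vec d)
        (u : OrthonormalBasis (Fin d) ℝ (StochBSLS.Vec d)) (lam : Fin d → ℝ)
        (band : Fin d → Fin m) (C : ℝ),
        StochBSLS.Problem 𝒟 xopt β u lam band C →
      ∀ (x₀ : StochBSLS.Vec d) (ε : ℝ) (T : Fin m → ℕ) (n : ℕ), 0 < ε →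
        StochBSLS.batchSize C (StochBSLS.maxMult band) T ≤ n →
        (ε < 9 * ‖x₀ - xopt‖ ^ 2 → StochBSLS.SufficientSteps β ‖x₀ - xopt‖ ε T →
          MeasureTheory.Integrable
              (fun z => ‖(StochBSLS.bslsStoch d n T β.hi).result x₀ z - xopt‖ ^ 2)
              (StochBSLS.sampleStream 𝒟) ∧
            ∫ z, ‖(StochBSLS.bslsStoch d n T β.hi).result x₀ z - xopt‖ ^ 2
              ∂(StochBSLS.sampleStream 𝒟) ≤ ε) ∧
        (ε < 9 * β.hi ⊤ * ‖x₀ - xopt‖ ^ 2 →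
          StochBSLS.SufficientSteps β ‖x₀ - xopt‖ (ε / β.hi ⊤) T →
          StochBSLS.OptimalInExpectation 𝒟 (StochBSLS.bslsStoch d n T β.hi) x₀ ε)) ∧
    (∀ (d m : ℕ) [NeZero m] (n : ℕ) (T : Fin m → ℕ) (L : Fin m → ℝ), (∀ i, 1 ≤ T i) →
        (∀ x₀ z, (StochBSLS.bslsStoch d n T L).queries x₀ z ≤ n * 2 ^ m * ∏ i, T i) ∧
        (StochBSLS.bslsStoch d n T L).space ≤ 6 * (d + m)) ∧
    -- known bands: total number of samples in terms of the condition numbers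
    (∃ c : ℕ → ℝ, ∀ (d m : ℕ) [NeZero m] (β : StochBSLS.Bands m)
        (𝒟 : MeasureTheory.Measure (StochBSLS.Sample d))
        [MeasureTheory.IsProbabilityMeasure 𝒟] (xopt : StochBSLS.Vec d)
        (u : OrthonormalBasis (Fin d) ℝ (StochBSLS.Vec d)) (lam : Fin d → ℝ)
        (band : Fin d → Fin m) (C : ℝ),
        StochBSLS.Problem 𝒟 xopt β u lam band C →
      ∀ (x₀ : StochBSLS.Vec d) (ε : ℝ), 0 < ε → ε < 9 * β.hi ⊤ * ‖x₀ - xopt‖ ^ 2 →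
      ∃ n : ℕ, 0 < n ∧
        StochBSLS.OptimalInExpectation 𝒟
          (StochBSLS.bslsStoch d n (StochBSLS.stepCount β ‖x₀ - xopt‖ (ε / β.hi ⊤)) β.hi) x₀ ε ∧
        ∀ z, ((StochBSLS.bslsStoch d n
              (StochBSLS.stepCount β ‖x₀ - xopt‖ (ε / β.hi ⊤)) β.hi).queries x₀ z : ℝ) ≤
          c m * C * StochBSLS.maxMult band * (∏ i, β.cond i ^ 2) *
            Real.log β.globalCond ^ (2 * (m - 1)) *
            (1 + Real.log (9 * ‖x₀ - xopt‖ ^ 2 / (ε / β.hi ⊤))) ^ 2) ∧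
    -- unknown bands
    (∃ c : ℕ → ℝ, ∀ (d m : ℕ) [NeZero m] (μ₁ Lm π R C K ε δ : ℝ), 0 < ε → 0 < δ → δ < 1 →
        (m : ℝ) ≤ Real.log (Lm / μ₁) / 3 →
      ∃ (s : ℕ) (p : StochBSLS.Prog d (Fin d ⊕ Fin s)),
        ((p.space + p.length : ℕ) : ℝ) ≤ c m * d * Real.log (Lm / μ₁) ^ (2 * m) ∧
        ∀ (β : StochBSLS.Bands m) (𝒟 : MeasureTheory.Measure (StochBSLS.Sample d))
          [MeasureTheory.IsProbabilityMeasure 𝒟] (xopt : StochBSLS.Vec d)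
          (u : OrthonormalBasis (Fin d) ℝ (StochBSLS.Vec d)) (lam : Fin d → ℝ)
          (band : Fin d → Fin m),
          StochBSLS.Problem 𝒟 xopt β u lam band C →
          StochBSLS.BoundedBy 𝒟 u lam K →
          β.lo 0 = μ₁ → β.hi ⊤ = Lm → β.condProd = π →
        ∀ x₀ : StochBSLS.Vec d, ‖x₀ - xopt‖ ≤ R →
          StochBSLS.sampleStream 𝒟 {z | ¬ StochBSLS.IsOptimal 𝒟 ε (p.result x₀ z)} ≤
            ENNReal.ofReal δ ∧
          ∀ z, (p.queries x₀ z : ℝ) ≤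
            c m * (K ^ 2 * d * Real.log (4 * d / δ) * (1 + Real.sqrt (ε / δ))) *
              (StochBSLS.batchSize C d (StochBSLS.stepCount β R (ε / Lm)) * 2 ^ m *
                ∏ i, (StochBSLS.stepCount β R (ε / Lm) i : ℝ))) := by
  refine ⟨?_, ?_, ?_, ?_⟩
  · intro d m _ β 𝒟 _ xopt u lam band C hp x₀ ε T n hε hn
    refine ⟨fun hr hT => ?_, fun hr hT => ?_⟩
    · obtain ⟨hn0, hγ⟩ := hp.batchSize_suffices hε hr hT hn
      exact hp.bslsStoch_accuracy hε hn0 hr hT hγ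
    · have hL := β.hi_pos ⊤
      have hε' : 0 < ε / β.hi ⊤ := by positivity
      have hr' : ε / β.hi ⊤ < 9 * ‖x₀ - xopt‖ ^ 2 := by rw [div_lt_iff₀ hL]; linarith
      obtain ⟨hn0, hγ⟩ := hp.batchSize_suffices hε' hr' hT hn
      exact hp.optimalInExpectation hε (hp.bslsStoch_accuracy hε' hn0 hr' hT hγ)
  · intro d m _ n T L hT
    exact ⟨fun x₀ z => StochBSLS.bslsStoch_queries_le z n L x₀ hT,
      StochBSLS.bslsStoch_space_le d n T L⟩
  · exact ⟨fun m => 80 * m * 2 ^ m * 256 ^ m, fun d m _ β 𝒟 _ xopt u lam band C hp x₀ ε hε hr =>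
      hp.exists_batchSize hε hr⟩
  · refine ⟨fun m => 240 * m * 10000 ^ m, fun d m _ μ₁ Lm π R C K ε δ hε hδ hδ1 hm => ?_⟩
    obtain ⟨s, p, hsize, h⟩ := StochBSLS.exists_prog_unknown_bands d m μ₁ Lm π R C K hε hδ hδ1 hm
    refine ⟨s, p, hsize, fun β 𝒟 _ xopt u lam band hp hK hμ hL hπ x₀ hx => ?_⟩
    obtain ⟨h1, h2⟩ := h β 𝒟 xopt u lam band hp hK hμ hL hπ x₀ hx
    refine ⟨h1, fun z => ?_⟩
    rw [← hL]
    exact h2 z
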